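/- Let $p\ge 0$ and $q\ge 1$ be integers with $p\equiv q \pmod 8$, and suppose that $p\le q$ or $q\ge 2$. Let $\mathbb{R}^{p,q}$ be $\mathbb{R}^{p+q}$ with the bilinear form $\langle x,y\rangle=\sum_{i\le p}x_iy_i-\sum_{i>p}x_iy_i$, and let $\Lambda=\Lambda_{p,q}\subset\mathbb{R}^{p,q}$ be an even unimodular lattice (so $\langle x,x\rangle\in 2\mathbb{Z}$ for all $x\in\Lambda$, and $\Lambda$ equals its dual lattice); if $p=0$, assume that $\Lambda$ contains a vector of norm $-2$. Let $\mathfrak{h}_{p,q}=\mathrm{SO}_0(p,q)/(\mathrm{SO}(p)\times \mathrm{SO}(q))$ be the open set of the Grassmannian formed by the $p$-dimensional subspaces $E\subset\mathbb{R}^{p,q}$ on which the form is positive definite. Every such $E$ is spanned by the vectors $e_j+\sum_{i=1}^{q}\tau_j^i e_{p+i}$ $(1\le j\le p)$ for a unique real matrix $\tau=(\tau_j^i)$, and these $\tau_j^i$ are global real analytic coordinates on $\mathfrak{h}_{p,q}$. Let $\mathcal{O}^+_{p,q}$ be the group of automorphisms of the lattice $\Lambda$ that preserve the orientation of the positive definite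 $p$-dimensional subspaces. Let $$\mathfrak{D}_{p,q}=\mathcal{O}^+_{p,q}\backslash\bigcup_{\delta\in\Lambda,\ \langle\delta,\delta\rangle=-2}\{E\in\mathfrak{h}_{p,q} : E\subset\delta^{\perp}\}\ \subset\ \mathcal{O}^+_{p,q}\backslash\mathfrak{h}_{p,q}$$ be the discriminant locus. A subset of $\mathfrak{h}_{p,q}$ is called real analytic if near every point of $\mathfrak{h}_{p,q}$ it is the common zero set of finitely many real analytic functions, and a subset of $\mathcal{O}^+_{p,q}\backslash\mathfrak{h}_{p,q}$ is called real analytic if its preimage in $\mathfrak{h}_{p,q}$ is. Then $\mathfrak{D}_{p,q}$ is an irreducible real analytic subset of $\mathcal{O}^+_{p,q}\backslash\mathfrak{h}_{p,q}$: it is real analytic and non-empty, and whenever $\mathfrak{D}_{p,q}=A\cup B$ with $A,B$ real analytic subsets of $\mathcal{O}^+_{p,q}\backslash\mathfrak{h}_{p,q}$, then $\mathfrak{D}_{p,q}=A$ or $\mathfrak{D}_{p,q}=B$. -/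

import Mathlib

namespace EvenLattice

/-- The real vector space `ℝ^{p,q}`. -/
abbrev Rpq (p q : ℕ) : Type := Fin p ⊕ Fin q → ℝ

/-- The standard symmetric bilinear form of signature `(p, q)` on `ℝ^{p,q}`. -/
def form {p q : ℕ} (x y : Rpq p q) : ℝ :=
  ∑ i, x (Sum.inl i) * y (Sum.inl i) - ∑ i, x (Sum.inr i) * y (Sum.inr i)

/-- A lattice in `ℝ^{p,q}` is even and unimodular: all norms are even integers, and the lattice
is equal to its dual lattice. -/
structure IsEvenUnimodular {p q : ℕ} (Λ : Submodule ℤ (Rpq p q)) : Prop where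
  even : ∀ x ∈ Λ, ∃ n : ℤ, form x x = 2 * n
  unimodular : ∀ x, x ∈ Λ ↔ ∀ y ∈ Λ, ∃ n : ℤ, form x y = n

/-- The set of lattice vectors of norm `-2`. -/
def normNegTwo {p q : ℕ} (Λ : Submodule ℤ (Rpq p q)) : Set (Rpq p q) :=
  {δ | δ ∈ Λ ∧ form δ δ = -2}

/-- A `p`-dimensional subspace of `ℝ^{p,q}` on which the form is positive definite. -/
def IsPosPlane {p q : ℕ} (E : Submodule ℝ (Rpq p q)) : Prop :=
  Module.finrank ℝ E = p ∧ ∀ x ∈ E, x ≠ 0 → 0 < form x x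

/-- The symmetric space `𝔥_{p,q} = SO₀(p,q) / (SO(p) × SO(q))`, realized in the Grassmannian as
the set of positive definite `p`-dimensional subspaces of `ℝ^{p,q}`. -/
def SymSpace (p q : ℕ) : Type := {E : Submodule ℝ (Rpq p q) // IsPosPlane E}

/-- A basis of a positive definite `p`-dimensional subspace of `ℝ^{p,q}`. -/
def IsPosFrame {p q : ℕ} (e : Fin p → Rpq p q) : Prop :=
  IsPosPlane (Submodule.span ℝ (Set.range e))

/-- Every positive definite `p`-dimensional subspace projects isomorphically onto the standard
`ℝ^p ⊆ ℝ^{p,q}`; it is oriented by means of this projection, so that a basis of it is positively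
oriented when the following determinant is positive. -/
noncomputable def frameDet {p q : ℕ} (e : Fin p → Rpq p q) : ℝ :=
  (Matrix.of fun i j => e j (Sum.inl i)).det

/-- The automorphism group `O_{p,q}` of the lattice `Λ`, as a group of isometries of its real
span `ℝ^{p,q}`. -/
def latticeO {p q : ℕ} (Λ : Submodule ℤ (Rpq p q)) : Subgroup (Rpq p q ≃ₗ[ℝ] Rpq p q) where
  carrier := {g | (∀ x y, form (g x) (g y) = form x y) ∧ ∀ x, g x ∈ Λ ↔ x ∈ Λ}
  one_mem' := ⟨fun _ _ => rfl, fun _ => Iff.rfl⟩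
  mul_mem' := by
    rintro g h ⟨hg, hg'⟩ ⟨hh, hh'⟩
    exact ⟨fun x y => (hg _ _).trans (hh x y), fun x => (hg' _).trans (hh' x)⟩
  inv_mem' := by
    rintro g ⟨hg, hg'⟩
    refine ⟨fun x y => ?_, fun x => ?_⟩
    · have h := hg (g⁻¹ x) (g⁻¹ y)
      have hx : ∀ z, g (g⁻¹ z) = z := fun z => g.apply_symm_apply z
      rw [hx, hx] at h
      exact h.symm
    · have h := hg' (g⁻¹ x)
      have hx : g (g⁻¹ x) = x := g.apply_symm_apply x
      rw [hx] at h
      exact h.symm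

theorem isPosPlane_map {p q : ℕ} {g : Rpq p q ≃ₗ[ℝ] Rpq p q}
    (hg : ∀ x y, form (g x) (g y) = form x y) {E : Submodule ℝ (Rpq p q)} (hE : IsPosPlane E) :
    IsPosPlane (E.map (g : Rpq p q →ₗ[ℝ] Rpq p q)) := by
  refine ⟨(LinearEquiv.finrank_map_eq g E).trans hE.1, ?_⟩
  rintro _ ⟨x, hx, rfl⟩ h0
  have hx0 : x ≠ 0 := by
    rintro rfl
    exact h0 (map_zero g)
  have := hE.2 x hx hx0
  rwa [← hg x x] at this

theorem isPosFrame_comp {p q : ℕ} {g : Rpq p q ≃ₗ[ℝ] Rpq p q}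
    (hg : ∀ x y, form (g x) (g y) = form x y) {e : Fin p → Rpq p q} (he : IsPosFrame e) :
    IsPosFrame (fun i => g (e i)) := by
  have h := isPosPlane_map hg he
  rw [Submodule.map_span, ← Set.range_comp] at h
  exact h

/-- The subgroup `O⁺_{p,q}` of the automorphisms of `Λ` which preserve the orientation of the
positive definite `p`-dimensional subspaces. -/
def latticeOPlus {p q : ℕ} (Λ : Submodule ℤ (Rpq p q)) :
    Subgroup (Rpq p q ≃ₗ[ℝ] Rpq p q) where
  carrier := {g | g ∈ latticeO Λ ∧
    ∀ e : Fin p → Rpq p q, IsPosFrame e → (0 < frameDet (fun i => g (e i)) ↔ 0 < frameDet e)}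
  one_mem' := ⟨(latticeO Λ).one_mem, fun _ _ => Iff.rfl⟩
  mul_mem' := by
    rintro g h ⟨hg, hg'⟩ ⟨hh, hh'⟩
    exact ⟨(latticeO Λ).mul_mem hg hh, fun e he =>
      (hg' (fun i => h (e i)) (isPosFrame_comp hh.1 he)).trans (hh' e he)⟩
  inv_mem' := by
    rintro g ⟨hg, hg'⟩
    have hi := (latticeO Λ).inv_mem hg
    refine ⟨hi, fun e he => ?_⟩
    have h := hg' (fun i => g⁻¹ (e i)) (isPosFrame_comp hi.1 he)
    have hx : ∀ z, g (g⁻¹ z) = z := fun z => g.apply_symm_apply z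
    simp only [hx] at h
    exact h.symm

/-- `O⁺_{p,q}` acts on `𝔥_{p,q}` by taking images of subspaces. -/
instance {p q : ℕ} (Λ : Submodule ℤ (Rpq p q)) :
    MulAction (latticeOPlus Λ) (SymSpace p q) where
  smul g E := ⟨E.1.map ((g : Rpq p q ≃ₗ[ℝ] Rpq p q) : Rpq p q →ₗ[ℝ] Rpq p q),
    isPosPlane_map g.2.1.1 E.2⟩
  one_smul E := Subtype.ext (Submodule.map_id E.1)
  mul_smul g h E := Subtype.ext (Submodule.map_comp
    ((h : Rpq p q ≃ₗ[ℝ] Rpq p q) : Rpq p q →ₗ[ℝ] Rpq p q)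
    ((g : Rpq p q ≃ₗ[ℝ] Rpq p q) : Rpq p q →ₗ[ℝ] Rpq p q) E.1)

/-- The quotient `O⁺_{p,q} \ 𝔥_{p,q}`. -/
abbrev ModularQuotient {p q : ℕ} (Λ : Submodule ℤ (Rpq p q)) : Type :=
  MulAction.orbitRel.Quotient (latticeOPlus Λ) (SymSpace p q)

/-- The quotient map `𝔥_{p,q} → O⁺_{p,q} \ 𝔥_{p,q}`. -/
def toQuotient {p q : ℕ} (Λ : Submodule ℤ (Rpq p q)) (E : SymSpace p q) : ModularQuotient Λ :=
  Quotient.mk _ E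

/-- `𝔥_{p,q-1}(δ)`: the points of `𝔥_{p,q}` whose subspace lies in the orthogonal complement
of `δ`. -/
def orthLocus {p q : ℕ} (δ : Rpq p q) : Set (SymSpace p q) :=
  {E | ∀ x ∈ E.1, form x δ = 0}

/-- The discriminant locus `𝔇_{p,q}` in `O⁺_{p,q} \ 𝔥_{p,q}`. -/
def discriminantLocus {p q : ℕ} (Λ : Submodule ℤ (Rpq p q)) : Set (ModularQuotient Λ) :=
  toQuotient Λ '' ⋃ δ ∈ normNegTwo Λ, orthLocus δ

/-- The subspace `E_τ` spanned by the vectors `e_j + ∑ i, τ j i • e_{p+i}`, `j = 1, …, p`. Every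
point of `𝔥_{p,q}` is `E_τ` for exactly one `τ`: the `τ j i` are global coordinates which
identify `𝔥_{p,q}` with an open subset of `ℝ^{pq}`. -/
def graphPlane {p q : ℕ} (τ : Fin p → Fin q → ℝ) : Submodule ℝ (Rpq p q) :=
  Submodule.span ℝ (Set.range fun j : Fin p => (Sum.elim (Pi.single j 1) (τ j) : Rpq p q))

/-- Real analytic subsets of `𝔥_{p,q}`: near every point of `𝔥_{p,q}` the set is, in the global
coordinates, the common zero set of finitely many real analytic functions. -/
def IsAnalyticSubset {p q : ℕ} (A : Set (SymSpace p q)) : Prop :=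
  ∀ τ : Fin p → Fin q → ℝ, IsPosPlane (graphPlane τ) →
    ∃ O ∈ nhds τ, ∃ (n : ℕ) (f : Fin n → (Fin p → Fin q → ℝ) → ℝ),
      (∀ k, AnalyticOnNhd ℝ (f k) O) ∧
      ∀ σ ∈ O, ∀ hσ : IsPosPlane (graphPlane σ),
        (⟨graphPlane σ, hσ⟩ : SymSpace p q) ∈ A ↔ ∀ k, f k σ = 0

/-- Real analytic subsets of the quotient `O⁺_{p,q} \ 𝔥_{p,q}`: the preimage in `𝔥_{p,q}` is real
analytic. -/
def IsQuotientAnalytic {p q : ℕ} {Λ : Submodule ℤ (Rpq p q)} (A : Set (ModularQuotient Λ)) :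
    Prop :=
  IsAnalyticSubset (toQuotient Λ ⁻¹' A)

/-- An irreducible real analytic subset of the quotient: a nonempty real analytic subset which is
not the union of two proper real analytic subsets. -/
structure IsIrreducibleAnalytic {p q : ℕ} {Λ : Submodule ℤ (Rpq p q)}
    (D : Set (ModularQuotient Λ)) : Prop where
  analytic : IsQuotientAnalytic D
  nonempty : D.Nonempty
  irreducible : ∀ A B : Set (ModularQuotient Λ), IsQuotientAnalytic A → IsQuotientAnalytic B →
    D = A ∪ B → D = A ∨ D = B

end EvenLattice

/-!
In the graph coordinates `τ` the condition `E ⊆ δ^⊥` is a system of affine equations, and the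
positive definite subspaces form a convex set of matrices `τ`. Hence each `orthLocus δ` is convex in
these coordinates. If it is covered by two real analytic sets, it lies in one of them: restricted to
a segment these sets are locally given by analytic functions of one variable
(`orthLocus_subset_or`). The discriminant locus is analytic because near a given subspace only
finitely many `δ` occur (`isQuotientAnalytic_discriminantLocus`). So
irreducibility follows once all the sets `orthLocus δ`, with `δ` a lattice vector of norm `-2`, are
shown to have the same image in the quotient
(`exists_mem_orthLocus_toQuotient_eq`). This is trivial for `p = 0`, where the symmetric space is a
point, and in signature `(1, 1)`, where `δ` is unique up to sign. In all other cases the group acts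
transitively on the vectors of norm `-2`, which is an arithmetic fact about the lattice.

The transitivity rests on the existence of isotropic vectors in `δ^⊥`. It is obtained without the
Hasse-Minkowski theorem, by computing the Witt class of a unimodular lattice `M` over `ℤ`. The
lattice becomes metabolic after a diagonal form is added (`exists_cobounds`), and this diagonal form
can be changed by elementary relations between the symbols `⟨a⟩`. Let `p` be the largest prime
dividing its entries. By means of `⟨a⟩ + ⟨b⟩ = ⟨a + b⟩ + ⟨ab(a + b)⟩` the entries divisible by `p`
become `p • T` with `T` anisotropic modulo `p`, at the cost of entries with smaller prime factors.
As `M` is nondegenerate modulo `p`, a reduction of the Lagrangian subgroup modulo `p` shows that `T`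
is empty (`IsMetabolic.unimodularAt`). When all primes are gone only entries `±1` remain, and their
number is determined by the signature (`Realized.cobounds`). Removing them again gives an isotropic
subgroup of rank `min p q`, and an isotropic vector in `δ^⊥`
(`Realized.exists_isotropic_orthogonal`).

An isotropic vector in `δ^⊥` leads to a hyperbolic plane in `δ^⊥` (`exists_hypPair_orthogonal`).
The Eichler criterion, applied in the sum of the lattice with a further hyperbolic plane, then
produces an isometry carrying `δ'` to `δ` (`exists_isometry_of_norm`). If it reverses the
orientation of the positive definite subspaces, it is composed with the reflection in a vector of
norm `2` of the hyperbolic plane, which fixes `δ` (`exists_latticeOPlus`).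
-/

namespace EvenLattice

open Module

/-! ### Integral lattices and their metabolic stabilisations -/

/-- An integral lattice: a finitely generated free abelian group with an integer-valued symmetric
bilinear form, which may be degenerate. -/
structure IntLattice where
  /-- The underlying abelian group. -/
  carrier : Type
  [grp : AddCommGroup carrier]
  [free : Module.Free ℤ carrier]
  [fin : Module.Finite ℤ carrier]
  /-- The bilinear form. -/
  bil : LinearMap.BilinForm ℤ carrier
  symm : ∀ x y, bil x y = bil y x

namespace IntLattice

instance : CoeSort IntLattice Type := ⟨IntLattice.carrier⟩

attribute [instance] IntLattice.grp IntLattice.free IntLattice.fin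

/-- The orthogonal sum `M ⊕ ⟨a⟩` of `M` with a rank-one lattice whose generator has norm `a`. -/
def adjoin (M : IntLattice) (a : ℤ) : IntLattice where
  carrier := M × ℤ
  bil := LinearMap.mk₂ ℤ (fun x y => M.bil x.1 y.1 + a * (x.2 * y.2))
    (fun x x' y => by simp; ring) (fun c x y => by simp; ring)
    (fun x y y' => by simp; ring) (fun c x y => by simp; ring)
  symm x y := by
    simp [M.symm x.1 y.1, mul_comm x.2 y.2]

/-- The component in `M` of an element of `M ⊕ ⟨a⟩`. -/
def base (M : IntLattice) (a : ℤ) : M.adjoin a →ₗ[ℤ] M where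
  toFun x := Prod.fst x
  map_add' _ _ := rfl
  map_smul' _ _ := rfl

/-- The coordinate of an element of `M ⊕ ⟨a⟩` along the adjoined generator. -/
def coord (M : IntLattice) (a : ℤ) : M.adjoin a →ₗ[ℤ] ℤ where
  toFun x := Prod.snd x
  map_add' _ _ := rfl
  map_smul' _ _ := rfl

/-- The map to `M ⊕ ⟨a⟩` with given components. -/
def lift (M : IntLattice) (a : ℤ) {W : Type*} [AddCommGroup W] (f : W →ₗ[ℤ] M) (g : W →ₗ[ℤ] ℤ) :
    W →ₗ[ℤ] M.adjoin a where
  toFun w := (f w, g w)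
  map_add' x y := by
    rw [map_add, map_add]
    rfl
  map_smul' c x := by
    rw [map_smul, map_smul]
    rfl

/-- The element of `M ⊕ ⟨a⟩` with given components. -/
def pair (M : IntLattice) (a : ℤ) (x : M) (t : ℤ) : M.adjoin a := (x, t)

@[simp] theorem base_lift (M : IntLattice) (a : ℤ) {W : Type*} [AddCommGroup W] (f : W →ₗ[ℤ] M)
    (g : W →ₗ[ℤ] ℤ) (w : W) : M.base a (M.lift a f g w) = f w := rfl

@[simp] theorem coord_lift (M : IntLattice) (a : ℤ) {W : Type*} [AddCommGroup W] (f : W →ₗ[ℤ] M)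
    (g : W →ₗ[ℤ] ℤ) (w : W) : M.coord a (M.lift a f g w) = g w := rfl

@[simp] theorem base_pair (M : IntLattice) (a : ℤ) (x : M) (t : ℤ) :
    M.base a (M.pair a x t) = x := rfl

@[simp] theorem coord_pair (M : IntLattice) (a : ℤ) (x : M) (t : ℤ) :
    M.coord a (M.pair a x t) = t := rfl

theorem adjoin_ext {M : IntLattice} {a : ℤ} {x y : M.adjoin a} (h : M.base a x = M.base a y)
    (h' : M.coord a x = M.coord a y) : x = y := Prod.ext h h'

theorem adjoin_bil (M : IntLattice) (a : ℤ) (x y : M.adjoin a) :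
    (M.adjoin a).bil x y = M.bil (M.base a x) (M.base a y) + a * (M.coord a x * M.coord a y) := rfl

theorem finrank_adjoin (M : IntLattice) (a : ℤ) :
    finrank ℤ (M.adjoin a) = finrank ℤ M + 1 := by
  have e : (M.adjoin a) ≃ₗ[ℤ] M × ℤ :=
    { (M.base a).prod (M.coord a) with
      invFun := fun x => x
      left_inv := fun _ => rfl
      right_inv := fun _ => rfl }
  rw [e.finrank_eq]
  simp

/-- A lattice is metabolic if it has a totally isotropic subgroup of at least half its rank. -/
def IsMetabolic (M : IntLattice) : Prop :=
  ∃ N : Submodule ℤ M, finrank ℤ M ≤ 2 * finrank ℤ N ∧ ∀ x ∈ N, M.bil x x = 0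

theorem bil_eq_zero_of_isotropic {M : IntLattice} {N : Submodule ℤ M}
    (hN : ∀ x ∈ N, M.bil x x = 0) {x y : M} (hx : x ∈ N) (hy : y ∈ N) : M.bil x y = 0 := by
  have h := hN _ (N.add_mem hx hy)
  have h1 := M.symm x y
  simp only [map_add, LinearMap.add_apply, hN x hx, hN y hy] at h
  omega

/-- A finite-index embedding `M → M'` which multiplies norms by a nonzero square; it exhibits
`M ⊗ ℚ` and `M' ⊗ ℚ` as isometric spaces. -/
def Isog (M M' : IntLattice) : Prop :=
  finrank ℤ M' ≤ finrank ℤ M ∧ ∃ (f : M →ₗ[ℤ] M') (s : ℤ), s ≠ 0 ∧ Function.Injective f ∧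
    ∀ x, M'.bil (f x) (f x) = s ^ 2 * M.bil x x

theorem IsMetabolic.of_isog {M M' : IntLattice} (h : Isog M M') (hM : M.IsMetabolic) :
    M'.IsMetabolic := by
  obtain ⟨hr, f, s, -, hf, hs⟩ := h
  obtain ⟨N, hN, hN'⟩ := hM
  refine ⟨N.map f, ?_, ?_⟩
  · rw [← (N.equivMapOfInjective f hf).finrank_eq]
    omega
  · rintro _ ⟨x, hx, rfl⟩
    rw [hs, hN' x hx, mul_zero]

theorem Isog.adjoin {M M' : IntLattice} (h : Isog M M') (a : ℤ) :
    Isog (M.adjoin a) (M'.adjoin a) := by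
  obtain ⟨hr, f, s, hs0, hf, hs⟩ := h
  refine ⟨by rw [finrank_adjoin, finrank_adjoin]; omega,
    M'.lift a (f ∘ₗ M.base a) (s • M.coord a), s, hs0, ?_, ?_⟩
  · intro x y hxy
    have h1 := congrArg (M'.base a) hxy
    have h2 := congrArg (M'.coord a) hxy
    simp only [base_lift, coord_lift, LinearMap.comp_apply, LinearMap.smul_apply] at h1 h2
    exact adjoin_ext (hf h1) (mul_left_cancel₀ hs0 h2)
  · intro x
    simp only [adjoin_bil, base_lift, coord_lift, LinearMap.comp_apply, LinearMap.smul_apply, hs,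
      smul_eq_mul]
    ring

/-- `M ⊕ ⟨a₁⟩ ⊕ ⋯ ⊕ ⟨aₖ⟩` is metabolic. For nondegenerate forms this means that `M` is Witt
equivalent over `ℚ` to `⟨-a₁, …, -aₖ⟩`. -/
def Cobounds (M : IntLattice) (l : List ℤ) : Prop := (l.foldl adjoin M).IsMetabolic

theorem Cobounds.of_isog {M M' : IntLattice} (h : Isog M M') (l : List ℤ) (hl : M.Cobounds l) :
    M'.Cobounds l := by
  induction l generalizing M M' with
  | nil => exact IsMetabolic.of_isog h hl
  | cons a l ih => exact ih (h.adjoin a) hl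

theorem cobounds_append (M : IntLattice) (l m : List ℤ) :
    M.Cobounds (l ++ m) ↔ (l.foldl adjoin M).Cobounds m := by
  simp [Cobounds, List.foldl_append]

/-- The diagonal form `l` may be replaced by `l'` in every metabolic sum. -/
def WittLe (l l' : List ℤ) : Prop := ∀ M : IntLattice, M.Cobounds l → M.Cobounds l'

theorem WittLe.refl (l : List ℤ) : WittLe l l := fun _ h => h

theorem WittLe.trans {l l' l'' : List ℤ} (h : WittLe l l') (h' : WittLe l' l'') :
    WittLe l l'' := fun M hM => h' M (h M hM)

theorem WittLe.append_left {l l' : List ℤ} (h : WittLe l l') (m : List ℤ) :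
    WittLe (m ++ l) (m ++ l') := fun M hM => by
  rw [cobounds_append] at hM ⊢
  exact h _ hM

theorem isog_swap (M : IntLattice) (a b : ℤ) :
    Isog ((M.adjoin a).adjoin b) ((M.adjoin b).adjoin a) := by
  refine ⟨by simp [finrank_adjoin], (M.adjoin b).lift a (M.lift b (M.base a ∘ₗ (M.adjoin a).base b)
    ((M.adjoin a).coord b)) (M.coord a ∘ₗ (M.adjoin a).base b), 1, one_ne_zero, ?_, ?_⟩
  · intro x y h
    have h1 := congrArg ((M.adjoin b).base a) h
    have h2 := congrArg ((M.adjoin b).coord a) h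
    have h3 := congrArg (M.base b) h1
    have h4 := congrArg (M.coord b) h1
    exact adjoin_ext (adjoin_ext h3 h2) h4
  · intro x
    simp only [adjoin_bil, base_lift, coord_lift, LinearMap.comp_apply]
    ring

theorem WittLe.of_perm {l l' : List ℤ} (h : l.Perm l') : WittLe l l' := by
  induction h with
  | nil => exact WittLe.refl _
  | cons a _ ih => exact fun M hM => ih _ hM
  | swap a b l => exact fun M hM => Cobounds.of_isog (isog_swap M b a) l hM
  | trans _ _ ih ih' => exact ih.trans ih'

theorem WittLe.append_right {l l' : List ℤ} (h : WittLe l l') (m : List ℤ) :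
    WittLe (l ++ m) (l' ++ m) :=
  (WittLe.of_perm List.perm_append_comm).trans
    ((h.append_left m).trans (WittLe.of_perm List.perm_append_comm))

theorem wittLe_mul_sq (a : ℤ) {c : ℤ} (hc : c ≠ 0) : WittLe [a * c ^ 2] [a] := fun M hM => by
  refine IsMetabolic.of_isog (M := M.adjoin (a * c ^ 2)) (M' := M.adjoin a) ?_ hM
  refine ⟨by simp [finrank_adjoin], M.lift a (M.base _) (c • M.coord _), 1, one_ne_zero, ?_, ?_⟩
  · intro x y h
    have h1 := congrArg (M.base a) h
    have h2 := congrArg (M.coord a) h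
    exact adjoin_ext h1 (mul_left_cancel₀ hc h2)
  · intro x
    simp only [adjoin_bil, base_lift, coord_lift, LinearMap.smul_apply, smul_eq_mul]
    ring

theorem wittLe_of_mul_sq (a : ℤ) {c : ℤ} (hc : c ≠ 0) : WittLe [a] [a * c ^ 2] := fun M hM => by
  refine IsMetabolic.of_isog (M := M.adjoin a) (M' := M.adjoin (a * c ^ 2)) ?_ hM
  refine ⟨by simp [finrank_adjoin], M.lift _ (c • M.base _) (M.coord _), c, hc, ?_, ?_⟩
  · intro x y h
    have h1 := congrArg (M.base _) h
    have h2 := congrArg (M.coord _) h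
    exact adjoin_ext (smul_right_injective _ hc h1) h2
  · intro x
    simp only [adjoin_bil, base_lift, coord_lift, LinearMap.smul_apply, smul_eq_mul, map_smul]
    ring

/-- The relation `⟨a⟩ + ⟨b⟩ = ⟨a + b⟩ + ⟨ab(a + b)⟩`, from the orthogonal vectors `(1, 1)` and
`(b, -a)` of `⟨a, b⟩`. -/
theorem wittLe_add {a b : ℤ} (hab : a + b ≠ 0) : WittLe [a, b] [a + b, a * b * (a + b)] :=
    fun M hM => by
  refine IsMetabolic.of_isog (M := (M.adjoin a).adjoin b)
    (M' := (M.adjoin (a + b)).adjoin (a * b * (a + b))) ?_ hM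
  refine ⟨by simp [finrank_adjoin], lift _ _ (lift _ _ ((a + b) • (M.base a ∘ₗ base _ b))
    (a • (M.coord a ∘ₗ base _ b) + b • coord _ b)) ((M.coord a ∘ₗ base _ b) - coord _ b),
    a + b, hab, ?_, ?_⟩
  · intro x y h
    have h1 := congrArg (base _ _) h
    have h2 := congrArg (coord _ _) h
    have h3 := congrArg (base _ _) h1
    have h4 := congrArg (coord _ _) h1
    simp only [base_lift, coord_lift, LinearMap.comp_apply, LinearMap.smul_apply, smul_eq_mul,
      LinearMap.add_apply, LinearMap.sub_apply] at h2 h3 h4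
    have h3 := smul_right_injective _ hab h3
    have h5 : (a + b) * (coord M a (base _ b x) - coord M a (base _ b y)) = 0 := by
      linear_combination h4 + b * h2
    have h6 := (mul_eq_zero.mp h5).resolve_left hab
    exact adjoin_ext (adjoin_ext h3 (by omega)) (by omega)
  · intro x
    simp only [adjoin_bil, base_lift, coord_lift, LinearMap.comp_apply, LinearMap.smul_apply,
      smul_eq_mul, LinearMap.add_apply, LinearMap.sub_apply, map_smul]
    ring

theorem wittLe_of_add {a b : ℤ} (hab : a + b ≠ 0) : WittLe [a + b, a * b * (a + b)] [a, b] :=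
    fun M hM => by
  refine IsMetabolic.of_isog (M := (M.adjoin (a + b)).adjoin (a * b * (a + b)))
    (M' := (M.adjoin a).adjoin b) ?_ hM
  refine ⟨by simp [finrank_adjoin], lift _ _ (lift _ _ (M.base _ ∘ₗ base _ _)
    ((M.coord _ ∘ₗ base _ _) + b • coord _ _)) ((M.coord _ ∘ₗ base _ _) - a • coord _ _),
    1, one_ne_zero, ?_, ?_⟩
  · intro x y h
    have h1 := congrArg (base _ _) h
    have h2 := congrArg (coord _ _) h
    have h3 := congrArg (base _ _) h1
    have h4 := congrArg (coord _ _) h1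
    simp only [base_lift, coord_lift, LinearMap.comp_apply, LinearMap.smul_apply, smul_eq_mul,
      LinearMap.add_apply, LinearMap.sub_apply] at h2 h3 h4
    have h5 : (a + b) * (coord _ _ x - coord _ _ y) = 0 := by
      linear_combination h4 - h2
    have h6 : coord _ _ x = coord _ _ y := by
      have := (mul_eq_zero.mp h5).resolve_left hab
      omega
    rw [h6] at h4
    exact adjoin_ext (adjoin_ext h3 (by linarith)) h6
  · intro x
    simp only [adjoin_bil, base_lift, coord_lift, LinearMap.comp_apply, LinearMap.smul_apply,
      smul_eq_mul, LinearMap.add_apply, LinearMap.sub_apply]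
    ring

theorem finrank_map_add_finrank_inf_ker {M M' : Type*} [AddCommGroup M] [Module.Free ℤ M]
    [Module.Finite ℤ M] [AddCommGroup M'] (f : M →ₗ[ℤ] M') (N : Submodule ℤ M) :
    finrank ℤ (N.map f) + finrank ℤ (N ⊓ LinearMap.ker f : Submodule ℤ M) = finrank ℤ N := by
  have h := (LinearMap.ker (f.domRestrict N)).finrank_quotient_add_finrank
  rw [(f.domRestrict N).quotKerEquivRange.finrank_eq, LinearMap.range_domRestrict] at h
  rw [← h, ← Submodule.map_comap_subtype, LinearMap.ker_domRestrict]
  congr 1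
  exact ((Submodule.equivMapOfInjective N.subtype N.subtype_injective _).finrank_eq).symm

/-- A linear functional cuts down the rank by at most one. -/
theorem finrank_le_finrank_inf_ker_add_one {M : Type*} [AddCommGroup M] [Module.Free ℤ M]
    [Module.Finite ℤ M] (f : M →ₗ[ℤ] ℤ) (N : Submodule ℤ M) :
    finrank ℤ N ≤ finrank ℤ (N ⊓ LinearMap.ker f : Submodule ℤ M) + 1 := by
  rw [← finrank_map_add_finrank_inf_ker f N]
  have := Submodule.finrank_le (N.map f)
  simp at this
  omega

theorem isotropic_sup_span {M : IntLattice} {N : Submodule ℤ M} (hN : ∀ x ∈ N, M.bil x x = 0)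
    {v : M} (hv : M.bil v v = 0) (hNv : ∀ x ∈ N, M.bil x v = 0) :
    ∀ x ∈ N ⊔ Submodule.span ℤ {v}, M.bil x x = 0 := by
  intro x hx
  obtain ⟨y, hy, z, hz, rfl⟩ := Submodule.mem_sup.mp hx
  obtain ⟨c, rfl⟩ := Submodule.mem_span_singleton.mp hz
  simp [hN y hy, hv, hNv y hy, M.symm v y]

/-- A vector outside the kernel of a functional which vanishes on `N` increases the rank. -/
theorem finrank_add_one_le_finrank_sup_span {M : Type*} [AddCommGroup M] [Module.Free ℤ M]
    [Module.Finite ℤ M] {N : Submodule ℤ M} (g : M →ₗ[ℤ] ℤ) (hg : ∀ x ∈ N, g x = 0) {v : M}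
    (hv : g v ≠ 0) : finrank ℤ N + 1 ≤ finrank ℤ (N ⊔ Submodule.span ℤ {v} : Submodule ℤ M) := by
  rw [← finrank_map_add_finrank_inf_ker g (N ⊔ Submodule.span ℤ {v}), add_comm]
  have hle : N ≤ (N ⊔ Submodule.span ℤ {v}) ⊓ LinearMap.ker g :=
    le_inf le_sup_left fun x hx => hg x hx
  refine add_le_add ?_ (Submodule.finrank_mono hle)
  rw [Nat.one_le_iff_ne_zero]
  intro h0
  have h1 := Submodule.finrank_eq_zero.mp h0
  have h2 : g v ∈ (N ⊔ Submodule.span ℤ {v}).map g :=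
    ⟨v, Submodule.mem_sup_right (Submodule.mem_span_singleton_self v), rfl⟩
  rw [h1] at h2
  exact hv h2

/-- A Lagrangian subgroup of `M` and the isotropic vector `(1, 1)` of `⟨c, -c⟩` span a Lagrangian
subgroup of the sum. -/
theorem wittLe_nil_pair (c : ℤ) : WittLe [] [c, -c] := by
  intro M hM
  obtain ⟨N, hN, hN'⟩ : M.IsMetabolic := hM
  change ((M.adjoin c).adjoin (-c)).IsMetabolic
  let f : M →ₗ[ℤ] (M.adjoin c).adjoin (-c) := lift _ _ (lift _ _ LinearMap.id 0) 0
  have hf : Function.Injective f := fun x y h =>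
    congrArg (base M c) (congrArg (base (M.adjoin c) (-c)) h)
  have hc : ∀ x ∈ N.map f, coord (M.adjoin c) (-c) x = 0 := by
    rintro _ ⟨x, -, rfl⟩
    rfl
  refine ⟨N.map f ⊔ Submodule.span ℤ {pair _ _ (pair _ _ 0 1) 1}, ?_, ?_⟩
  · have h1 := finrank_add_one_le_finrank_sup_span (v := pair (M.adjoin c) (-c) (pair M c 0 1) 1)
      (coord (M.adjoin c) (-c)) hc (by simp)
    rw [← (N.equivMapOfInjective f hf).finrank_eq] at h1
    rw [finrank_adjoin, finrank_adjoin]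
    omega
  · refine isotropic_sup_span ?_ ?_ ?_
    · rintro _ ⟨x, hx, rfl⟩
      simp [f, adjoin_bil, hN' x hx]
    · simp [adjoin_bil]
    · rintro _ ⟨x, hx, rfl⟩
      simp [f, adjoin_bil]

theorem wittLe_pair_nil {c : ℤ} (hc : c ≠ 0) : WittLe [c, -c] [] := by
  intro M hM
  obtain ⟨L, hL, hL'⟩ : ((M.adjoin c).adjoin (-c)).IsMetabolic := hM
  change M.IsMetabolic
  rw [finrank_adjoin, finrank_adjoin] at hL
  let t := M.coord c ∘ₗ (M.adjoin c).base (-c)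
  let u := (M.adjoin c).coord (-c)
  let π := M.base c ∘ₗ (M.adjoin c).base (-c)
  -- `π` maps `L ∩ {t = u}` to an isotropic subgroup; it remains to count ranks.
  have hbil : ∀ x y, ((M.adjoin c).adjoin (-c)).bil x y =
      M.bil (π x) (π y) + c * (t x * t y) - c * (u x * u y) := fun x y => by
    simp only [adjoin_bil, π, t, u, LinearMap.comp_apply]
    ring
  refine ⟨(L ⊓ LinearMap.ker (t - u)).map π, ?_, ?_⟩
  swap
  · rintro _ ⟨x, ⟨hx, hx'⟩, rfl⟩
    have h1 := hL' x hx
    have h2 : t x = u x := sub_eq_zero.mp hx'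
    rw [hbil, h2] at h1
    linarith
  have h1 := finrank_map_add_finrank_inf_ker π (L ⊓ LinearMap.ker (t - u))
  have h2 := finrank_le_finrank_inf_ker_add_one (t - u) L
  by_cases hker : (L ⊓ LinearMap.ker (t - u)) ⊓ LinearMap.ker π = ⊥
  · rw [hker, finrank_bot] at h1
    omega
  · obtain ⟨x, ⟨⟨hx, hxt⟩, hxπ⟩, hx0⟩ := Submodule.exists_mem_ne_zero_of_ne_bot hker
    have hxt : t x = u x := sub_eq_zero.mp hxt
    have hxπ : π x = 0 := hxπ
    have hux : u x ≠ 0 := fun h => hx0 (adjoin_ext (adjoin_ext hxπ (hxt.trans h)) h)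
    have hle : L ⊓ LinearMap.ker (t - u) = L := by
      refine inf_eq_left.mpr fun y hy => ?_
      have h3 := bil_eq_zero_of_isotropic hL' hx hy
      rw [hbil, hxπ, hxt, map_zero, LinearMap.zero_apply, zero_add, ← mul_sub, ← mul_sub] at h3
      exact ((mul_eq_zero.mp h3).resolve_left hc |> mul_eq_zero.mp).resolve_left hux
    have h4 := finrank_map_add_finrank_inf_ker u
      ((L ⊓ LinearMap.ker (t - u)) ⊓ LinearMap.ker π)
    have h5 : ((L ⊓ LinearMap.ker (t - u)) ⊓ LinearMap.ker π) ⊓ LinearMap.ker u = ⊥ := by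
      rw [eq_bot_iff]
      rintro y ⟨⟨⟨-, hyt⟩, hyπ⟩, hyu⟩
      have hyt : t y = u y := sub_eq_zero.mp hyt
      have hyu : u y = 0 := hyu
      exact adjoin_ext (adjoin_ext hyπ (hyt.trans hyu)) hyu
    have h6 := Submodule.finrank_le
      (((L ⊓ LinearMap.ker (t - u)) ⊓ LinearMap.ker π).map u)
    rw [h5, finrank_bot] at h4
    rw [finrank_self] at h6
    rw [hle] at h1 h4 h6 ⊢
    omega

/-- Every integral lattice cobounds a nondegenerate diagonal form: an isotropic subgroup `N` that
is too small is enlarged by `(x, 1) ∈ M ⊕ ⟨-x²⟩`, where `x ∈ N^⊥` has nonzero norm. -/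
theorem exists_cobounds (M : IntLattice) : ∃ l : List ℤ, (∀ a ∈ l, a ≠ 0) ∧ M.Cobounds l := by
  suffices h : ∀ (k : ℕ) (M : IntLattice) (N : Submodule ℤ M), (∀ x ∈ N, M.bil x x = 0) →
      finrank ℤ M ≤ 2 * finrank ℤ N + k → ∃ l : List ℤ, (∀ a ∈ l, a ≠ 0) ∧ M.Cobounds l from
    h (finrank ℤ M) M ⊥ (by simp) (by omega)
  intro k
  induction k with
  | zero => exact fun M N hN hr => ⟨[], by simp, N, hr, hN⟩
  | succ k ih =>
    intro M N hN hr
    let φ : M →ₗ[ℤ] (N →ₗ[ℤ] ℤ) := (LinearMap.lcomp ℤ ℤ N.subtype) ∘ₗ M.bil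
    by_cases hx : ∃ x : M, (∀ y ∈ N, M.bil x y = 0) ∧ M.bil x x ≠ 0
    · obtain ⟨x, hxN, hxx⟩ := hx
      let f : M →ₗ[ℤ] M.adjoin (-M.bil x x) := lift _ _ LinearMap.id 0
      have hf : Function.Injective f := fun y z h => congrArg (base M _) h
      have hc : ∀ y ∈ N.map f, coord M _ y = 0 := by
        rintro _ ⟨y, -, rfl⟩
        rfl
      have h1 := finrank_add_one_le_finrank_sup_span (v := pair M (-M.bil x x) x 1)
        (coord M _) hc (by simp)
      rw [← (N.equivMapOfInjective f hf).finrank_eq] at h1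
      have h2 : ∀ y ∈ N.map f ⊔ Submodule.span ℤ {pair M (-M.bil x x) x 1},
          (M.adjoin (-M.bil x x)).bil y y = 0 := by
        refine isotropic_sup_span ?_ ?_ ?_
        · rintro _ ⟨y, hy, rfl⟩
          simp [f, adjoin_bil, hN y hy]
        · simp [adjoin_bil]
        · rintro _ ⟨y, hy, rfl⟩
          simp [f, adjoin_bil, M.symm y x, hxN y hy]
      obtain ⟨l, hl, hl'⟩ := ih _ _ h2 (by rw [finrank_adjoin]; omega)
      exact ⟨-M.bil x x :: l, by simpa [hxx] using hl, hl'⟩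
    · push Not at hx
      refine ⟨[], by simp, LinearMap.ker φ, ?_,
        fun x h => hx x fun y hy => LinearMap.congr_fun h ⟨y, hy⟩⟩
      · have h1 := (LinearMap.ker φ).finrank_quotient_add_finrank
        rw [φ.quotKerEquivRange.finrank_eq] at h1
        have h2 := Submodule.finrank_le (LinearMap.range φ)
        have h3 : finrank ℤ (N →ₗ[ℤ] ℤ) = finrank ℤ N := by
          rw [Module.finrank_linearMap, finrank_self, mul_one]
        have h4 : finrank ℤ N ≤ finrank ℤ (LinearMap.ker φ) := by
          refine Submodule.finrank_mono fun x hx => ?_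
          ext y
          exact bil_eq_zero_of_isotropic hN hx y.2
        change finrank ℤ M ≤ 2 * finrank ℤ (LinearMap.ker φ)
        omega

end IntLattice
end EvenLattice

namespace EvenLattice

open Module

namespace IntLattice

/-! ### Removing one prime from a diagonal form -/

/-- A nonzero integer all of whose prime factors are less than `p`. -/
def Smooth (p : ℕ) (a : ℤ) : Prop := a.natAbs ∈ Nat.smoothNumbers p

/-- A nonzero integer of absolute value less than `p`. -/
def Small (p : ℕ) (a : ℤ) : Prop := a ≠ 0 ∧ |a| < p

theorem Smooth.ne_zero {p : ℕ} {a : ℤ} (h : Smooth p a) : a ≠ 0 :=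
  Int.natAbs_ne_zero.mp (Nat.ne_zero_of_mem_smoothNumbers h)

theorem Smooth.mul {p : ℕ} {a b : ℤ} (ha : Smooth p a) (hb : Smooth p b) : Smooth p (a * b) := by
  unfold Smooth
  rw [Int.natAbs_mul]
  exact Nat.mul_mem_smoothNumbers ha hb

theorem Smooth.neg {p : ℕ} {a : ℤ} (ha : Smooth p a) : Smooth p (-a) := by
  unfold Smooth
  rwa [Int.natAbs_neg]

theorem Small.smooth {p : ℕ} {a : ℤ} (h : Small p a) : Smooth p a :=
  Nat.mem_smoothNumbers_of_lt (Int.natAbs_pos.mpr h.1) (by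
    have h1 := h.2
    rw [Int.abs_eq_natAbs] at h1
    exact_mod_cast h1)

theorem Small.not_dvd {p : ℕ} {a : ℤ} (h : Small p a) : ¬ (p : ℤ) ∣ a := fun hd =>
  h.1 (Int.eq_zero_of_abs_lt_dvd hd h.2)

theorem small_one {p : ℕ} (hp : p.Prime) : Small p 1 :=
  ⟨one_ne_zero, by simpa using hp.one_lt⟩

theorem small_emod {p : ℕ} (hp : p.Prime) {a : ℤ} (h : ¬ (p : ℤ) ∣ a) : Small p (a % p) := by
  have h0 : (0 : ℤ) < p := by exact_mod_cast hp.pos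
  have h1 := Int.emod_nonneg a h0.ne'
  have h2 := Int.emod_lt_of_pos a h0
  exact ⟨fun h3 => h (Int.dvd_of_emod_eq_zero h3), by rwa [abs_of_nonneg h1]⟩

/-- Up to diagonal entries prime to `p` and smaller prime factors, `⟨pv⟩` may be replaced
by `⟨pw⟩`. -/
def Reduces (p : ℕ) (v w : ℤ) : Prop :=
  ∃ S : List ℤ, (∀ a ∈ S, Smooth p a) ∧ WittLe [p * v] (p * w :: S)

theorem Reduces.refl (p : ℕ) (v : ℤ) : Reduces p v v := ⟨[], by simp, WittLe.refl _⟩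

theorem Reduces.trans {p : ℕ} {u v w : ℤ} (h : Reduces p u v) (h' : Reduces p v w) :
    Reduces p u w := by
  obtain ⟨S, hS, h⟩ := h
  obtain ⟨S', hS', h'⟩ := h'
  refine ⟨S' ++ S, ?_, h.trans (h'.append_right S)⟩
  intro a ha
  exact (List.mem_append.mp ha).elim (hS' a) (hS a)

/-- The lattice `M` cobounds a diagonal form whose entries divisible by `p` are `p • T`, the other
entries having only prime factors less than `p`. -/
def Residual (M : IntLattice) (p : ℕ) (T : List ℤ) : Prop :=
  ∃ A : List ℤ, (∀ a ∈ A, Smooth p a) ∧ M.Cobounds (A ++ T.map ((p : ℤ) * ·))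

theorem Residual.of_wittLe {M : IntLattice} {p : ℕ} {T₁ T₂ S T : List ℤ}
    (hS : ∀ a ∈ S, Smooth p a)
    (h : WittLe (T₁.map ((p : ℤ) * ·)) (S ++ T₂.map ((p : ℤ) * ·)))
    (hT : M.Residual p (T₁ ++ T)) : M.Residual p (T₂ ++ T) := by
  obtain ⟨A, hA, hM⟩ := hT
  refine ⟨A ++ S, fun a ha => (List.mem_append.mp ha).elim (hA a) (hS a), ?_⟩
  have := ((h.append_right (T.map ((p : ℤ) * ·))).append_left A) M (by simpa using hM)
  simpa using this

theorem Residual.of_perm {M : IntLattice} {p : ℕ} {T T' : List ℤ} (h : T.Perm T')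
    (hT : M.Residual p T) : M.Residual p T' := by
  obtain ⟨A, hA, hM⟩ := hT
  exact ⟨A, hA, WittLe.of_perm ((h.map _).append_left A) M hM⟩

theorem Residual.of_reduces {M : IntLattice} {p : ℕ} {v w : ℤ} {T : List ℤ} (h : Reduces p v w)
    (hT : M.Residual p (v :: T)) : M.Residual p (w :: T) := by
  obtain ⟨S, hS, h⟩ := h
  refine Residual.of_wittLe (T₁ := [v]) (T₂ := [w]) hS ?_ hT
  exact h.trans (WittLe.of_perm (by simpa using (List.perm_append_singleton (↑p * w) S).symm))

/-- If `n₁ n₂ = r + p t` then `⟨p m n₁ n₂⟩ = ⟨p m r⟩ + ⟨m t⟩ - ⟨m t r n₁ n₂⟩` by the relation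
between `⟨a⟩ + ⟨b⟩` and `⟨a + b⟩` for `a = p m r` and `b = p² m t`; here `|t| < p`. -/
theorem reduces_mul {p : ℕ} (hp : p.Prime) {m n₁ n₂ r : ℤ} (hm : Smooth p m) (h₁ : Small p n₁)
    (h₂ : Small p n₂) (hr : Small p r) (h : (p : ℤ) ∣ n₁ * n₂ - r) :
    Reduces p (m * n₁ * n₂) (m * r) := by
  obtain ⟨t, ht⟩ := h
  have hp0 : (0 : ℤ) < p := by exact_mod_cast hp.pos
  by_cases ht0 : t = 0
  · have h3 : n₁ * n₂ = r := by
      rw [ht0, mul_zero] at ht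
      linarith
    rw [mul_assoc, h3]
    exact Reduces.refl _ _
  have htp : Small p t := by
    refine ⟨ht0, ?_⟩
    have h1 : |n₁ * n₂| ≤ (p - 1) * (p - 1) := by
      rw [abs_mul]
      have := h₁.2
      have := h₂.2
      exact mul_le_mul (by omega) (by omega) (abs_nonneg _) (by omega)
    have h2 : (p : ℤ) * |t| ≤ |n₁ * n₂| + |r| := by
      rw [← abs_of_pos hp0, ← abs_mul, ← ht]
      exact abs_sub _ _
    have h3 := hr.2
    nlinarith
  have hn : m * n₁ * n₂ ≠ 0 := mul_ne_zero (mul_ne_zero hm.ne_zero h₁.1) h₂.1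
  have hc0 : m * (p : ℤ) ^ 2 ≠ 0 := mul_ne_zero hm.ne_zero (pow_ne_zero _ hp0.ne')
  refine ⟨[m * t, -(m * t * r * n₁ * n₂)], ?_, ?_⟩
  · have h1 := hm.mul htp.smooth
    simpa using ⟨h1, (((h1.mul hr.smooth).mul h₁.smooth).mul h₂.smooth).neg⟩
  set a := (p : ℤ) * (m * r) with ha
  set b := m * t * (p : ℤ) ^ 2 with hb
  have hab : (p : ℤ) * (m * n₁ * n₂) = a + b := by
    linear_combination (p * m) * ht
  have hab0 : a + b ≠ 0 := hab ▸ mul_ne_zero hp0.ne' hn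
  have hc : a * b * (a + b) = m * t * r * n₁ * n₂ * (m * (p : ℤ) ^ 2) ^ 2 := by
    rw [← hab, ha, hb]
    ring
  have s1 : WittLe [a + b] [a + b, a * b * (a + b), -(a * b * (a + b))] :=
    (wittLe_nil_pair (a * b * (a + b))).append_left [a + b]
  have s2 := (wittLe_of_add hab0).append_right [-(a * b * (a + b))]
  have s3 : WittLe [a, b, -(a * b * (a + b))] [a, m * t, -(a * b * (a + b))] :=
    ((wittLe_mul_sq (m * t) hp0.ne').append_right [-(a * b * (a + b))]).append_left [a]
  have s4 : WittLe [a, m * t, -(a * b * (a + b))] [a, m * t, -(m * t * r * n₁ * n₂)] := by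
    rw [hc, ← neg_mul]
    exact (wittLe_mul_sq _ hc0).append_left [a, m * t]
  rw [hab]
  exact s1.trans (s2.trans (s3.trans s4))

theorem reduces_of_dvd {p : ℕ} (hp : p.Prime) {v w : ℤ} (hv : Small p v) (hw : Small p w)
    (h : (p : ℤ) ∣ v - w) : Reduces p v w := by
  have := reduces_mul hp (small_one hp).smooth hv (small_one hp) hw (by simpa using h)
  simpa using this

/-- Every smooth `v` can be reduced to a small integer, by treating its prime factors one
by one. -/
theorem Smooth.exists_reduces {p : ℕ} (hp : p.Prime) {v : ℤ} (hv : Smooth p v) :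
    ∃ r, Small p r ∧ (p : ℤ) ∣ v - r ∧ Reduces p v r := by
  suffices h : ∀ k : ℕ, k ∈ Nat.smoothNumbers p → ∀ n : ℤ, Small p n →
      ∃ r, Small p r ∧ (p : ℤ) ∣ n * k - r ∧ Reduces p (n * k) r by
    obtain h1 | h1 := Int.natAbs_eq v
    · have := h _ hv 1 (small_one hp)
      rwa [one_mul, ← h1] at this
    · have := h _ hv (-1) ⟨by simp, by simpa using hp.one_lt⟩
      rwa [neg_one_mul, ← h1] at this
  intro k
  induction k using Nat.strong_induction_on with
  | _ k ih =>
    intro hk n hn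
    by_cases hk1 : k = 1
    · exact ⟨n, hn, by simp [hk1], by simpa [hk1] using Reduces.refl p n⟩
    obtain ⟨ℓ, hℓ, k', rfl⟩ := Nat.exists_prime_and_dvd hk1
    have hk0 := Nat.ne_zero_of_mem_smoothNumbers hk
    have hℓp : ℓ < p := Nat.mem_smoothNumbers'.mp hk ℓ hℓ (dvd_mul_right _ _)
    have hk' : k' ∈ Nat.smoothNumbers p := Nat.mem_smoothNumbers_of_dvd hk (dvd_mul_left _ _)
    have hℓs : Small p ℓ := ⟨by exact_mod_cast hℓ.ne_zero, by simpa using hℓp⟩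
    have hpn : ¬ (p : ℤ) ∣ n * ℓ := fun hd =>
      ((Nat.prime_iff_prime_int.mp hp).dvd_or_dvd hd).elim hn.not_dvd hℓs.not_dvd
    have hr := small_emod hp hpn
    have hd : (p : ℤ) ∣ n * ℓ - n * ℓ % p := Int.dvd_self_sub_emod
    have hlt : k' < ℓ * k' := by
      have := hℓ.two_le
      have : 0 < k' := Nat.pos_of_ne_zero fun h => hk0 (by simp [h])
      nlinarith
    obtain ⟨r, hr1, hr2, hr3⟩ := ih k' hlt hk' (n * ℓ % p) hr
    refine ⟨r, hr1, ?_, ?_⟩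
    · have h1 : n * ((ℓ * k' : ℕ) : ℤ) - r =
          (n * ℓ - n * ℓ % p) * k' + (n * ℓ % p * k' - r) := by
        push_cast
        ring
      rw [h1]
      exact (hd.mul_right (k' : ℤ)).add hr2
    · have h1 := reduces_mul hp (m := k') (by simpa [Smooth] using hk') hn hℓs hr hd
      have h2 : (k' : ℤ) * n * ℓ = n * ((ℓ * k' : ℕ) : ℤ) := by
        push_cast
        ring
      rw [h2, mul_comm (k' : ℤ)] at h1
      exact h1.trans hr3

theorem Small.exists_reduces_mul_sq {p : ℕ} (hp : p.Prime) {v t : ℤ} (hv : Small p v)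
    (ht : ¬ (p : ℤ) ∣ t) : ∃ r, Small p r ∧ (p : ℤ) ∣ v * t ^ 2 - r ∧ Reduces p v r := by
  have hs := small_emod hp ht
  obtain ⟨r, h1, h2, h3⟩ := (hv.smooth.mul (hs.smooth.mul hs.smooth)).exists_reduces hp
  refine ⟨r, h1, ?_, Reduces.trans ⟨[], by simp, ?_⟩ h3⟩
  · obtain ⟨c, hc⟩ : (p : ℤ) ∣ t - t % p := Int.dvd_self_sub_emod
    have h4 : v * t ^ 2 - r = v * (t % p * (t % p)) - r + p * (v * c * (t + t % p)) := by
      linear_combination v * (t + t % p) * hc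
    rw [h4]
    exact h2.add (dvd_mul_right _ _)
  · have := wittLe_of_mul_sq (p * v) hs.1
    rwa [show (p : ℤ) * v * (t % p) ^ 2 = p * (v * (t % p * (t % p))) by ring] at this

/-- If finitely many of the residual entries add up to a multiple of `p`, the residual form can be
shortened: choosing representatives `a > 0 > b`, two of these entries cancel or are replaced by
`a + b` and `ab(a + b)`, which makes the vanishing sum shorter. -/
theorem Residual.shorten_of_sum {M : IntLattice} {p : ℕ} (hp : p.Prime) (Z T : List ℤ)
    (hZ0 : Z ≠ []) (hZ : ∀ v ∈ Z, Small p v) (hT : ∀ v ∈ T, Small p v) (hsum : (p : ℤ) ∣ Z.sum)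
    (h : M.Residual p (Z ++ T)) :
    ∃ T' : List ℤ, (∀ v ∈ T', Small p v) ∧ T'.length < Z.length + T.length ∧ M.Residual p T' := by
  induction hn : Z.length generalizing Z T with
  | zero => exact absurd (List.length_eq_zero_iff.mp hn) hZ0
  | succ n ih =>
    match Z, hn with
    | [v], _ =>
      exact absurd (by simpa using hsum) (hZ v (by simp)).not_dvd
    | v₁ :: v₂ :: Z', hn =>
      have hv₁ := hZ v₁ (by simp)
      have hv₂ := hZ v₂ (by simp)
      have hZ' : ∀ v ∈ Z', Small p v := fun v hv => hZ v (by simp [hv])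
      have hp0 : (0 : ℤ) < p := by exact_mod_cast hp.pos
      have e1 := Int.emod_lt_of_pos v₁ hp0
      have e2 := Int.emod_lt_of_pos v₂ hp0
      have e3 := Int.emod_nonneg v₁ hp0.ne'
      have e4 := Int.emod_nonneg v₂ hp0.ne'
      have hs₁ := small_emod hp hv₁.not_dvd
      have hs₂ := small_emod hp hv₂.not_dvd
      have e5 : 0 < v₁ % p := lt_of_le_of_ne e3 hs₁.1.symm
      have e6 : 0 < v₂ % p := lt_of_le_of_ne e4 hs₂.1.symm
      have d1 : (p : ℤ) ∣ v₁ - v₁ % p := Int.dvd_self_sub_emod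
      have d2 : (p : ℤ) ∣ v₂ - (v₂ % p - p) := by
        rw [show v₂ - (v₂ % p - p) = v₂ - v₂ % p + p by ring]
        exact Int.dvd_self_sub_emod.add dvd_rfl
      generalize v₁ % (p : ℤ) = a at *
      generalize hb : v₂ % (p : ℤ) - p = b at *
      have hsb : Small p b := ⟨by omega, by rw [abs_lt]; omega⟩
      have h1 : M.Residual p (a :: v₂ :: (Z' ++ T)) :=
        Residual.of_reduces (reduces_of_dvd hp hv₁ hs₁ d1) h
      have h2 : M.Residual p (a :: b :: (Z' ++ T)) :=
        (Residual.of_reduces (reduces_of_dvd hp hv₂ hsb d2)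
          (h1.of_perm (List.Perm.swap _ _ _))).of_perm (List.Perm.swap _ _ _)
      have hZT : ∀ v ∈ Z' ++ T, Small p v := fun v hv =>
        (List.mem_append.mp hv).elim (hZ' v) (hT v)
      have hn' : Z'.length + 1 = n := by simpa using hn
      by_cases hab : a + b = 0
      · refine ⟨Z' ++ T, hZT, by simp; omega, ?_⟩
        refine Residual.of_wittLe (T₁ := [a, b]) (T₂ := []) (S := []) (by simp) ?_ h2
        have : b = -a := by omega
        simpa [this] using wittLe_pair_nil (mul_ne_zero hp0.ne' hs₁.1)
      · have hsab : Small p (a + b) := ⟨hab, by rw [abs_lt]; omega⟩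
        obtain ⟨r, hr1, -, hr3⟩ := ((hs₁.smooth.mul hsb.smooth).mul hsab.smooth).exists_reduces hp
        have h3 : M.Residual p ((a + b) :: a * b * (a + b) :: (Z' ++ T)) := by
          refine Residual.of_wittLe (T₁ := [a, b]) (T₂ := [a + b, a * b * (a + b)]) (S := [])
            (by simp) ?_ h2
          have s1 := wittLe_add (a := p * a) (b := p * b)
            (by rw [← mul_add]; exact mul_ne_zero hp0.ne' hab)
          have s2 := (wittLe_mul_sq (p * (a * b * (a + b))) hp0.ne').append_left [p * (a + b)]
          rw [← mul_add, show p * a * (p * b) * (p * (a + b)) = p * (a * b * (a + b)) * (p : ℤ) ^ 2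
            by ring] at s1
          simpa using s1.trans s2
        have h4 : M.Residual p (r :: (a + b) :: (Z' ++ T)) :=
          Residual.of_reduces hr3 (h3.of_perm (List.Perm.swap _ _ _))
        have h5 : (p : ℤ) ∣ ((a + b) :: Z').sum := by
          have e : ((a + b) :: Z').sum = (v₁ :: v₂ :: Z').sum - (v₁ - a) - (v₂ - b) := by
            simp only [List.sum_cons]
            ring
          exact e ▸ (hsum.sub d1).sub d2
        have h6 : M.Residual p ((a + b) :: Z' ++ r :: T) := by
          refine h4.of_perm ((List.Perm.swap _ _ _).trans ?_)
          rw [List.cons_append]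
          exact (List.perm_middle.symm).cons _
        obtain ⟨T', h7, h8, h9⟩ := ih ((a + b) :: Z') (r :: T) (by simp)
          (by simpa using ⟨hsab, hZ'⟩) (by simpa using ⟨hr1, hT⟩) h5 h6 (by simpa using hn')
        exact ⟨T', h7, by simp at h8 ⊢; omega, h9⟩

/-- The diagonal form `T` has only the trivial zero modulo `p`. A vector is encoded by a list of
pairs of an entry of `T` and a coordinate. -/
def AnisotropicMod (p : ℕ) (T : List ℤ) : Prop :=
  ∀ L : List (ℤ × ℤ), L.map Prod.fst = T → (p : ℤ) ∣ (L.map fun x => x.1 * x.2 ^ 2).sum →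
    ∀ x ∈ L, (p : ℤ) ∣ x.2

/-- A nontrivial zero of the residual form modulo `p` shortens it: multiplying the entries by the
squares of the coordinates prime to `p` turns the zero into a vanishing sum of entries. The list
`L` holds the entries still to be treated, `Z` the treated ones which occur in the sum. -/
theorem Residual.shorten_of_zero {M : IntLattice} {p : ℕ} (hp : p.Prime) (L : List (ℤ × ℤ))
    (Z T : List ℤ) (hL : ∀ x ∈ L, Small p x.1) (hZ : ∀ v ∈ Z, Small p v)
    (hT : ∀ v ∈ T, Small p v) (hne : Z ≠ [] ∨ ∃ x ∈ L, ¬ (p : ℤ) ∣ x.2)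
    (hsum : (p : ℤ) ∣ Z.sum + (L.map fun x => x.1 * x.2 ^ 2).sum)
    (h : M.Residual p (L.map Prod.fst ++ (Z ++ T))) :
    ∃ T' : List ℤ, (∀ v ∈ T', Small p v) ∧ T'.length < L.length + Z.length + T.length ∧
      M.Residual p T' := by
  induction L generalizing Z T with
  | nil =>
    obtain ⟨T', h1, h2, h3⟩ := Residual.shorten_of_sum hp Z T (by simpa using hne) hZ hT
      (by simpa using hsum) (by simpa using h)
    exact ⟨T', h1, by simpa using h2, h3⟩
  | cons x L ih =>
    obtain ⟨v, t⟩ := x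
    have hv : Small p v := hL (v, t) (by simp)
    have hL' : ∀ x ∈ L, Small p x.1 := fun x hx => hL x (by simp [hx])
    simp only [List.map_cons, List.sum_cons] at hsum h
    by_cases ht : (p : ℤ) ∣ t
    · have h4 : Z ≠ [] ∨ ∃ x ∈ L, ¬ (p : ℤ) ∣ x.2 := by
        refine hne.imp_right ?_
        rintro ⟨x, hx, hx'⟩
        rcases List.mem_cons.mp hx with rfl | hx
        · exact absurd ht hx'
        · exact ⟨x, hx, hx'⟩
      have h5 : (p : ℤ) ∣ Z.sum + (L.map fun x => x.1 * x.2 ^ 2).sum := by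
        have h6 : (p : ℤ) ∣ v * t ^ 2 := (dvd_pow ht two_ne_zero).mul_left v
        have e : Z.sum + (L.map fun x => x.1 * x.2 ^ 2).sum =
            Z.sum + (v * t ^ 2 + (L.map fun x => x.1 * x.2 ^ 2).sum) - v * t ^ 2 := by ring
        exact e ▸ hsum.sub h6
      have h6 : M.Residual p (L.map Prod.fst ++ (Z ++ v :: T)) := by
        refine h.of_perm ?_
        rw [← List.append_assoc, ← List.append_assoc, List.cons_append, List.cons_append]
        exact List.perm_middle.symm
      obtain ⟨T', h1, h2, h3⟩ := ih Z (v :: T) hL' hZ (by simpa using ⟨hv, hT⟩) h4 h5 h6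
      exact ⟨T', h1, by simp at h2 ⊢; omega, h3⟩
    · obtain ⟨r, hr1, hr2, hr3⟩ := hv.exists_reduces_mul_sq hp ht
      have h5 : (p : ℤ) ∣ (r :: Z).sum + (L.map fun x => x.1 * x.2 ^ 2).sum := by
        have e : (r :: Z).sum + (L.map fun x => x.1 * x.2 ^ 2).sum =
            Z.sum + (v * t ^ 2 + (L.map fun x => x.1 * x.2 ^ 2).sum) - (v * t ^ 2 - r) := by
          simp only [List.sum_cons]
          ring
        exact e ▸ hsum.sub hr2
      have h6 : M.Residual p (L.map Prod.fst ++ (r :: Z ++ T)) := by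
        refine (Residual.of_reduces hr3 h).of_perm ?_
        rw [List.cons_append]
        exact List.perm_middle.symm
      obtain ⟨T', h1, h2, h3⟩ := ih (r :: Z) T hL' (by simpa using ⟨hr1, hZ⟩) hT
        (Or.inl (by simp)) h5 h6
      exact ⟨T', h1, by simp at h2 ⊢; omega, h3⟩

theorem Residual.exists_anisotropicMod {M : IntLattice} {p : ℕ} (hp : p.Prime) {T : List ℤ}
    (hT : ∀ v ∈ T, Small p v) (h : M.Residual p T) :
    ∃ T' : List ℤ, (∀ v ∈ T', Small p v) ∧ AnisotropicMod p T' ∧ M.Residual p T' := by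
  induction hn : T.length using Nat.strong_induction_on generalizing T with
  | _ n ih =>
    by_cases hA : AnisotropicMod p T
    · exact ⟨T, hT, hA, h⟩
    · simp only [AnisotropicMod, not_forall] at hA
      obtain ⟨L, rfl, hL, x, hx, hx'⟩ := hA
      obtain ⟨T', h1, h2, h3⟩ := Residual.shorten_of_zero hp L [] []
        (fun x hx => hT _ (List.mem_map_of_mem hx)) (by simp) (by simp) (Or.inr ⟨x, hx, hx'⟩)
        (by simpa using hL) (by simpa using h)
      exact ih _ (by simp at h2 hn; omega) h1 h3 rfl

/-- A diagonal entry whose largest prime factor is at most `p` is `u` or `pu` up to squares, with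
`u` smooth. -/
theorem Smooth.exists_wittLe {p : ℕ} (hp : p.Prime) {a : ℤ} (ha : Smooth (p + 1) a) :
    ∃ S T : List ℤ, (∀ v ∈ S, Smooth p v) ∧ (∀ v ∈ T, Small p v) ∧
      WittLe [a] (S ++ T.map ((p : ℤ) * ·)) := by
  have hp0 : (p : ℤ) ≠ 0 := by exact_mod_cast hp.ne_zero
  obtain ⟨j, u, hu, rfl⟩ : ∃ (j : ℕ) (u : ℤ), ¬ (p : ℤ) ∣ u ∧ a = p ^ j * u := by
    obtain ⟨u, hu, hu'⟩ := (FiniteMultiplicity.of_not_isUnit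
      (Nat.prime_iff_prime_int.mp hp).not_isUnit ha.ne_zero).exists_eq_pow_mul_and_not_dvd
    exact ⟨_, u, hu', hu⟩
  have hus : Smooth p u := by
    refine Nat.mem_smoothNumbers'.mpr fun ℓ hℓ hd => ?_
    have h1 : ℓ < p + 1 := Nat.mem_smoothNumbers'.mp ha ℓ hℓ (by
      rw [Int.natAbs_mul]
      exact hd.mul_left _)
    refine lt_of_le_of_ne (by omega) ?_
    rintro rfl
    exact hu (Int.natCast_dvd.mpr hd)
  obtain ⟨k, rfl | rfl⟩ := Nat.even_or_odd' j
  · refine ⟨[u], [], by simpa using hus, by simp, ?_⟩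
    have := wittLe_mul_sq u (pow_ne_zero k hp0)
    rw [show u * ((p : ℤ) ^ k) ^ 2 = p ^ (2 * k) * u by ring] at this
    simpa using this
  · obtain ⟨r, hr, -, S, hS, h⟩ := hus.exists_reduces hp
    refine ⟨S, [r], hS, by simpa using hr, ?_⟩
    have := wittLe_mul_sq (p * u) (pow_ne_zero k hp0)
    rw [show p * u * ((p : ℤ) ^ k) ^ 2 = p ^ (2 * k + 1) * u by ring] at this
    refine (this.trans h).trans (WittLe.of_perm ?_)
    simpa using (List.perm_append_singleton (↑p * r) S).symm

theorem exists_residual {M : IntLattice} {p : ℕ} (hp : p.Prime) (l A T : List ℤ)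
    (hl : ∀ a ∈ l, Smooth (p + 1) a) (hA : ∀ a ∈ A, Smooth p a) (hT : ∀ v ∈ T, Small p v)
    (h : M.Cobounds (l ++ (A ++ T.map ((p : ℤ) * ·)))) :
    ∃ T' : List ℤ, (∀ v ∈ T', Small p v) ∧ M.Residual p T' := by
  induction l generalizing A T with
  | nil => exact ⟨T, hT, A, hA, h⟩
  | cons a l ih =>
    obtain ⟨S, U, hS, hU, hw⟩ := (hl a (by simp)).exists_wittLe hp
    refine ih (S ++ A) (U ++ T) (fun b hb => hl b (by simp [hb]))
      (fun v hv => (List.mem_append.mp hv).elim (hS v) (hA v))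
      (fun v hv => (List.mem_append.mp hv).elim (hU v) (hT v)) ?_
    refine WittLe.of_perm ?_ M (hw.append_right (l ++ (A ++ T.map ((p : ℤ) * ·))) M h)
    refine List.perm_iff_count.mpr fun x => ?_
    simp only [List.count_append, List.map_append]
    omega

end IntLattice
end EvenLattice

namespace EvenLattice

open Module

namespace IntLattice

/-! ### Reduction modulo a prime -/

/-- The form of `M` is nondegenerate modulo `p`. -/
def UnimodularAt (p : ℕ) (M : IntLattice) : Prop :=
  ∀ x : M, (∀ y, (p : ℤ) ∣ M.bil x y) → ∃ x', x = (p : ℤ) • x'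

theorem UnimodularAt.adjoin {p : ℕ} (hp : p.Prime) {M : IntLattice} (h : UnimodularAt p M) {a : ℤ}
    (ha : ¬ (p : ℤ) ∣ a) : UnimodularAt p (M.adjoin a) := by
  intro x hx
  obtain ⟨x', hx'⟩ := h (M.base a x) fun y => by simpa [adjoin_bil] using hx (M.pair a y 0)
  have h1 : (p : ℤ) ∣ a * M.coord a x := by simpa [adjoin_bil] using hx (M.pair a 0 1)
  obtain ⟨t, ht⟩ := ((Nat.prime_iff_prime_int.mp hp).dvd_or_dvd h1).resolve_left ha
  exact ⟨M.pair a x' t, adjoin_ext (by rw [map_smul, base_pair, hx'])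
    (by rw [map_smul, coord_pair, ht, smul_eq_mul])⟩

theorem UnimodularAt.foldl {p : ℕ} (hp : p.Prime) {A : List ℤ} (hA : ∀ a ∈ A, Smooth p a)
    {M : IntLattice} (h : UnimodularAt p M) : UnimodularAt p (A.foldl IntLattice.adjoin M) := by
  induction A generalizing M with
  | nil => exact h
  | cons a A ih =>
    refine ih (fun b hb => hA b (by simp [hb])) (h.adjoin hp fun hd => ?_)
    exact lt_irrefl p (Nat.mem_smoothNumbers'.mp (hA a (by simp)) p hp (Int.natCast_dvd.mp hd))

/-- In `M ⊕ p • T`, a vector of the radical modulo `p` whose norm is divisible by `p²` is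
divisible by `p`. -/
def RadicalAnisotropic (p : ℕ) (M : IntLattice) (T : List ℤ) : Prop :=
  ∀ x : M, (∀ y, (p : ℤ) ∣ M.bil x y) → ∀ L : List (ℤ × ℤ), L.map Prod.fst = T →
    (p : ℤ) ^ 2 ∣ M.bil x x + p * (L.map fun z => z.1 * z.2 ^ 2).sum →
    (∃ x', x = (p : ℤ) • x') ∧ ∀ z ∈ L, (p : ℤ) ∣ z.2

theorem UnimodularAt.radicalAnisotropic {p : ℕ} (hp : p.Prime) {M : IntLattice}
    (h : UnimodularAt p M) {T : List ℤ} (hT : AnisotropicMod p T) : RadicalAnisotropic p M T := by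
  intro x hx L hL hd
  obtain ⟨x', rfl⟩ := h x hx
  refine ⟨⟨x', rfl⟩, hT L hL ?_⟩
  have hp0 : (p : ℤ) ≠ 0 := by exact_mod_cast hp.ne_zero
  simp only [map_smul, LinearMap.smul_apply, smul_eq_mul] at hd
  rw [sq, ← mul_add] at hd
  exact (Int.dvd_add_right (dvd_mul_right _ _)).mp (Int.dvd_of_mul_dvd_mul_left hp0 hd)

theorem RadicalAnisotropic.foldl {p : ℕ} {T : List ℤ} {M : IntLattice}
    (h : RadicalAnisotropic p M T) :
    RadicalAnisotropic p ((T.map ((p : ℤ) * ·)).foldl IntLattice.adjoin M) [] := by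
  induction T generalizing M with
  | nil => exact h
  | cons v T ih =>
    refine ih fun x hx L hL hd => ?_
    obtain ⟨⟨x', hx'⟩, h2⟩ := h (M.base _ x)
      (fun y => by simpa [adjoin_bil] using hx (M.pair _ y 0)) ((v, M.coord _ x) :: L)
      (by simpa using hL) (by
        rw [adjoin_bil] at hd
        convert hd using 1
        simp only [List.map_cons, List.sum_cons]
        ring)
    obtain ⟨t, ht⟩ := h2 (v, M.coord _ x) (by simp)
    refine ⟨⟨M.pair _ x' t, adjoin_ext (by rw [map_smul, base_pair, hx']) ?_⟩,
      fun z hz => h2 z (by simp [hz])⟩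
    rw [map_smul, coord_pair, smul_eq_mul, ← ht]

theorem UnimodularAt.of_foldl {p : ℕ} {l : List ℤ} {M : IntLattice}
    (h : UnimodularAt p (l.foldl IntLattice.adjoin M)) : UnimodularAt p M := by
  induction l generalizing M with
  | nil => exact h
  | cons a l ih =>
    intro x hx
    obtain ⟨x', hx'⟩ := ih h (M.pair a x 0) fun y => by simpa [adjoin_bil] using hx _
    exact ⟨M.base a x', by simpa using congrArg (M.base a) hx'⟩

/-- If `M` is metabolic and radical vectors modulo `p` of norm divisible by `p²` are trivial, then
`M` is nondegenerate modulo `p`: the reduction of a saturated totally isotropic subgroup of half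
rank meets the radical trivially, and the sum of the two lies in its orthogonal space. -/
theorem IsMetabolic.unimodularAt {p : ℕ} (hp : p.Prime) {M : IntLattice} (hM : M.IsMetabolic)
    (h : RadicalAnisotropic p M []) : UnimodularAt p M := by
  have : Fact p.Prime := ⟨hp⟩
  obtain ⟨N, hr, hN⟩ := hM
  obtain ⟨n, hn, ⟨b₀⟩⟩ : ∃ n, finrank ℤ M = n ∧ Nonempty (Basis (Fin n) ℤ M) :=
    ⟨_, rfl, ⟨Module.finBasis ℤ M⟩⟩
  obtain ⟨k, ⟨b, bN, f, a, hf⟩⟩ := Submodule.smithNormalForm b₀ N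
  have hk : finrank ℤ N = k := by simpa using Module.finrank_eq_card_basis bN
  have ha : ∀ i, a i ≠ 0 := fun i h0 => bN.ne_zero i (Subtype.ext (by rw [hf, h0, zero_smul]; rfl))
  have hiso : ∀ i j, M.bil (b (f i)) (b (f j)) = 0 := fun i j => by
    have h1 := bil_eq_zero_of_isotropic hN (bN i).2 (bN j).2
    rw [hf, hf] at h1
    simpa [ha] using h1
  -- Reduction modulo `p` in the coordinates of `b`, and the reduced form.
  let red : M → (Fin n → ZMod p) := fun x i => (b.repr x i : ZMod p)
  let C : LinearMap.BilinForm (ZMod p) (Fin n → ZMod p) :=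
    Matrix.toBilin' (Matrix.of fun i j => ((M.bil (b i) (b j) : ℤ) : ZMod p))
  have hC : ∀ x y, C (red x) (red y) = ((M.bil x y : ℤ) : ZMod p) := fun x y => by
    rw [Matrix.toBilin'_apply]
    conv_rhs => rw [← b.sum_repr x, ← b.sum_repr y]
    simp only [map_sum, LinearMap.sum_apply, map_smul, LinearMap.smul_apply, smul_eq_mul,
      Int.cast_sum, Int.cast_mul, Matrix.of_apply, red]
    rw [Finset.sum_comm]
    refine Finset.sum_congr rfl fun j _ => ?_
    rw [Finset.mul_sum]
    refine Finset.sum_congr rfl fun i _ => ?_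
    ring
  have hsurj : ∀ u, ∃ x, red x = u := fun u => by
    refine ⟨∑ i, ((u i).val : ℤ) • b i, funext fun i => ?_⟩
    simp [red, Finsupp.single_apply]
  have hred : ∀ x, red x = 0 ↔ ∃ x', x = (p : ℤ) • x' := fun x => by
    constructor
    · intro h0
      have h1 : ∀ i, (p : ℤ) ∣ b.repr x i := fun i =>
        (ZMod.intCast_zmod_eq_zero_iff_dvd _ p).mp (congrFun h0 i)
      choose c hc using h1
      refine ⟨∑ i, c i • b i, ?_⟩
      conv_lhs => rw [← b.sum_repr x]
      simp [Finset.smul_sum, smul_smul, hc]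
    · rintro ⟨x', rfl⟩
      funext i
      simp [red]
  have hrad : ∀ x, (∀ y, (p : ℤ) ∣ M.bil x y) ↔ red x ∈ LinearMap.ker C := fun x => by
    rw [LinearMap.mem_ker]
    constructor
    · intro hx
      refine LinearMap.ext fun u => ?_
      obtain ⟨y, rfl⟩ := hsurj u
      rw [hC, LinearMap.zero_apply]
      exact (ZMod.intCast_zmod_eq_zero_iff_dvd _ p).mpr (hx y)
    · intro hx y
      rw [← ZMod.intCast_zmod_eq_zero_iff_dvd, ← hC, hx]
      rfl
  let w : Fin k → (Fin n → ZMod p) := fun i => Pi.single (f i) 1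
  have hw : LinearIndependent (ZMod p) w := by
    have := (Pi.basisFun (ZMod p) (Fin n)).linearIndependent.comp f f.injective
    have e : w = Pi.basisFun (ZMod p) (Fin n) ∘ f := by
      funext i
      simp [w]
    rwa [e]
  let W := Submodule.span (ZMod p) (Set.range w)
  have hWr : finrank (ZMod p) W = k := by
    simpa using finrank_span_eq_card hw
  have hWx : ∀ u ∈ W, ∃ c : Fin k → ℤ, red (∑ i, c i • b (f i)) = u := fun u hu => by
    obtain ⟨c, rfl⟩ := (Submodule.mem_span_range_iff_exists_fun _).mp hu
    refine ⟨fun i => ((c i).val : ℤ), ?_⟩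
    funext j
    simp [red, w, Finsupp.single_apply, Pi.single_apply, eq_comm]
  have hzero : ∀ c d : Fin k → ℤ,
      M.bil (∑ i, c i • b (f i)) (∑ i, d i • b (f i)) = 0 := fun c d => by
    simp [hiso]
  have hWorth : W ≤ C.orthogonal W := fun u hu v hv => by
    obtain ⟨c, rfl⟩ := hWx u hu
    obtain ⟨d, rfl⟩ := hWx v hv
    change C _ _ = 0
    rw [hC, hzero, Int.cast_zero]
  have hdisj : W ⊓ LinearMap.ker C = ⊥ := by
    rw [eq_bot_iff]
    rintro u ⟨hu, hu'⟩
    obtain ⟨c, rfl⟩ := hWx u hu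
    exact (hred _).mpr (h _ ((hrad _).mpr hu') [] rfl (by simp [hiso])).1
  have hker : LinearMap.ker C ≤ C.orthogonal W := fun u hu v _ => by
    obtain ⟨x, rfl⟩ := hsurj u
    obtain ⟨y, rfl⟩ := hsurj v
    change C _ _ = 0
    rw [hC, M.symm, ← hC, LinearMap.mem_ker.mp hu, LinearMap.zero_apply]
  have h1 := LinearMap.BilinForm.finrank_add_finrank_orthogonal' (B := C) W
  have h2 := Submodule.finrank_sup_add_finrank_inf_eq W (LinearMap.ker C)
  have h3 := Submodule.finrank_mono (sup_le hWorth hker)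
  have hbot : LinearMap.ker C = ⊥ := by
    rw [← Submodule.finrank_eq_zero (R := ZMod p)]
    rw [hdisj, finrank_bot] at h1 h2
    rw [hWr] at h1 h2
    simp at h1
    omega
  intro x hx
  rw [← hred, ← Submodule.mem_bot (ZMod p), ← hbot]
  exact (hrad x).mp hx

/-- A lattice which is nondegenerate modulo every prime is Witt equivalent to a sum of copies
of `⟨1⟩` and `⟨-1⟩`: the primes dividing the entries of a cobounded diagonal form are removed one
by one, from the largest down. -/
theorem exists_cobounds_units {M : IntLattice} (hM : ∀ p : ℕ, p.Prime → UnimodularAt p M) :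
    ∃ l : List ℤ, (∀ a ∈ l, a = 1 ∨ a = -1) ∧ M.Cobounds l := by
  suffices h : ∀ (p : ℕ) (l : List ℤ), (∀ a ∈ l, Smooth p a) → M.Cobounds l →
      ∃ l : List ℤ, (∀ a ∈ l, a = 1 ∨ a = -1) ∧ M.Cobounds l by
    obtain ⟨l, hl, hM⟩ := exists_cobounds M
    obtain ⟨K, hK⟩ := (l.map Int.natAbs).toFinset.bddAbove
    refine h (K + 1) l (fun a ha => ?_) hM
    refine Nat.mem_smoothNumbers_of_lt (Int.natAbs_pos.mpr (hl a ha)) (Nat.lt_succ_of_le (hK ?_))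
    simpa using ⟨a, ha, rfl⟩
  intro p
  induction p with
  | zero =>
    refine fun l hl h => ⟨l, fun a ha => Int.natAbs_eq_iff.mp ?_, h⟩
    simpa [Smooth, Nat.smoothNumbers_zero] using hl a ha
  | succ p ih =>
    intro l hl h
    by_cases hp : p.Prime
    swap
    · refine ih l (fun a ha => ?_) h
      have := hl a ha
      rwa [Smooth, Nat.smoothNumbers_succ hp] at this
    obtain ⟨T, hT, hres⟩ := exists_residual hp l [] [] hl (by simp) (by simp) (by simpa using h)
    obtain ⟨T, hT, hani, A, hA, hcob⟩ := hres.exists_anisotropicMod hp hT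
    have hU := (hM p hp).foldl hp hA
    rw [cobounds_append] at hcob
    have hU' := IsMetabolic.unimodularAt hp hcob (hU.radicalAnisotropic hp hani).foldl
    cases T with
    | nil => exact ih A hA hcob
    | cons v T =>
      have h1 : UnimodularAt p ((A.foldl IntLattice.adjoin M).adjoin (p * v)) :=
        UnimodularAt.of_foldl (l := T.map ((p : ℤ) * ·)) hU'
      obtain ⟨x', hx'⟩ := h1 (pair _ _ 0 1) fun y => by
        rw [adjoin_bil]
        simp [mul_assoc]
      have h2 : (1 : ℤ) = p * coord _ _ x' := by simpa using congrArg (coord _ _) hx'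
      exact absurd (Int.isUnit_iff_natAbs_eq.mp (IsUnit.of_mul_eq_one _ h2.symm))
        (by simpa using hp.one_lt.ne')

theorem exists_cobounds_replicate {M : IntLattice} {l : List ℤ} (hl : ∀ a ∈ l, a = 1 ∨ a = -1)
    (h : M.Cobounds l) :
    ∃ c, M.Cobounds (List.replicate c 1) ∨ M.Cobounds (List.replicate c (-1)) := by
  induction hn : l.length using Nat.strong_induction_on generalizing l with
  | _ n ih =>
    by_cases h1 : (1 : ℤ) ∈ l
    · by_cases h2 : (-1 : ℤ) ∈ l
      · have h3 : (-1 : ℤ) ∈ l.erase 1 := (List.mem_erase_of_ne (by norm_num)).mpr h2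
        have h4 : l.Perm ([1, -1] ++ (l.erase 1).erase (-1)) :=
          (List.perm_cons_erase h1).trans ((List.perm_cons_erase h3).cons _)
        have h5 := WittLe.of_perm h4 M h
        refine ih _ ?_ (fun a ha => hl a (List.mem_of_mem_erase (List.mem_of_mem_erase ha)))
          ((wittLe_pair_nil one_ne_zero).append_right _ M h5) rfl
        have := h4.length_eq
        simp at this ⊢
        omega
      · refine ⟨l.length, Or.inl ?_⟩
        rwa [← List.eq_replicate_of_mem fun a ha =>
          (hl a ha).resolve_right fun h => h2 (h ▸ ha)]
    · refine ⟨l.length, Or.inr ?_⟩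
      rwa [← List.eq_replicate_of_mem fun a ha =>
        (hl a ha).resolve_left fun h => h1 (h ▸ ha)]

theorem Cobounds.exists_isotropic {M : IntLattice} {l : List ℤ} (h : M.Cobounds l) :
    ∃ N : Submodule ℤ M, finrank ℤ M ≤ 2 * finrank ℤ N + l.length ∧ ∀ x ∈ N, M.bil x x = 0 := by
  induction l generalizing M with
  | nil =>
    obtain ⟨N, hN, hN'⟩ : M.IsMetabolic := h
    exact ⟨N, by simpa using hN, hN'⟩
  | cons a l ih =>
    obtain ⟨N, hN, hN'⟩ := ih (M := M.adjoin a) h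
    have h1 := finrank_le_finrank_inf_ker_add_one (M.coord a) N
    have h2 := finrank_map_add_finrank_inf_ker (M.base a) (N ⊓ LinearMap.ker (M.coord a))
    have h3 : N ⊓ LinearMap.ker (M.coord a) ⊓ LinearMap.ker (M.base a) = ⊥ := by
      rw [eq_bot_iff]
      rintro x ⟨⟨-, hx⟩, hx'⟩
      exact adjoin_ext hx' hx
    rw [h3, finrank_bot] at h2
    rw [finrank_adjoin] at hN
    refine ⟨(N ⊓ LinearMap.ker (M.coord a)).map (M.base a), by simp only [List.length_cons]; omega,
      ?_⟩
    rintro _ ⟨x, ⟨hx, hx'⟩, rfl⟩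
    have := hN' x hx
    rw [adjoin_bil, LinearMap.mem_ker.mp hx'] at this
    simpa using this

end IntLattice
end EvenLattice

namespace EvenLattice

open Module

/-! ### Signature and isotropic subgroups -/

theorem form_add_left {p q : ℕ} (x x' y : Rpq p q) : form (x + x') y = form x y + form x' y := by
  simp only [form, Pi.add_apply, add_mul, Finset.sum_add_distrib]
  ring

theorem form_smul_left {p q : ℕ} (c : ℝ) (x y : Rpq p q) : form (c • x) y = c * form x y := by
  simp only [form, Pi.smul_apply, smul_eq_mul, mul_assoc, ← Finset.mul_sum]
  ring

theorem form_comm {p q : ℕ} (x y : Rpq p q) : form x y = form y x := by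
  simp only [form, mul_comm]

/-- The standard form of `ℝ^{p,q}` as a bilinear map. -/
noncomputable def formBilin (p q : ℕ) : LinearMap.BilinForm ℝ (Rpq p q) :=
  LinearMap.mk₂ ℝ form form_add_left form_smul_left
    (fun x y y' => by rw [form_comm, form_add_left, form_comm y, form_comm y'])
    (fun c x y => by rw [form_comm, form_smul_left, form_comm y, smul_eq_mul])

theorem formBilin_apply {p q : ℕ} (x y : Rpq p q) : formBilin p q x y = form x y := rfl

/-- A totally isotropic subspace projects injectively to the positive coordinates. -/
theorem finrank_le_left_of_isotropic {p q : ℕ} {E : Submodule ℝ (Rpq p q)}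
    (hE : ∀ x ∈ E, form x x = 0) : finrank ℝ E ≤ p := by
  let π : Rpq p q →ₗ[ℝ] (Fin p → ℝ) := LinearMap.funLeft ℝ ℝ Sum.inl
  have hinj : Function.Injective (π.domRestrict E) := by
    rw [← LinearMap.ker_eq_bot, eq_bot_iff]
    rintro ⟨x, hx⟩ h
    have h1 : ∀ i, x (Sum.inl i) = 0 := fun i => congrFun (LinearMap.mem_ker.mp h) i
    have h2 := hE x hx
    simp only [form, h1, mul_zero, Finset.sum_const_zero, zero_sub, neg_eq_zero] at h2
    rw [Finset.sum_eq_zero_iff_of_nonneg fun i _ => mul_self_nonneg _] at h2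
    refine Subtype.ext (funext fun i => ?_)
    rcases i with i | i
    · exact h1 i
    · exact mul_self_eq_zero.mp (h2 i (Finset.mem_univ i))
  simpa using LinearMap.finrank_le_finrank_of_injective hinj

theorem finrank_le_right_of_isotropic {p q : ℕ} {E : Submodule ℝ (Rpq p q)}
    (hE : ∀ x ∈ E, form x x = 0) : finrank ℝ E ≤ q := by
  let π : Rpq p q →ₗ[ℝ] (Fin q → ℝ) := LinearMap.funLeft ℝ ℝ Sum.inr
  have hinj : Function.Injective (π.domRestrict E) := by
    rw [← LinearMap.ker_eq_bot, eq_bot_iff]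
    rintro ⟨x, hx⟩ h
    have h1 : ∀ i, x (Sum.inr i) = 0 := fun i => congrFun (LinearMap.mem_ker.mp h) i
    have h2 := hE x hx
    simp only [form, h1, mul_zero, Finset.sum_const_zero, sub_zero] at h2
    rw [Finset.sum_eq_zero_iff_of_nonneg fun i _ => mul_self_nonneg _] at h2
    refine Subtype.ext (funext fun i => ?_)
    rcases i with i | i
    · exact mul_self_eq_zero.mp (h2 i (Finset.mem_univ i))
    · exact h1 i
  simpa using LinearMap.finrank_le_finrank_of_injective hinj

namespace IntLattice

/-- `M` is realised as a discrete subgroup of `ℝ^{s,t}`, not necessarily of full rank. -/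
def Realized (M : IntLattice) (s t : ℕ) : Prop :=
  ∃ (φ : M →ₗ[ℤ] Rpq s t) (ε : ℝ), 0 < ε ∧ (∀ x, x ≠ 0 → ε ≤ ‖φ x‖) ∧
    ∀ x y, (M.bil x y : ℝ) = form (φ x) (φ y)

theorem Realized.finrank_le {M : IntLattice} {s t : ℕ} (h : M.Realized s t) {N : Submodule ℤ M}
    (hN : ∀ x ∈ N, M.bil x x = 0) : finrank ℤ N ≤ s ∧ finrank ℤ N ≤ t := by
  obtain ⟨φ, ε, hε, hφ, hform⟩ := h
  have hinj : Function.Injective φ := by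
    rw [← LinearMap.ker_eq_bot, eq_bot_iff]
    intro x hx
    by_contra h0
    have := hφ x h0
    rw [LinearMap.mem_ker.mp hx, norm_zero] at this
    linarith
  have hspan : Submodule.span ℤ (φ '' N) = N.map φ := by
    rw [← Submodule.map_coe, Submodule.span_eq]
  have hdisc : DiscreteTopology (Submodule.span ℤ (φ '' N)) := by
    refine DiscreteTopology.of_forall_le_norm hε ?_
    rintro ⟨y, hy⟩ h0
    rw [hspan] at hy
    obtain ⟨x, -, rfl⟩ := hy
    exact hφ x fun hx => h0 (Subtype.ext (by simp [hx]))
  have hrank : finrank ℝ (Submodule.span ℝ (φ '' N)) = finrank ℤ N := by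
    have h1 := Real.finrank_eq_int_finrank_of_discrete hdisc
    rw [Set.finrank, Set.finrank, hspan] at h1
    rw [h1, ← (N.equivMapOfInjective φ hinj).finrank_eq]
  have hiso : ∀ x ∈ Submodule.span ℝ (φ '' N), ∀ y ∈ Submodule.span ℝ (φ '' N),
      formBilin s t x y = 0 := by
    intro x hx
    induction hx using Submodule.span_induction with
    | zero => simp
    | add x x' _ _ ih ih' => exact fun y hy => by simp [ih y hy, ih' y hy]
    | smul c x _ ih => exact fun y hy => by simp [ih y hy]
    | mem x hx =>
      intro y hy
      obtain ⟨a, ha, rfl⟩ := hx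
      induction hy using Submodule.span_induction with
      | zero => simp
      | add y y' _ _ ih ih' => simp [ih, ih']
      | smul c y _ ih => simp [ih]
      | mem y hy =>
        obtain ⟨b, hb, rfl⟩ := hy
        rw [formBilin_apply, ← hform, bil_eq_zero_of_isotropic hN ha hb, Int.cast_zero]
  rw [← hrank]
  exact ⟨finrank_le_left_of_isotropic fun x hx => hiso x hx x hx,
    finrank_le_right_of_isotropic fun x hx => hiso x hx x hx⟩

theorem Realized.adjoin_one {M : IntLattice} {s t : ℕ} (h : M.Realized s t) :
    (M.adjoin 1).Realized (s + 1) t := by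
  obtain ⟨φ, ε, hε, hφ, hform⟩ := h
  let ψ : M.adjoin 1 → Rpq (s + 1) t := fun x =>
    Sum.elim (Fin.cons (M.coord 1 x : ℝ) fun i => φ (M.base 1 x) (Sum.inl i))
      fun i => φ (M.base 1 x) (Sum.inr i)
  let Ψ : M.adjoin 1 →+ Rpq (s + 1) t :=
    AddMonoidHom.mk' ψ fun x y => by
      funext i
      rcases i with i | i
      · refine Fin.cases ?_ (fun i => ?_) i <;> simp [ψ]
      · simp [ψ]
  refine ⟨Ψ.toIntLinearMap, min ε 1, by positivity, fun x hx => ?_, fun x y => ?_⟩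
  · change _ ≤ ‖ψ x‖
    by_cases hb : M.base 1 x = 0
    · have hc : M.coord 1 x ≠ 0 := fun hc => hx (adjoin_ext hb hc)
      refine (min_le_right _ _).trans (le_trans ?_ (norm_le_pi_norm (ψ x) (Sum.inl 0)))
      simp only [ψ, Sum.elim_inl, Fin.cons_zero, Real.norm_eq_abs]
      exact_mod_cast Int.one_le_abs hc
    · refine (min_le_left _ _).trans ((hφ _ hb).trans ?_)
      refine (pi_norm_le_iff_of_nonneg (norm_nonneg _)).mpr fun i => ?_
      rcases i with i | i
      · exact norm_le_pi_norm (ψ x) (Sum.inl i.succ)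
      · exact norm_le_pi_norm (ψ x) (Sum.inr i)
  · change _ = form (ψ x) (ψ y)
    rw [adjoin_bil]
    push_cast
    rw [hform]
    simp only [form, ψ, Sum.elim_inl, Sum.elim_inr, Fin.sum_univ_succ, Fin.cons_zero, Fin.cons_succ]
    ring

theorem Realized.adjoin_neg_one {M : IntLattice} {s t : ℕ} (h : M.Realized s t) :
    (M.adjoin (-1)).Realized s (t + 1) := by
  obtain ⟨φ, ε, hε, hφ, hform⟩ := h
  let ψ : M.adjoin (-1) → Rpq s (t + 1) := fun x =>
    Sum.elim (fun i => φ (M.base (-1) x) (Sum.inl i))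
      (Fin.cons (M.coord (-1) x : ℝ) fun i => φ (M.base (-1) x) (Sum.inr i))
  let Ψ : M.adjoin (-1) →+ Rpq s (t + 1) :=
    AddMonoidHom.mk' ψ fun x y => by
      funext i
      rcases i with i | i
      · simp [ψ]
      · refine Fin.cases ?_ (fun i => ?_) i <;> simp [ψ]
  refine ⟨Ψ.toIntLinearMap, min ε 1, by positivity, fun x hx => ?_, fun x y => ?_⟩
  · change _ ≤ ‖ψ x‖
    by_cases hb : M.base (-1) x = 0
    · have hc : M.coord (-1) x ≠ 0 := fun hc => hx (adjoin_ext hb hc)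
      refine (min_le_right _ _).trans (le_trans ?_ (norm_le_pi_norm (ψ x) (Sum.inr 0)))
      simp only [ψ, Sum.elim_inr, Fin.cons_zero, Real.norm_eq_abs]
      exact_mod_cast Int.one_le_abs hc
    · refine (min_le_left _ _).trans ((hφ _ hb).trans ?_)
      refine (pi_norm_le_iff_of_nonneg (norm_nonneg _)).mpr fun i => ?_
      rcases i with i | i
      · exact norm_le_pi_norm (ψ x) (Sum.inl i)
      · exact norm_le_pi_norm (ψ x) (Sum.inr i.succ)
  · change _ = form (ψ x) (ψ y)
    rw [adjoin_bil]
    push_cast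
    rw [hform]
    simp only [form, ψ, Sum.elim_inl, Sum.elim_inr, Fin.sum_univ_succ, Fin.cons_zero, Fin.cons_succ]
    ring

theorem Realized.le_of_cobounds_one {M : IntLattice} {s t : ℕ} (h : M.Realized s t) {c : ℕ}
    (hc : M.Cobounds (List.replicate c 1)) :
    finrank ℤ M + c ≤ 2 * (s + c) ∧ finrank ℤ M + c ≤ 2 * t := by
  induction c generalizing M s with
  | zero =>
    obtain ⟨N, hN, hN'⟩ : M.IsMetabolic := hc
    have := h.finrank_le hN'
    omega
  | succ c ih =>
    have := ih h.adjoin_one hc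
    rw [finrank_adjoin] at this
    omega

theorem Realized.le_of_cobounds_neg_one {M : IntLattice} {s t : ℕ} (h : M.Realized s t) {c : ℕ}
    (hc : M.Cobounds (List.replicate c (-1))) :
    finrank ℤ M + c ≤ 2 * s ∧ finrank ℤ M + c ≤ 2 * (t + c) := by
  induction c generalizing M t with
  | zero =>
    obtain ⟨N, hN, hN'⟩ : M.IsMetabolic := hc
    have := h.finrank_le hN'
    omega
  | succ c ih =>
    have := ih h.adjoin_neg_one hc
    rw [finrank_adjoin] at this
    omega

/-- The Witt class of a unimodular lattice is determined by its signature `(s, t)`: it is the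
difference `s - t` of the numbers of squares. -/
theorem Realized.cobounds {M : IntLattice} {s t : ℕ} (h : M.Realized s t)
    (hr : finrank ℤ M = s + t) (hM : ∀ p : ℕ, p.Prime → UnimodularAt p M) :
    M.Cobounds (List.replicate (t - s) 1 ++ List.replicate (s - t) (-1)) := by
  obtain ⟨l, hl, hl'⟩ := exists_cobounds_units hM
  obtain ⟨c, hc | hc⟩ := exists_cobounds_replicate hl hl'
  · have := h.le_of_cobounds_one hc
    have h1 : t - s = c := by omega
    have h2 : s - t = 0 := by omega
    simpa [h1, h2] using hc
  · have := h.le_of_cobounds_neg_one hc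
    have h1 : t - s = 0 := by omega
    have h2 : s - t = c := by omega
    simpa [h1, h2] using hc

/-- A unimodular lattice of signature `(s, t)` has an isotropic subgroup of rank `min s t`. -/
theorem Realized.exists_isotropic {M : IntLattice} {s t : ℕ} (h : M.Realized s t)
    (hr : finrank ℤ M = s + t) (hM : ∀ p : ℕ, p.Prime → UnimodularAt p M) :
    ∃ N : Submodule ℤ M, min s t ≤ finrank ℤ N ∧ ∀ x ∈ N, M.bil x x = 0 := by
  obtain ⟨N, hN, hN'⟩ := (h.cobounds hr hM).exists_isotropic
  refine ⟨N, ?_, hN'⟩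
  simp only [List.length_append, List.length_replicate] at hN
  omega

theorem exists_ne_zero_of_finrank_pos {M : Type*} [AddCommGroup M] [Module.Free ℤ M]
    [Module.Finite ℤ M] {N : Submodule ℤ M} (h : 0 < finrank ℤ N) : ∃ x ∈ N, x ≠ 0 := by
  refine Submodule.exists_mem_ne_zero_of_ne_bot fun h0 => ?_
  rw [h0, finrank_bot] at h
  exact lt_irrefl _ h

/-- In signature `(s, t)` with `s ≥ 1` and `t ≥ 2`, but not `(1, 2)`, the orthogonal complement of
a vector of norm `-2` is isotropic. -/
theorem Realized.exists_isotropic_orthogonal {M : IntLattice} {s t : ℕ} (h : M.Realized s t)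
    (hr : finrank ℤ M = s + t) (hM : ∀ p : ℕ, p.Prime → UnimodularAt p M)
    (hst : 2 ≤ s ∧ 2 ≤ t ∨ 1 ≤ s ∧ s + 2 ≤ t) {δ : M} (hδ : M.bil δ δ = -2) :
    ∃ x, x ≠ 0 ∧ M.bil x x = 0 ∧ M.bil x δ = 0 := by
  obtain hst | hst := hst
  · obtain ⟨N, hN, hN'⟩ := h.exists_isotropic hr hM
    have h1 := finrank_le_finrank_inf_ker_add_one (M.bil δ) N
    obtain ⟨x, ⟨hx, hxδ⟩, hx0⟩ := exists_ne_zero_of_finrank_pos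
      (N := N ⊓ LinearMap.ker (M.bil δ)) (by omega)
    exact ⟨x, hx0, hN' x hx, by rw [M.symm]; exact hxδ⟩
  -- Here `M ⊕ ⟨1⟩ ⊕ ⟨1⟩` has an isotropic subgroup `N` of rank at least `3`. An element of it in
  -- `δ^⊥ ⊕ ℤ (δ + c₁ ± c₂)` projects to an isotropic vector of `δ^⊥`.
  obtain ⟨c, hc⟩ : ∃ c, t - s = c + 2 := ⟨t - s - 2, by omega⟩
  have h1 := h.cobounds hr hM
  rw [show s - t = 0 by omega, hc, List.replicate_zero, List.append_nil] at h1
  obtain ⟨N, hN, hN'⟩ := Cobounds.exists_isotropic (M := (M.adjoin 1).adjoin 1)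
    (l := List.replicate c 1) h1
  rw [finrank_adjoin, finrank_adjoin, List.length_replicate] at hN
  let π : (M.adjoin 1).adjoin 1 →ₗ[ℤ] M := M.base 1 ∘ₗ (M.adjoin 1).base 1
  let a : (M.adjoin 1).adjoin 1 →ₗ[ℤ] ℤ := M.coord 1 ∘ₗ (M.adjoin 1).base 1
  let b : (M.adjoin 1).adjoin 1 →ₗ[ℤ] ℤ := (M.adjoin 1).coord 1
  have hbil : ∀ x y, ((M.adjoin 1).adjoin 1).bil x y =
      M.bil (π x) (π y) + a x * a y + b x * b y := fun x y => by
    simp only [adjoin_bil, π, a, b, LinearMap.comp_apply]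
    ring
  have key : ∀ σ : ℤ, σ ^ 2 = 1 → ∃ z ∈ N, z ≠ 0 ∧ a z = σ * b z ∧
      M.bil (π z) δ = -2 * a z := fun σ hσ => by
    have h2 := finrank_le_finrank_inf_ker_add_one (a - σ • b) N
    have h3 := finrank_le_finrank_inf_ker_add_one ((M.bil δ) ∘ₗ π + (2 : ℤ) • a)
      (N ⊓ LinearMap.ker (a - σ • b))
    obtain ⟨z, ⟨⟨hz, hz1⟩, hz2⟩, hz0⟩ := exists_ne_zero_of_finrank_pos
      (N := (N ⊓ LinearMap.ker (a - σ • b)) ⊓ LinearMap.ker ((M.bil δ) ∘ₗ π + (2 : ℤ) • a))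
      (by omega)
    refine ⟨z, hz, hz0, ?_, ?_⟩
    · simpa using sub_eq_zero.mp hz1
    · have : M.bil δ (π z) + 2 * a z = 0 := hz2
      rw [M.symm]
      linarith
  by_contra hno
  push Not at hno
  have key' : ∀ σ : ℤ, σ ^ 2 = 1 → ∃ z ∈ N, b z ≠ 0 ∧ a z = σ * b z ∧ π z = a z • δ :=
    fun σ hσ => by
    obtain ⟨z, hz, hz0, hz1, hz2⟩ := key σ hσ
    have hzz := hN' z hz
    rw [hbil] at hzz
    have hab : a z * a z = b z * b z := by
      rw [hz1]
      linear_combination (b z * b z) * hσ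
    have h3 : M.bil (π z - a z • δ) δ = 0 := by
      simp only [map_sub, map_smul, LinearMap.sub_apply, LinearMap.smul_apply, smul_eq_mul, hz2,
        hδ]
      ring
    have h4 : M.bil (π z - a z • δ) (π z - a z • δ) = 0 := by
      simp only [map_sub, map_smul, LinearMap.sub_apply, LinearMap.smul_apply, smul_eq_mul,
        hz2, hδ, M.symm δ (π z)]
      linear_combination hzz + hab
    have h5 : π z = a z • δ := by
      by_contra h6
      exact hno _ (sub_ne_zero.mpr h6) h4 h3
    refine ⟨z, hz, fun hb => hz0 ?_, hz1, h5⟩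
    have ha : a z = 0 := by rw [hz1, hb, mul_zero]
    exact adjoin_ext (adjoin_ext (by
      change π z = 0
      rw [h5, ha, zero_smul]) ha) hb
  -- The elements for the two signs would be nonzero multiples of `δ + c₁ + c₂` and
  -- `δ - c₁ + c₂` up to sign, which are not orthogonal.
  obtain ⟨y, hy, hyb, hya, hyπ⟩ := key' 1 (by norm_num)
  obtain ⟨z, hz, hzb, hza, hzπ⟩ := key' (-1) (by norm_num)
  have h6 := bil_eq_zero_of_isotropic hN' hy hz
  rw [hbil, hyπ, hzπ] at h6
  simp only [map_smul, LinearMap.smul_apply, smul_eq_mul, hδ, hya, hza] at h6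
  have h7 : b y * b z = 0 := by linarith
  exact (mul_ne_zero hyb hzb) h7

end IntLattice
end EvenLattice

namespace EvenLattice

open Module

namespace IntLattice

/-! ### Eichler transvections -/

/-- All norms are even. -/
def IsEven (M : IntLattice) : Prop := ∀ x : M, ∃ k : ℤ, M.bil x x = 2 * k

/-- An isometry of `M` which fixes `δ` maps `v` to `w`. -/
def OrbitRel (M : IntLattice) (δ v w : M) : Prop :=
  ∃ g : M ≃ₗ[ℤ] M, (∀ x y, M.bil (g x) (g y) = M.bil x y) ∧ g δ = δ ∧ g v = w

theorem OrbitRel.trans {M : IntLattice} {δ u v w : M} (h : M.OrbitRel δ u v)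
    (h' : M.OrbitRel δ v w) : M.OrbitRel δ u w := by
  obtain ⟨g, h1, h2, h3⟩ := h
  obtain ⟨g', h1', h2', h3'⟩ := h'
  exact ⟨g.trans g', fun x y => by simp [h1', h1], by simp [h2, h2'], by simp [h3, h3']⟩

theorem OrbitRel.symm {M : IntLattice} {δ v w : M} (h : M.OrbitRel δ v w) : M.OrbitRel δ w v := by
  obtain ⟨g, h1, h2, h3⟩ := h
  refine ⟨g.symm, fun x y => ?_, ?_, ?_⟩
  · rw [← h1, g.apply_symm_apply, g.apply_symm_apply]
  · rw [LinearEquiv.symm_apply_eq, h2]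
  · rw [LinearEquiv.symm_apply_eq, h3]

theorem OrbitRel.bil_self {M : IntLattice} {δ v w : M} (h : M.OrbitRel δ v w) :
    M.bil w w = M.bil v v := by
  obtain ⟨g, h1, -, rfl⟩ := h
  exact h1 v v

/-- The Eichler transvection attached to an isotropic vector `e` and a vector `a ∈ e^⊥` of norm
`2k`. -/
def transvection (M : IntLattice) (e a : M) (k : ℤ) : M →ₗ[ℤ] M :=
  LinearMap.id - (M.bil a).smulRight e + (M.bil e).smulRight a - k • (M.bil e).smulRight e

theorem transvection_apply (M : IntLattice) (e a : M) (k : ℤ) (x : M) :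
    M.transvection e a k x = x - M.bil a x • e + M.bil e x • a - k • M.bil e x • e := by
  simp only [transvection, LinearMap.sub_apply, LinearMap.add_apply, LinearMap.id_apply,
    LinearMap.smul_apply, LinearMap.smulRight_apply]

theorem transvection_neg_transvection {M : IntLattice} {e a : M} {k : ℤ} (he : M.bil e e = 0)
    (hea : M.bil e a = 0) (ha : M.bil a a = 2 * k) (x : M) :
    M.transvection e (-a) k (M.transvection e a k x) = x := by
  have hae : M.bil a e = 0 := by rw [M.symm, hea]
  simp only [transvection_apply, map_add, map_sub, map_neg, map_smul, LinearMap.neg_apply, he, hea,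
    hae, ha]
  module

theorem orbitRel_transvection {M : IntLattice} {δ e a : M} {k : ℤ} (he : M.bil e e = 0)
    (hea : M.bil e a = 0) (ha : M.bil a a = 2 * k) (heδ : M.bil e δ = 0) (haδ : M.bil a δ = 0)
    (v : M) : M.OrbitRel δ v (v - M.bil a v • e + M.bil e v • a - k • M.bil e v • e) := by
  refine ⟨{ M.transvection e a k with
    invFun := M.transvection e (-a) k
    left_inv := transvection_neg_transvection he hea ha
    right_inv := fun x => ?_ }, fun x y => ?_, ?_, M.transvection_apply e a k v⟩
  · have := transvection_neg_transvection (a := -a) (k := k) he (by simp [hea]) (by simp [ha]) x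
    rwa [neg_neg] at this
  · have hae : M.bil a e = 0 := by rw [M.symm, hea]
    change M.bil (M.transvection e a k x) (M.transvection e a k y) = _
    simp only [transvection_apply, map_add, map_sub, map_smul, LinearMap.add_apply,
      LinearMap.sub_apply, LinearMap.smul_apply, he, hea, hae, ha, smul_eq_mul, M.symm x a,
      M.symm x e]
    ring
  · change M.transvection e a k δ = δ
    simp [transvection_apply, heδ, haδ]

/-- A hyperbolic pair orthogonal to `δ`. -/
structure HypPair (M : IntLattice) (δ e f : M) : Prop where
  ee : M.bil e e = 0
  ff : M.bil f f = 0
  ef : M.bil e f = 1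
  eδ : M.bil e δ = 0
  fδ : M.bil f δ = 0

theorem HypPair.fe {M : IntLattice} {δ e f : M} (h : M.HypPair δ e f) : M.bil f e = 1 := by
  rw [M.symm, h.ef]

theorem HypPair.swap {M : IntLattice} {δ e f : M} (h : M.HypPair δ e f) : M.HypPair δ f e :=
  ⟨h.ff, h.ee, h.fe, h.fδ, h.eδ⟩

/-- Two orthogonal hyperbolic pairs in the orthogonal complement of `δ`. -/
structure TwoHypPairs (M : IntLattice) (δ e₁ f₁ e₂ f₂ : M) : Prop where
  fst : M.HypPair δ e₁ f₁
  snd : M.HypPair δ e₂ f₂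
  ee : M.bil e₁ e₂ = 0
  ef : M.bil e₁ f₂ = 0
  fe : M.bil f₁ e₂ = 0
  ff : M.bil f₁ f₂ = 0

section

variable {M : IntLattice} {δ e₁ f₁ e₂ f₂ : M}

theorem TwoHypPairs.swap (h : M.TwoHypPairs δ e₁ f₁ e₂ f₂) : M.TwoHypPairs δ e₁ f₁ f₂ e₂ :=
  ⟨h.fst, h.snd.swap, h.ef, h.ee, h.ff, h.fe⟩

/-- The transvections by multiples of `f₁` along `f₂`. -/
theorem TwoHypPairs.orbitRel_ff (h : M.TwoHypPairs δ e₁ f₁ e₂ f₂) (t : ℤ) (v : M) :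
    M.OrbitRel δ v (v - (t * M.bil v f₁) • f₂ + (t * M.bil v f₂) • f₁) := by
  have := orbitRel_transvection (a := t • f₁) (k := 0) h.snd.ff (by simp [M.symm f₂ f₁, h.ff])
    (by simp [h.fst.ff]) h.snd.fδ (by simp [h.fst.fδ]) v
  convert this using 1
  simp only [map_smul, LinearMap.smul_apply, smul_eq_mul, M.symm v]
  module

/-- The transvections by multiples of `e₁` along `f₂`. -/
theorem TwoHypPairs.orbitRel_fe (h : M.TwoHypPairs δ e₁ f₁ e₂ f₂) (t : ℤ) (v : M) :
    M.OrbitRel δ v (v - (t * M.bil v e₁) • f₂ + (t * M.bil v f₂) • e₁) := by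
  have := orbitRel_transvection (a := t • e₁) (k := 0) h.snd.ff (by simp [M.symm f₂ e₁, h.ef])
    (by simp [h.fst.ee]) h.snd.fδ (by simp [h.fst.eδ]) v
  convert this using 1
  simp only [map_smul, LinearMap.smul_apply, smul_eq_mul, M.symm v]
  module

/-- If the coefficient of `f₂` in `v` is not divisible by the positive coefficient `n` of `e₁`, two
steps of the Euclidean algorithm make the coefficient of `e₁` smaller and keep it positive. -/
theorem TwoHypPairs.dvd_of_minimal (h : M.TwoHypPairs δ e₁ f₁ e₂ f₂) {n : ℤ} (hn : 0 < n) {v : M}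
    (hv : M.bil v f₁ = n) (hmin : ∀ w, M.OrbitRel δ v w → 0 < M.bil w f₁ → n ≤ M.bil w f₁) :
    n ∣ M.bil v e₂ := by
  by_contra hnd
  set r := M.bil v e₂ % n with hr
  have hr0 : 0 < r := lt_of_le_of_ne (Int.emod_nonneg _ hn.ne')
    fun h0 => hnd (Int.dvd_of_emod_eq_zero h0.symm)
  have hrn : r < n := Int.emod_lt_of_pos _ hn
  have h1 := h.orbitRel_ff (M.bil v e₂ / n) v
  set w := v - (M.bil v e₂ / n * M.bil v f₁) • f₂ + (M.bil v e₂ / n * M.bil v f₂) • f₁ with hw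
  have hwf : M.bil w f₁ = n := by
    simp [hw, hv, h.fst.ff, M.symm f₂ f₁, h.ff]
  have hwe : M.bil w e₂ = r := by
    have := Int.emod_add_mul_ediv (M.bil v e₂) n
    simp only [hw, map_add, map_sub, map_smul, LinearMap.add_apply, LinearMap.sub_apply,
      LinearMap.smul_apply, h.snd.fe, h.fe, hv, smul_eq_mul]
    linarith
  have h2 := h.swap.orbitRel_fe (-((n - 1) / r)) w
  have h3 := Int.emod_add_mul_ediv (n - 1) r
  have h4 := Int.emod_nonneg (n - 1) hr0.ne'
  have h5 := Int.emod_lt_of_pos (n - 1) hr0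
  have h6 : M.bil (w - (-((n - 1) / r) * M.bil w e₁) • e₂ + (-((n - 1) / r) * M.bil w e₂) • e₁) f₁
      = (n - 1) % r + 1 := by
    simp only [map_add, map_sub, map_smul, LinearMap.add_apply, LinearMap.sub_apply,
      LinearMap.smul_apply, M.symm e₂ f₁, h.fe, h.fst.ef, hwe, hwf, smul_eq_mul]
    linarith
  have := hmin _ (h1.trans h2) (by omega)
  omega

/-- The transvections by a vector `y` orthogonal to both pairs, along `e₂`. -/
theorem TwoHypPairs.orbitRel_orthogonal (h : M.TwoHypPairs δ e₁ f₁ e₂ f₂) (hM : M.IsEven) {y : M}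
    (hye : M.bil y e₂ = 0) (hyδ : M.bil y δ = 0) {v : M} (hv : M.bil v e₂ = 0) :
    M.OrbitRel δ v (v - M.bil v y • e₂) := by
  obtain ⟨k, hk⟩ := hM y
  have := orbitRel_transvection h.snd.ee (by rw [M.symm, hye]) hk h.snd.eδ hyδ v
  simpa [M.symm _ v, hv] using this

/-- The orthogonal decomposition of the pairing with `z` along the two hyperbolic planes. -/
theorem TwoHypPairs.exists_orthogonal (h : M.TwoHypPairs δ e₁ f₁ e₂ f₂) {z : M}
    (hz : M.bil z δ = 0) : ∃ y, M.bil y e₂ = 0 ∧ M.bil y f₂ = 0 ∧ M.bil y e₁ = 0 ∧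
      M.bil y f₁ = 0 ∧ M.bil y δ = 0 ∧ ∀ v, M.bil v z = M.bil z f₁ * M.bil v e₁ +
        M.bil z e₁ * M.bil v f₁ + M.bil z f₂ * M.bil v e₂ + M.bil z e₂ * M.bil v f₂ +
        M.bil v y := by
  refine ⟨z - M.bil z f₁ • e₁ - M.bil z e₁ • f₁ - M.bil z f₂ • e₂ - M.bil z e₂ • f₂,
    ?_, ?_, ?_, ?_, ?_, fun v => ?_⟩
  all_goals
    simp [h.fst.ee, h.fst.ff, h.fst.ef, h.fst.fe, h.snd.ee, h.snd.ff, h.snd.ef, h.snd.fe, h.ee,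
      h.ef, h.fe, h.ff, M.symm e₂ e₁, M.symm e₂ f₁, M.symm f₂ e₁, M.symm f₂ f₁, h.fst.eδ, h.fst.fδ,
      h.snd.eδ, h.snd.fδ, hz]

theorem TwoHypPairs.exists_pos_of_ne_zero (h : M.TwoHypPairs δ e₁ f₁ e₂ f₂) {v : M}
    (hv : M.bil v f₂ ≠ 0) : ∃ w, M.OrbitRel δ v w ∧ 0 < M.bil w f₁ := by
  refine ⟨_, h.orbitRel_fe (M.bil v f₂ * (|M.bil v f₁| + 1)) v, ?_⟩
  simp only [map_add, map_sub, map_smul, LinearMap.add_apply, LinearMap.sub_apply,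
    LinearMap.smul_apply, M.symm f₂ f₁, h.ff, h.fst.ef, smul_eq_mul]
  have h1 : 0 < M.bil v f₂ ^ 2 := by positivity
  have h2 := neg_abs_le (M.bil v f₁)
  have h3 := abs_nonneg (M.bil v f₁)
  nlinarith

theorem TwoHypPairs.exists_pos (h : M.TwoHypPairs δ e₁ f₁ e₂ f₂) (hM : M.IsEven) {v z : M}
    (hz : M.bil z δ = 0) (hvz : M.bil v z = 1) :
    ∃ w, M.OrbitRel δ v w ∧ 0 < M.bil w f₁ := by
  suffices h0 : ∃ w, M.OrbitRel δ v w ∧ (M.bil w f₂ ≠ 0 ∨ M.bil w e₂ ≠ 0) by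
    obtain ⟨w, hw, hw' | hw'⟩ := h0
    · obtain ⟨u, hu, hu'⟩ := h.exists_pos_of_ne_zero hw'
      exact ⟨u, hw.trans hu, hu'⟩
    · obtain ⟨u, hu, hu'⟩ := h.swap.exists_pos_of_ne_zero hw'
      exact ⟨u, hw.trans hu, hu'⟩
  by_contra hno
  push Not at hno
  have hrefl : M.OrbitRel δ v v := ⟨LinearEquiv.refl ℤ M, fun _ _ => rfl, rfl, rfl⟩
  obtain ⟨hc, hd⟩ := hno v hrefl
  have ha : M.bil v f₁ = 0 := by
    have := (hno _ (h.orbitRel_ff 1 v)).2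
    simpa [h.snd.fe, h.fe, hd] using this
  have hb : M.bil v e₁ = 0 := by
    have := (hno _ (h.orbitRel_fe 1 v)).2
    simpa [h.snd.fe, h.ee, hd] using this
  obtain ⟨y, hy1, -, -, -, hy2, hy⟩ := h.exists_orthogonal hz
  have h1 := (hno _ (h.orbitRel_orthogonal hM hy1 hy2 hd)).1
  have h2 := hy v
  simp [hc, h.snd.ef] at h1
  simp [ha, hb, hc, hd, h1, hvz] at h2

/-- The Eichler criterion: a vector `v ∈ δ^⊥` with `⟨v, z⟩ = 1` for some `z ∈ δ^⊥` is equivalent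
to a vector `e₁ + m f₁`. The coefficient of `e₁` is minimised over the orbit; a minimal positive
coefficient divides all values of the form on the vector, so it is `1`. -/
theorem TwoHypPairs.exists_orbitRel (h : M.TwoHypPairs δ e₁ f₁ e₂ f₂) (hM : M.IsEven) {v z : M}
    (hvδ : M.bil v δ = 0) (hz : M.bil z δ = 0) (hvz : M.bil v z = 1) :
    ∃ m : ℤ, M.OrbitRel δ v (e₁ + m • f₁) := by
  classical
  have hex : ∃ n : ℕ, 0 < n ∧ ∃ w, M.OrbitRel δ v w ∧ M.bil w f₁ = n := by
    obtain ⟨w, hw, hpos⟩ := h.exists_pos hM hz hvz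
    exact ⟨(M.bil w f₁).toNat, by omega, w, hw, by omega⟩
  obtain ⟨hn0, w₀, hw₀, hw₀n⟩ := Nat.find_spec hex
  set n := Nat.find hex with hn
  have hmin : ∀ w, M.OrbitRel δ v w → 0 < M.bil w f₁ → (n : ℤ) ≤ M.bil w f₁ := fun w hw hpos => by
    have := Nat.find_min' hex (m := (M.bil w f₁).toNat) ⟨by omega, w, hw, by omega⟩
    omega
  have hn0' : (0 : ℤ) < n := by exact_mod_cast hn0
  have hdvd : ∀ w, M.OrbitRel δ v w → M.bil w f₁ = n → (n : ℤ) ∣ M.bil w e₂ ∧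
      (n : ℤ) ∣ M.bil w f₂ := fun w hw hwn =>
    ⟨h.dvd_of_minimal hn0' hwn fun u hu => hmin u (hw.trans hu),
      h.swap.dvd_of_minimal hn0' hwn fun u hu => hmin u (hw.trans hu)⟩
  -- Clear the coefficient of `f₂`.
  obtain ⟨w, hw, hwn, hwd⟩ : ∃ w, M.OrbitRel δ v w ∧ M.bil w f₁ = n ∧ M.bil w e₂ = 0 := by
    obtain ⟨t, ht⟩ := (hdvd w₀ hw₀ hw₀n).1
    refine ⟨_, hw₀.trans (h.orbitRel_ff t w₀), ?_, ?_⟩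
    · simp [M.symm f₂ f₁, h.ff, h.fst.ff, hw₀n]
    · simp only [map_add, map_sub, map_smul, LinearMap.add_apply, LinearMap.sub_apply,
        LinearMap.smul_apply, h.snd.fe, h.fe, hw₀n, ht, smul_eq_mul]
      ring
  have hwc := (hdvd w hw hwn).2
  have hwb : (n : ℤ) ∣ M.bil w e₁ := by
    have h1 := (hdvd _ (hw.trans (h.swap.orbitRel_fe 1 w)) (by
      simp [hwn, hwd, M.symm e₂ f₁, h.fe])).2
    simp only [map_add, map_sub, map_smul, LinearMap.add_apply, LinearMap.sub_apply,
      LinearMap.smul_apply, h.snd.ef, h.ef, hwd, smul_eq_mul, one_mul, mul_one, mul_zero,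
      add_zero] at h1
    exact (Int.dvd_iff_dvd_of_dvd_sub h1).mp hwc
  obtain ⟨g, hg, hgδ, hgv⟩ := id hw
  obtain ⟨y, hy1, -, -, hy4, hy2, hy⟩ := h.exists_orthogonal (z := g z) (by
    rw [← hgδ, hg, hz])
  have hwy : (n : ℤ) ∣ M.bil w y := by
    have h1 := (hdvd _ (hw.trans (h.orbitRel_orthogonal hM hy1 hy2 hwd)) (by
      simp [hwn, M.symm e₂ f₁, h.fe])).2
    simp only [map_sub, map_smul, LinearMap.sub_apply, LinearMap.smul_apply, h.snd.ef,
      smul_eq_mul, mul_one] at h1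
    exact (Int.dvd_iff_dvd_of_dvd_sub h1).mp hwc
  have hone : M.bil w f₁ = 1 := by
    have h1 := hy w
    rw [← hgv, hg, hvz, hgv, hwn, hwd] at h1
    have h2 : (n : ℤ) ∣ 1 := by
      rw [h1]
      exact ((((hwb.mul_left _).add (dvd_mul_left _ _)).add (by simp)).add (hwc.mul_left _)).add hwy
    rw [hwn]
    exact Int.eq_one_of_dvd_one hn0'.le h2
  -- Clear the component orthogonal to the first pair.
  have hwδ : M.bil w δ = 0 := by rw [← hgv, ← hgδ, hg, hvδ]
  obtain ⟨k, hk⟩ := hM (-(w - e₁ - M.bil w e₁ • f₁))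
  have h1 := orbitRel_transvection (δ := δ) h.fst.ff
    (by simp [h.fst.ff, h.fst.fe, M.symm f₁ w, hone]) hk h.fst.fδ
    (by simp [hwδ, h.fst.eδ, h.fst.fδ]) w
  rw [M.symm f₁ w, hone] at h1
  refine ⟨M.bil w e₁ - M.bil (-(w - e₁ - M.bil w e₁ • f₁)) w - k, hw.trans ?_⟩
  convert h1 using 1
  module

theorem TwoHypPairs.orbitRel_of_bil_self_eq (h : M.TwoHypPairs δ e₁ f₁ e₂ f₂) (hM : M.IsEven)
    {v z v' z' : M} (hvδ : M.bil v δ = 0) (hz : M.bil z δ = 0) (hvz : M.bil v z = 1)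
    (hvδ' : M.bil v' δ = 0) (hz' : M.bil z' δ = 0) (hvz' : M.bil v' z' = 1)
    (hn : M.bil v v = M.bil v' v') : M.OrbitRel δ v v' := by
  obtain ⟨m, hm⟩ := h.exists_orbitRel hM hvδ hz hvz
  obtain ⟨m', hm'⟩ := h.exists_orbitRel hM hvδ' hz' hvz'
  have h1 := hm.bil_self
  have h2 := hm'.bil_self
  simp [h.fst.ee, h.fst.ff, h.fst.ef, h.fst.fe] at h1 h2
  have : m = m' := by omega
  subst this
  exact hm.trans hm'.symm

end

end IntLattice
end EvenLattice

namespace EvenLattice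

open Module

namespace IntLattice

/-! ### Vectors of norm `-2` in unimodular lattices -/

/-- A vector not divisible by any prime has product `1` with some vector. -/
theorem exists_bil_eq_one {M : IntLattice} (hM : ∀ p : ℕ, p.Prime → UnimodularAt p M) {x : M}
    (hx : ∀ p : ℕ, p.Prime → ¬ ∃ x', x = (p : ℤ) • x') : ∃ z, M.bil x z = 1 := by
  obtain ⟨d, hd⟩ := Submodule.IsPrincipal.principal (LinearMap.range (M.bil x))
  have hdvd : ∀ y, d ∣ M.bil x y := fun y => by
    have : M.bil x y ∈ LinearMap.range (M.bil x) := ⟨y, rfl⟩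
    rw [hd] at this
    exact Ideal.mem_span_singleton.mp this
  by_cases h1 : d.natAbs = 1
  · have h2 : (1 : ℤ) ∈ LinearMap.range (M.bil x) := by
      rw [hd]
      exact Ideal.mem_span_singleton.mpr (Int.isUnit_iff_natAbs_eq.mpr h1).dvd
    exact h2
  · obtain ⟨p, hp, hpd⟩ := Nat.exists_prime_and_dvd h1
    exact absurd (hM p hp x fun y => (Int.natCast_dvd.mpr hpd).trans (hdvd y)) (hx p hp)

theorem exists_bil_eq_one_of_norm {M : IntLattice} (hM : ∀ p : ℕ, p.Prime → UnimodularAt p M)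
    {δ : M} (hδ : M.bil δ δ = -2) : ∃ z, M.bil δ z = 1 := by
  refine exists_bil_eq_one hM ?_
  rintro p hp ⟨x', rfl⟩
  simp only [map_smul, LinearMap.smul_apply, smul_eq_mul] at hδ
  have h1 : (p : ℤ) * p ∣ 2 := ⟨-M.bil x' x', by linear_combination hδ⟩
  have h2 := Int.le_of_dvd (by norm_num) h1
  have h3 : (2 : ℤ) ≤ p := by exact_mod_cast hp.two_le
  nlinarith

/-- An isotropic vector with product `1` with some vector is part of a hyperbolic pair. -/
theorem exists_hypPair_of_bil_eq_one {M : IntLattice} (hev : M.IsEven) {δ e y : M}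
    (he : M.bil e e = 0) (hey : M.bil e y = 1) (heδ : M.bil e δ = 0) (hyδ : M.bil y δ = 0) :
    ∃ f, M.HypPair δ e f := by
  obtain ⟨k, hk⟩ := hev y
  refine ⟨y - k • e, he, ?_, ?_, heδ, ?_⟩
  · simp only [map_sub, map_smul, LinearMap.sub_apply, LinearMap.smul_apply, he, hk, hey,
      M.symm y e, smul_eq_mul]
    ring
  · simp [he, hey]
  · simp [heδ, hyδ]

/-- A unimodular even lattice with an isotropic vector contains a hyperbolic pair. Choosing the
isotropic vector with the least possible positive product avoids saturating a subgroup. -/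
theorem exists_hypPair {M : IntLattice} (hev : M.IsEven)
    (hM : ∀ p : ℕ, p.Prime → UnimodularAt p M) (hnd : ∀ x, (∀ y, M.bil x y = 0) → x = 0) {x : M}
    (hx0 : x ≠ 0) (hx : M.bil x x = 0) : ∃ e f, M.HypPair 0 e f := by
  classical
  obtain ⟨y, hy⟩ : ∃ y, M.bil x y ≠ 0 := by
    by_contra! h
    exact hx0 (hnd x h)
  have hex : ∃ n : ℕ, 0 < n ∧ ∃ x y, M.bil x x = 0 ∧ (M.bil x y).natAbs = n :=
    ⟨_, Int.natAbs_pos.mpr hy, x, y, hx, rfl⟩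
  obtain ⟨hn0, e, y, he, hey⟩ := Nat.find_spec hex
  obtain ⟨z, hz⟩ := exists_bil_eq_one hM (x := e) (by
    rintro p hp ⟨e', rfl⟩
    have hp0 : (p : ℤ) ≠ 0 := by exact_mod_cast hp.ne_zero
    simp only [map_smul, LinearMap.smul_apply, smul_eq_mul, mul_eq_zero, hp0, false_or] at he
    simp only [map_smul, LinearMap.smul_apply, smul_eq_mul, Int.natAbs_mul, Int.natAbs_natCast]
      at hey
    have h1 : 0 < (M.bil e' y).natAbs := Nat.pos_of_ne_zero fun h => by
      rw [h, mul_zero] at hey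
      omega
    have h2 := Nat.find_min' hex ⟨h1, e', y, he, rfl⟩
    have := hp.two_le
    nlinarith)
  obtain ⟨f, hf⟩ := exists_hypPair_of_bil_eq_one hev he hz (map_zero _) (map_zero _)
  exact ⟨e, f, hf⟩

/-- If the orthogonal complement `K` of a vector `δ` of norm `-2` is isotropic, it contains a
hyperbolic pair. An isotropic `e ∈ K` with the least possible positive product with a vector of `K`
is not divisible by any prime, so `⟨e, z⟩ = 1` for some `z`. If `⟨z, δ⟩` is even, a multiple of `δ`
moves `z` into `K`. Otherwise `K` contains vectors whose products with `e` are odd and `2`, unless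
`⟨e, u⟩ ≡ ⟨u, δ⟩` modulo `2` for all `u`; but this would make `e - δ` divisible by `2`, although its
norm is `-2`. -/
theorem exists_hypPair_orthogonal {M : IntLattice} (hev : M.IsEven)
    (hM : ∀ p : ℕ, p.Prime → UnimodularAt p M) (hnd : ∀ x, (∀ y, M.bil x y = 0) → x = 0) {δ x : M}
    (hδ : M.bil δ δ = -2) (hx0 : x ≠ 0) (hx : M.bil x x = 0) (hxδ : M.bil x δ = 0) :
    ∃ e f, M.HypPair δ e f := by
  classical
  have hK : ∀ z, M.bil ((2 : ℤ) • z + M.bil z δ • δ) δ = 0 := fun z => by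
    simp only [map_add, map_smul, LinearMap.add_apply, LinearMap.smul_apply, hδ, smul_eq_mul]
    ring
  have hKe : ∀ e z, M.bil e δ = 0 → M.bil e ((2 : ℤ) • z + M.bil z δ • δ) = 2 * M.bil e z :=
    fun e z he => by simp [he]
  have hex : ∃ n : ℕ, 0 < n ∧ ∃ x y, M.bil x x = 0 ∧ M.bil x δ = 0 ∧ M.bil y δ = 0 ∧
      (M.bil x y).natAbs = n := by
    obtain ⟨y, hy⟩ : ∃ y, M.bil x y ≠ 0 := by
      by_contra! h
      exact hx0 (hnd x h)
    refine ⟨_, Int.natAbs_pos.mpr ?_, x, (2 : ℤ) • y + M.bil y δ • δ, hx, hxδ, hK y, rfl⟩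
    rw [hKe x y hxδ]
    exact mul_ne_zero two_ne_zero hy
  obtain ⟨hn0, e, y, he, heδ, hyδ, hey⟩ := Nat.find_spec hex
  have hprim : ∀ p : ℕ, p.Prime → ¬ ∃ e', e = (p : ℤ) • e' := by
    rintro p hp ⟨e', rfl⟩
    have hp0 : (p : ℤ) ≠ 0 := by exact_mod_cast hp.ne_zero
    simp only [map_smul, LinearMap.smul_apply, smul_eq_mul, mul_eq_zero, hp0, false_or] at he heδ
    simp only [map_smul, LinearMap.smul_apply, smul_eq_mul, Int.natAbs_mul, Int.natAbs_natCast]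
      at hey
    have h1 : 0 < (M.bil e' y).natAbs := Nat.pos_of_ne_zero fun h => by
      rw [h, mul_zero] at hey
      omega
    have h2 := Nat.find_min' hex ⟨h1, e', y, he, heδ, hyδ, rfl⟩
    have := hp.two_le
    nlinarith
  obtain ⟨z, hz⟩ := exists_bil_eq_one hM hprim
  by_cases hzδ : (2 : ℤ) ∣ M.bil z δ
  · -- A multiple of `δ` moves `z` into `K`.
    obtain ⟨c, hc⟩ := hzδ
    obtain ⟨f, hf⟩ := exists_hypPair_of_bil_eq_one hev he (y := z + c • δ) (by simp [hz, heδ]) heδ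
      (by simp [hc, hδ]; ring)
    exact ⟨e, f, hf⟩
  by_cases hex1 : ∃ u, ¬ (2 : ℤ) ∣ M.bil e u - M.bil u δ
  · -- Some `u` or `z + u` has odd product with `e` and even product with `δ`, or conversely.
    obtain ⟨u, hu⟩ := hex1
    obtain ⟨w, hw1, hw2⟩ : ∃ w, M.bil e w % 2 = 1 ∧ M.bil w δ % 2 = 0 := by
      by_cases h1 : M.bil u δ % 2 = 0
      · exact ⟨u, by omega, h1⟩
      · refine ⟨z + u, ?_, ?_⟩ <;> simp only [map_add, LinearMap.add_apply, hz] <;> omega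
    obtain ⟨c, hc⟩ := Int.dvd_of_emod_eq_zero hw2
    -- `s = w + c δ ∈ K` has odd product with `e`, and `2 z + ⟨z, δ⟩ δ ∈ K` has product `2`.
    have hs : M.bil (w + c • δ) δ = 0 := by simp [hc, hδ]; ring
    have hes : M.bil e (w + c • δ) = M.bil e w := by simp [heδ]
    obtain ⟨f, hf⟩ := exists_hypPair_of_bil_eq_one hev he
      (y := (w + c • δ) - (M.bil e w / 2) • ((2 : ℤ) • z + M.bil z δ • δ)) (by
        rw [map_sub, map_smul, hes, hKe e z heδ, hz, smul_eq_mul]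
        omega) heδ (by
        rw [map_sub, map_smul, LinearMap.sub_apply, LinearMap.smul_apply, hs, hK z]
        simp)
    exact ⟨e, f, hf⟩
  · push Not at hex1
    obtain ⟨w, hw⟩ := hM 2 Nat.prime_two (e - δ) fun u => by
      have := hex1 u
      rw [M.symm u δ] at this
      simpa using this
    have h1 : M.bil (e - δ) (e - δ) = -2 := by
      simp [he, hδ, heδ, M.symm δ e]
    rw [hw] at h1
    simp at h1
    omega

/-- The orthogonal sum of `M` with a hyperbolic plane. -/
def addHyp (M : IntLattice) : IntLattice where
  carrier := M × ℤ × ℤ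
  bil := LinearMap.mk₂ ℤ (fun x y => M.bil x.1 y.1 + (x.2.1 * y.2.2 + x.2.2 * y.2.1))
    (fun x x' y => by simp; ring) (fun c x y => by simp; ring)
    (fun x y y' => by simp; ring) (fun c x y => by simp; ring)
  symm x y := by
    simp only [LinearMap.mk₂_apply, M.symm x.1 y.1]
    ring

/-- The projection of `M ⊕ U` to `M`. -/
def hypBase (M : IntLattice) : M.addHyp →ₗ[ℤ] M where
  toFun x := Prod.fst x
  map_add' _ _ := rfl
  map_smul' _ _ := rfl

/-- The first coordinate along `U` in `M ⊕ U`. -/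
def hypFst (M : IntLattice) : M.addHyp →ₗ[ℤ] ℤ where
  toFun x := Prod.fst (Prod.snd x)
  map_add' _ _ := rfl
  map_smul' _ _ := rfl

/-- The second coordinate along `U` in `M ⊕ U`. -/
def hypSnd (M : IntLattice) : M.addHyp →ₗ[ℤ] ℤ where
  toFun x := Prod.snd (Prod.snd x)
  map_add' _ _ := rfl
  map_smul' _ _ := rfl

theorem addHyp_ext {M : IntLattice} {x y : M.addHyp} (h : M.hypBase x = M.hypBase y)
    (h₁ : M.hypFst x = M.hypFst y) (h₂ : M.hypSnd x = M.hypSnd y) : x = y :=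
  Prod.ext h (Prod.ext h₁ h₂)

/-- The inclusion of `M` in `M ⊕ U`. -/
def hypIncl (M : IntLattice) : M →ₗ[ℤ] M.addHyp where
  toFun x := (x, 0, 0)
  map_add' x y := by
    change _ = (x + y, (0 : ℤ) + 0, (0 : ℤ) + 0)
    simp
  map_smul' c x := by
    change _ = (c • x, c • (0 : ℤ), c • (0 : ℤ))
    simp

/-- The first vector of the hyperbolic pair spanning `U` in `M ⊕ U`. -/
def hypE (M : IntLattice) : M.addHyp := ((0 : M), (1 : ℤ), (0 : ℤ))

/-- The second vector of the hyperbolic pair spanning `U` in `M ⊕ U`. -/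
def hypF (M : IntLattice) : M.addHyp := ((0 : M), (0 : ℤ), (1 : ℤ))

theorem addHyp_bil (M : IntLattice) (x y : M.addHyp) : M.addHyp.bil x y =
    M.bil (M.hypBase x) (M.hypBase y) + (M.hypFst x * M.hypSnd y + M.hypSnd x * M.hypFst y) := rfl

@[simp] theorem hypBase_hypIncl (M : IntLattice) (x : M) : M.hypBase (M.hypIncl x) = x := rfl

@[simp] theorem hypFst_hypIncl (M : IntLattice) (x : M) : M.hypFst (M.hypIncl x) = 0 := rfl

@[simp] theorem hypSnd_hypIncl (M : IntLattice) (x : M) : M.hypSnd (M.hypIncl x) = 0 := rfl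

@[simp] theorem hypBase_hypE (M : IntLattice) : M.hypBase M.hypE = 0 := rfl

@[simp] theorem hypFst_hypE (M : IntLattice) : M.hypFst M.hypE = 1 := rfl

@[simp] theorem hypSnd_hypE (M : IntLattice) : M.hypSnd M.hypE = 0 := rfl

@[simp] theorem hypBase_hypF (M : IntLattice) : M.hypBase M.hypF = 0 := rfl

@[simp] theorem hypFst_hypF (M : IntLattice) : M.hypFst M.hypF = 0 := rfl

@[simp] theorem hypSnd_hypF (M : IntLattice) : M.hypSnd M.hypF = 1 := rfl

theorem addHyp_bil_hypIncl (M : IntLattice) (x y : M) :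
    M.addHyp.bil (M.hypIncl x) (M.hypIncl y) = M.bil x y := by
  simp [addHyp_bil]

theorem addHyp_bil_hypIncl_hypE (M : IntLattice) (x : M) :
    M.addHyp.bil (M.hypIncl x) M.hypE = 0 := by
  simp [addHyp_bil]

theorem addHyp_bil_hypIncl_hypF (M : IntLattice) (x : M) :
    M.addHyp.bil (M.hypIncl x) M.hypF = 0 := by
  simp [addHyp_bil]

theorem addHyp_hypPair (M : IntLattice) (δ : M) :
    M.addHyp.HypPair (M.hypIncl δ) M.hypE M.hypF where
  ee := by simp [addHyp_bil]
  ff := by simp [addHyp_bil]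
  ef := by simp [addHyp_bil]
  eδ := by rw [M.addHyp.symm, addHyp_bil_hypIncl_hypE]
  fδ := by rw [M.addHyp.symm, addHyp_bil_hypIncl_hypF]

/-- The orthogonal complement of the isotropic vector `hypE` is `M ⊕ ℤ hypE`. -/
theorem eq_hypIncl_add {M : IntLattice} {x : M.addHyp} (hx : M.addHyp.bil x M.hypE = 0) :
    ∃ s : ℤ, x = M.hypIncl (M.hypBase x) + s • M.hypE := by
  have ht : M.hypSnd x = 0 := by simpa [addHyp_bil] using hx
  exact ⟨M.hypFst x, addHyp_ext (by simp) (by simp) (by simp [ht])⟩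

/-- If `δ^⊥` contains a hyperbolic plane for a vector `δ` of norm `-2`, every other vector `δ'` of
norm `-2` is equivalent to it. By the Eichler criterion in `L = M ⊕ U` an isometry `g` of `L` maps
`δ'` to `δ`. As `δ^⊥` in `L` contains two hyperbolic planes, another one, fixing `δ`, maps
`g e` back to `e`, where `e` is the first basis vector of `U`. The composition induces an isometry
of `e^⊥ / e = M`. -/
theorem exists_isometry_of_norm {M : IntLattice} (hev : M.IsEven)
    (hM : ∀ p : ℕ, p.Prime → UnimodularAt p M) {δ δ' e f : M} (hδ : M.bil δ δ = -2)
    (hδ' : M.bil δ' δ' = -2) (h : M.HypPair δ e f) :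
    ∃ g : M ≃ₗ[ℤ] M, (∀ x y, M.bil (g x) (g y) = M.bil x y) ∧ g δ' = δ := by
  have hevL : M.addHyp.IsEven := fun x => by
    obtain ⟨k, hk⟩ := hev (M.hypBase x)
    exact ⟨k + M.hypFst x * M.hypSnd x, by rw [addHyp_bil, hk]; ring⟩
  have hpair : M.addHyp.HypPair (M.hypIncl δ) (M.hypIncl e) (M.hypIncl f) :=
    ⟨by rw [addHyp_bil_hypIncl, h.ee], by rw [addHyp_bil_hypIncl, h.ff],
      by rw [addHyp_bil_hypIncl, h.ef], by rw [addHyp_bil_hypIncl, h.eδ],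
      by rw [addHyp_bil_hypIncl, h.fδ]⟩
  have htwo : M.addHyp.TwoHypPairs (M.hypIncl δ) M.hypE M.hypF (M.hypIncl e) (M.hypIncl f) :=
    ⟨M.addHyp_hypPair δ, hpair, by rw [M.addHyp.symm, addHyp_bil_hypIncl_hypE],
      by rw [M.addHyp.symm, addHyp_bil_hypIncl_hypE],
      by rw [M.addHyp.symm, addHyp_bil_hypIncl_hypF],
      by rw [M.addHyp.symm, addHyp_bil_hypIncl_hypF]⟩
  have htwo0 : M.addHyp.TwoHypPairs 0 M.hypE M.hypF (M.hypIncl e) (M.hypIncl f) :=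
    ⟨⟨htwo.fst.ee, htwo.fst.ff, htwo.fst.ef, map_zero _, map_zero _⟩,
      ⟨htwo.snd.ee, htwo.snd.ff, htwo.snd.ef, map_zero _, map_zero _⟩,
      htwo.ee, htwo.ef, htwo.fe, htwo.ff⟩
  obtain ⟨z, hz⟩ := exists_bil_eq_one_of_norm hM hδ
  obtain ⟨z', hz'⟩ := exists_bil_eq_one_of_norm hM hδ'
  obtain ⟨g, hg, -, hgδ⟩ := htwo0.orbitRel_of_bil_self_eq hevL (v := M.hypIncl δ')
    (z := M.hypIncl z') (v' := M.hypIncl δ) (z' := M.hypIncl z) (map_zero _) (map_zero _)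
    (by rw [addHyp_bil_hypIncl, hz']) (map_zero _) (map_zero _) (by rw [addHyp_bil_hypIncl, hz])
    (by rw [addHyp_bil_hypIncl, addHyp_bil_hypIncl, hδ, hδ'])
  have hE := M.addHyp_hypPair δ'
  obtain ⟨k, hk, hkδ, hke⟩ := htwo.orbitRel_of_bil_self_eq hevL (v := g M.hypE)
    (z := g M.hypF) (v' := M.hypE) (z' := M.hypF) (by rw [← hgδ, hg, hE.eδ])
    (by rw [← hgδ, hg, hE.fδ]) (by rw [hg, hE.ef]) htwo.fst.eδ htwo.fst.fδ htwo.fst.ef (by rw [hg])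
  let G : M.addHyp ≃ₗ[ℤ] M.addHyp := g.trans k
  have hG : ∀ x y, M.addHyp.bil (G x) (G y) = M.addHyp.bil x y := fun x y => by
    simp [G, hk, hg]
  have hGe : G M.hypE = M.hypE := hke
  have hGδ : G (M.hypIncl δ') = M.hypIncl δ := by simp [G, hgδ, hkδ]
  have hGs : ∀ x y, M.addHyp.bil (G.symm x) (G.symm y) = M.addHyp.bil x y := fun x y => by
    rw [← hG, G.apply_symm_apply, G.apply_symm_apply]
  have hGse : G.symm M.hypE = M.hypE := by rw [LinearEquiv.symm_apply_eq, hGe]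
  -- An isometry fixing `hypE` induces a map of `M`, up to multiples of `hypE`.
  have key : ∀ K : M.addHyp ≃ₗ[ℤ] M.addHyp, (∀ x y, M.addHyp.bil (K x) (K y) =
      M.addHyp.bil x y) → K M.hypE = M.hypE → ∀ x : M, ∃ s : ℤ,
      K (M.hypIncl x) = M.hypIncl (M.hypBase (K (M.hypIncl x))) + s • M.hypE :=
    fun K hK hKe x => eq_hypIncl_add (by
      conv_lhs => rw [← hKe]
      rw [hK, addHyp_bil_hypIncl_hypE])
  have hinv : ∀ K : M.addHyp ≃ₗ[ℤ] M.addHyp, (∀ x y, M.addHyp.bil (K x) (K y) =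
      M.addHyp.bil x y) → K M.hypE = M.hypE → K.symm M.hypE = M.hypE → ∀ x : M,
      M.hypBase (K.symm (M.hypIncl (M.hypBase (K (M.hypIncl x))))) = x :=
    fun K hK hKe hKs x => by
      obtain ⟨s, hs⟩ := key K hK hKe x
      rw [eq_sub_of_add_eq hs.symm, map_sub, map_smul, hKs, K.symm_apply_apply]
      simp
  refine ⟨{ M.hypBase ∘ₗ G.toLinearMap ∘ₗ M.hypIncl with
    invFun := fun x => M.hypBase (G.symm (M.hypIncl x))
    left_inv := fun x => hinv G hG hGe hGse x
    right_inv := fun x => hinv G.symm hGs hGse (by simpa using hGe) x }, fun x y => ?_, ?_⟩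
  · change M.bil (M.hypBase (G (M.hypIncl x))) (M.hypBase (G (M.hypIncl y))) = _
    obtain ⟨s, hs⟩ := key G hG hGe x
    obtain ⟨t, ht⟩ := key G hG hGe y
    rw [← addHyp_bil_hypIncl, eq_sub_of_add_eq hs.symm, eq_sub_of_add_eq ht.symm]
    have h1 : ∀ u, M.addHyp.bil (G (M.hypIncl u)) M.hypE = 0 := fun u => by
      conv_lhs => rw [← hGe]
      rw [hG, addHyp_bil_hypIncl_hypE]
    simp only [map_sub, map_smul, LinearMap.sub_apply, LinearMap.smul_apply, h1,
      M.addHyp.symm M.hypE, hG, addHyp_bil_hypIncl, htwo.fst.ee]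
    simp
  · change M.hypBase (G (M.hypIncl δ')) = δ
    rw [hGδ, hypBase_hypIncl]

/-- In a lattice of rank two which contains a hyperbolic pair, a vector of norm `-2` is unique up
to sign. -/
theorem eq_or_eq_neg_of_finrank_le_two {M : IntLattice} (hr : finrank ℤ M ≤ 2) {e f : M}
    (h : M.HypPair 0 e f) {δ : M} (hδ : M.bil δ δ = -2) : δ = e - f ∨ δ = -(e - f) := by
  set a := M.bil δ f with ha
  set b := M.bil δ e with hb
  have hw : δ = a • e + b • f := by
    by_contra h0
    set w := δ - (a • e + b • f) with hw
    have hwe : M.bil e w = 0 := by simp [hw, h.ee, h.ef, M.symm e δ, ← hb]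
    have hwf : M.bil f w = 0 := by simp [hw, h.ff, h.fe, M.symm f δ, ← ha]
    have hli : LinearIndependent ℤ ![e, f, w] := by
      rw [Fintype.linearIndependent_iff]
      intro c hc
      rw [Fin.sum_univ_three] at hc
      simp only [Matrix.cons_val_zero, Matrix.cons_val_one, Matrix.cons_val] at hc
      have h1 := congrArg (M.bil e) hc
      have h2 := congrArg (M.bil f) hc
      simp [h.ee, h.ef, hwe] at h1
      simp [h.ff, h.fe, hwf] at h2
      simp only [h1, h2, zero_smul, zero_add, smul_eq_zero, hw, sub_eq_zero, h0, or_false] at hc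
      intro i
      fin_cases i
      · exact h2
      · exact h1
      · exact hc
    have := hli.fintype_card_le_finrank
    simp at this
    omega
  have hab : a * b = -1 := by
    rw [hw] at hδ
    simp only [map_add, map_smul, LinearMap.add_apply, LinearMap.smul_apply, h.ee, h.ef, h.fe,
      h.ff, smul_eq_mul] at hδ
    linarith
  rcases Int.mul_eq_neg_one_iff_eq_one_or_neg_one.mp hab with ⟨h1, h2⟩ | ⟨h1, h2⟩
  · left
    rw [hw, h1, h2]
    module
  · right
    rw [hw, h1, h2]
    module

end IntLattice
end EvenLattice

namespace EvenLattice

open Module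

/-! ### The lattice `Λ` in `ℝ^{p,q}` -/

section

variable {p q : ℕ}

theorem eq_zero_of_form_eq_zero {x : Rpq p q} (h : ∀ y, form x y = 0) : x = 0 := by
  have h1 := h (Sum.elim (fun i => x (Sum.inl i)) fun i => -x (Sum.inr i))
  simp only [form, Sum.elim_inl, Sum.elim_inr, mul_neg, Finset.sum_neg_distrib,
    sub_neg_eq_add] at h1
  have h2 : ∀ i, x (Sum.inl i) * x (Sum.inl i) = 0 := fun i => by
    have h3 := Finset.single_le_sum (f := fun i => x (Sum.inl i) * x (Sum.inl i))
      (fun i _ => mul_self_nonneg _) (Finset.mem_univ i)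
    have h4 := Finset.sum_nonneg (s := Finset.univ) (f := fun i => x (Sum.inr i) * x (Sum.inr i))
      (fun i _ => mul_self_nonneg _)
    have h5 := mul_self_nonneg (x (Sum.inl i))
    linarith
  have h2' : ∀ i, x (Sum.inr i) * x (Sum.inr i) = 0 := fun i => by
    have h3 := Finset.single_le_sum (f := fun i => x (Sum.inr i) * x (Sum.inr i))
      (fun i _ => mul_self_nonneg _) (Finset.mem_univ i)
    have h4 := Finset.sum_nonneg (s := Finset.univ) (f := fun i => x (Sum.inl i) * x (Sum.inl i))
      (fun i _ => mul_self_nonneg _)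
    have h5 := mul_self_nonneg (x (Sum.inr i))
    linarith
  funext i
  rcases i with i | i
  · exact mul_self_eq_zero.mp (h2 i)
  · exact mul_self_eq_zero.mp (h2' i)

theorem IsEvenUnimodular.floor_form (Λ : Submodule ℤ (Rpq p q)) (hΛ : IsEvenUnimodular Λ)
    {x y : Rpq p q} (hx : x ∈ Λ) (hy : y ∈ Λ) :
    ((⌊form x y⌋ : ℤ) : ℝ) = form x y := by
  obtain ⟨n, hn⟩ := (hΛ.unimodular x).mp hx y hy
  rw [hn, Int.floor_intCast]

variable (Λ : Submodule ℤ (Rpq p q)) [DiscreteTopology Λ] [IsZLattice ℝ Λ]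
  (hΛ : IsEvenUnimodular Λ)

/-- The even unimodular lattice `Λ` as an integral lattice. -/
noncomputable def IsEvenUnimodular.toIntLattice : IntLattice :=
  letI : Module.Free ℤ Λ := ZLattice.module_free ℝ Λ
  letI : Module.Finite ℤ Λ := ZLattice.module_finite ℝ Λ
  { carrier := Λ
    bil := LinearMap.mk₂ ℤ (fun x y => ⌊form (x : Rpq p q) y⌋)
      (fun x x' y => by
        apply Int.cast_injective (α := ℝ)
        rw [Int.cast_add, hΛ.floor_form Λ (x + x').2 y.2, hΛ.floor_form Λ x.2 y.2,
          hΛ.floor_form Λ x'.2 y.2]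
        exact form_add_left _ _ _)
      (fun c x y => by
        apply Int.cast_injective (α := ℝ)
        rw [smul_eq_mul, Int.cast_mul, hΛ.floor_form Λ (c • x).2 y.2, hΛ.floor_form Λ x.2 y.2]
        rw [Submodule.coe_smul, ← Int.cast_smul_eq_zsmul ℝ, form_smul_left])
      (fun x y y' => by
        apply Int.cast_injective (α := ℝ)
        rw [Int.cast_add, hΛ.floor_form Λ x.2 (y + y').2, hΛ.floor_form Λ x.2 y.2,
          hΛ.floor_form Λ x.2 y'.2, form_comm, form_comm _ (y : Rpq p q),
          form_comm _ (y' : Rpq p q)]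
        exact form_add_left _ _ _)
      (fun c x y => by
        apply Int.cast_injective (α := ℝ)
        rw [smul_eq_mul, Int.cast_mul, hΛ.floor_form Λ x.2 (c • y).2, hΛ.floor_form Λ x.2 y.2]
        rw [Submodule.coe_smul, ← Int.cast_smul_eq_zsmul ℝ, form_comm, form_smul_left, form_comm])
    symm := fun x y => by
      simp only [LinearMap.mk₂_apply]
      rw [form_comm] }

/-- The inclusion of `Λ` in `ℝ^{p,q}`. -/
noncomputable def IsEvenUnimodular.incl : hΛ.toIntLattice Λ →ₗ[ℤ] Rpq p q := Λ.subtype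

theorem IsEvenUnimodular.incl_mem (x : hΛ.toIntLattice Λ) : hΛ.incl Λ x ∈ Λ := Subtype.property x

theorem IsEvenUnimodular.incl_injective : Function.Injective (hΛ.incl Λ) :=
  Λ.subtype_injective

theorem IsEvenUnimodular.exists_incl_eq {x : Rpq p q} (hx : x ∈ Λ) :
    ∃ y : hΛ.toIntLattice Λ, hΛ.incl Λ y = x := ⟨⟨x, hx⟩, rfl⟩

theorem IsEvenUnimodular.form_incl (x y : hΛ.toIntLattice Λ) :
    form (hΛ.incl Λ x) (hΛ.incl Λ y) = ((hΛ.toIntLattice Λ).bil x y : ℤ) :=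
  (hΛ.floor_form Λ (Subtype.property x) (Subtype.property y)).symm

theorem IsEvenUnimodular.realized : (hΛ.toIntLattice Λ).Realized p q := by
  have h0 : IsOpen ({0} : Set Λ) := isOpen_discrete _
  obtain ⟨ε, hε, hball⟩ := Metric.isOpen_iff.mp h0 0 rfl
  refine ⟨hΛ.incl Λ, ε, hε, fun x hx => ?_, fun x y => (hΛ.form_incl Λ x y).symm⟩
  by_contra! hlt
  have hlt' : (show Λ from x) ∈ Metric.ball (0 : Λ) ε := mem_ball_zero_iff.mpr hlt
  exact hx (hball hlt')

theorem IsEvenUnimodular.finrank_toIntLattice : finrank ℤ (hΛ.toIntLattice Λ) = p + q := by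
  have h := ZLattice.rank ℝ Λ
  simp only [Module.finrank_fintype_fun_eq_card, Fintype.card_sum, Fintype.card_fin] at h
  exact h

theorem IsEvenUnimodular.unimodularAt (ℓ : ℕ) (hℓ : ℓ.Prime) :
    IntLattice.UnimodularAt ℓ (hΛ.toIntLattice Λ) := by
  intro x hx
  have h0 : (ℓ : ℝ) ≠ 0 := by exact_mod_cast hℓ.ne_zero
  obtain ⟨x', hx'⟩ := hΛ.exists_incl_eq Λ (x := (ℓ : ℝ)⁻¹ • hΛ.incl Λ x) (by
    rw [hΛ.unimodular]
    intro y hy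
    obtain ⟨y, rfl⟩ := hΛ.exists_incl_eq Λ hy
    obtain ⟨n, hn⟩ := hx y
    refine ⟨n, ?_⟩
    rw [form_smul_left, hΛ.form_incl, hn]
    push_cast
    field_simp)
  refine ⟨x', hΛ.incl_injective Λ ?_⟩
  rw [map_smul, hx', ← Int.cast_smul_eq_zsmul ℝ, smul_smul]
  simp [h0]

theorem IsEvenUnimodular.isEven : (hΛ.toIntLattice Λ).IsEven := fun x => by
  obtain ⟨n, hn⟩ := hΛ.even _ (hΛ.incl_mem Λ x)
  refine ⟨n, ?_⟩
  rw [hΛ.form_incl] at hn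
  exact_mod_cast hn

theorem IsEvenUnimodular.eq_zero_of_bil {x : hΛ.toIntLattice Λ}
    (hx : ∀ y, (hΛ.toIntLattice Λ).bil x y = 0) : x = 0 := by
  apply hΛ.incl_injective Λ
  rw [map_zero]
  refine eq_zero_of_form_eq_zero fun y => ?_
  have hy : y ∈ Submodule.span ℝ (Λ : Set (Rpq p q)) := by
    rw [IsZLattice.span_top]
    trivial
  change formBilin p q _ y = 0
  induction hy using Submodule.span_induction with
  | zero => simp
  | add a b _ _ ha hb => simp [ha, hb]
  | smul c a _ ha => simp [ha]
  | mem a ha =>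
    obtain ⟨a, rfl⟩ := hΛ.exists_incl_eq Λ ha
    rw [formBilin_apply, hΛ.form_incl, hx, Int.cast_zero]

/-- Isometries of the lattice `Λ` extend to isometries of `ℝ^{p,q}`. -/
theorem IsEvenUnimodular.exists_extend (g : hΛ.toIntLattice Λ ≃ₗ[ℤ] hΛ.toIntLattice Λ)
    (hg : ∀ x y, (hΛ.toIntLattice Λ).bil (g x) (g y) = (hΛ.toIntLattice Λ).bil x y) :
    ∃ G ∈ latticeO Λ, ∀ x, G (hΛ.incl Λ x) = hΛ.incl Λ (g x) := by
  let g' : Λ ≃ₗ[ℤ] Λ := g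
  have : Module.Free ℤ Λ := ZLattice.module_free ℝ Λ
  let b := Module.Free.chooseBasis ℤ Λ
  let B := b.ofZLatticeBasis ℝ Λ
  let B' := (b.map g').ofZLatticeBasis ℝ Λ
  let G : Rpq p q ≃ₗ[ℝ] Rpq p q := B.equiv B' (Equiv.refl _)
  have hGb : ∀ i, G (b i : Rpq p q) = (g' (b i) : Rpq p q) := fun i => by
    have h1 := B.equiv_apply i B' (Equiv.refl _)
    rw [Basis.ofZLatticeBasis_apply] at h1
    simpa [B'] using h1
  have hG : ∀ x : Λ, G (x : Rpq p q) = (g' x : Rpq p q) := fun x => by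
    have h1 : (G.toLinearMap.restrictScalars ℤ) ∘ₗ Λ.subtype = Λ.subtype ∘ₗ g'.toLinearMap :=
      b.ext fun i => hGb i
    exact LinearMap.congr_fun h1 x
  refine ⟨G, ⟨fun x y => ?_, fun x => ⟨fun hx => ?_, fun hx => ?_⟩⟩, fun x => hG x⟩
  · have h1 : (formBilin p q).compl₁₂ G.toLinearMap G.toLinearMap = formBilin p q := by
      refine LinearMap.BilinForm.ext_basis B fun i j => ?_
      simp only [LinearMap.compl₁₂_apply, B, Basis.ofZLatticeBasis_apply, formBilin_apply]
      change form (G (b i : Rpq p q)) (G (b j : Rpq p q)) = _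
      rw [hG, hG]
      exact (hΛ.form_incl Λ (g (b i)) (g (b j))).trans
        ((congrArg _ (hg (b i) (b j))).trans (hΛ.form_incl Λ (b i) (b j)).symm)
    exact LinearMap.congr_fun₂ h1 x y
  · have h1 := hG (g'.symm ⟨G x, hx⟩)
    rw [g'.apply_symm_apply] at h1
    rw [← G.injective h1]
    exact Subtype.property _
  · rw [hG ⟨x, hx⟩]
    exact Subtype.property _

theorem IsEvenUnimodular.normNegTwo_iff (x : hΛ.toIntLattice Λ) :
    hΛ.incl Λ x ∈ normNegTwo Λ ↔ (hΛ.toIntLattice Λ).bil x x = -2 := by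
  constructor
  · rintro ⟨-, h⟩
    rw [hΛ.form_incl] at h
    exact_mod_cast h
  · intro h
    exact ⟨hΛ.incl_mem Λ x, by rw [hΛ.form_incl, h]; norm_num⟩

theorem IsEvenUnimodular.exists_hypPair (hp : 0 < p) (hq : 0 < q) :
    ∃ e f, (hΛ.toIntLattice Λ).HypPair 0 e f := by
  obtain ⟨N, hN, hN'⟩ := (hΛ.realized Λ).exists_isotropic (hΛ.finrank_toIntLattice Λ)
    (hΛ.unimodularAt Λ)
  obtain ⟨x, hx, hx0⟩ := IntLattice.exists_ne_zero_of_finrank_pos (N := N) (by omega)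
  exact IntLattice.exists_hypPair (hΛ.isEven Λ) (hΛ.unimodularAt Λ)
    (fun x => hΛ.eq_zero_of_bil Λ) hx0 (hN' x hx)

theorem IsEvenUnimodular.normNegTwo_nonempty (hΛ : IsEvenUnimodular Λ) (hp : 0 < p) (hq : 0 < q) :
    (normNegTwo Λ).Nonempty := by
  obtain ⟨e, f, h⟩ := hΛ.exists_hypPair Λ hp hq
  refine ⟨hΛ.incl Λ (e - f), (hΛ.normNegTwo_iff Λ _).mpr ?_⟩
  simp [h.ee, h.ff, h.ef, h.fe]

/-- Vectors of norm `-2` are equivalent under the automorphism group of the lattice, and orthogonal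
to a vector of norm `2`. -/
theorem IsEvenUnimodular.exists_latticeO (hΛ : IsEvenUnimodular Λ)
    (hpq : 2 ≤ p ∧ 2 ≤ q ∨ 1 ≤ p ∧ p + 2 ≤ q) {δ δ' : Rpq p q}
    (hδ : δ ∈ normNegTwo Λ) (hδ' : δ' ∈ normNegTwo Λ) :
    ∃ g ∈ latticeO Λ, g δ' = δ ∧ ∃ u ∈ Λ, form u u = 2 ∧ form u δ = 0 := by
  obtain ⟨d, rfl⟩ := hΛ.exists_incl_eq Λ hδ.1
  obtain ⟨d', rfl⟩ := hΛ.exists_incl_eq Λ hδ'.1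
  rw [hΛ.normNegTwo_iff] at hδ hδ'
  obtain ⟨x, hx0, hx, hxδ⟩ := (hΛ.realized Λ).exists_isotropic_orthogonal
    (hΛ.finrank_toIntLattice Λ) (hΛ.unimodularAt Λ) hpq hδ
  obtain ⟨e, f, h⟩ := IntLattice.exists_hypPair_orthogonal (hΛ.isEven Λ) (hΛ.unimodularAt Λ)
    (fun x => hΛ.eq_zero_of_bil Λ) hδ hx0 hx hxδ
  obtain ⟨g, hg, hgδ⟩ := IntLattice.exists_isometry_of_norm (hΛ.isEven Λ) (hΛ.unimodularAt Λ)
    hδ hδ' h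
  obtain ⟨G, hG, hGg⟩ := hΛ.exists_extend Λ g hg
  refine ⟨G, hG, by rw [hGg, hgδ], hΛ.incl Λ (e + f), hΛ.incl_mem Λ _, ?_, ?_⟩
  · rw [hΛ.form_incl]
    simp [h.ee, h.ff, h.ef, h.fe]
  · rw [hΛ.form_incl]
    simp [h.eδ, h.fδ]

end

theorem IsEvenUnimodular.eq_or_eq_neg (Λ : Submodule ℤ (Rpq 1 1)) [DiscreteTopology Λ]
    [IsZLattice ℝ Λ] (hΛ : IsEvenUnimodular Λ) {δ δ' : Rpq 1 1} (hδ : δ ∈ normNegTwo Λ)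
    (hδ' : δ' ∈ normNegTwo Λ) : δ' = δ ∨ δ' = -δ := by
  obtain ⟨e, f, h⟩ := hΛ.exists_hypPair Λ one_pos one_pos
  obtain ⟨d, rfl⟩ := hΛ.exists_incl_eq Λ hδ.1
  obtain ⟨d', rfl⟩ := hΛ.exists_incl_eq Λ hδ'.1
  rw [hΛ.normNegTwo_iff] at hδ hδ'
  have hr := (hΛ.finrank_toIntLattice Λ).le
  rw [← map_neg]
  rcases IntLattice.eq_or_eq_neg_of_finrank_le_two hr h hδ with rfl | rfl <;>
  rcases IntLattice.eq_or_eq_neg_of_finrank_le_two hr h hδ' with rfl | rfl <;> simp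

end EvenLattice

namespace EvenLattice

open Module

/-! ### Graph coordinates on the symmetric space -/

variable {p q : ℕ}

theorem sum_smul_graphFrame (τ : Fin p → Fin q → ℝ) (c : Fin p → ℝ) :
    ∑ j, c j • (Sum.elim (Pi.single j 1) (τ j) : Rpq p q) =
      Sum.elim c fun i => ∑ j, c j * τ j i := by
  funext i
  rcases i with i | i
  · simp [Finset.sum_apply, Pi.single_apply]
  · simp [Finset.sum_apply]

theorem mem_graphPlane_iff {τ : Fin p → Fin q → ℝ} {x : Rpq p q} :
    x ∈ graphPlane τ ↔ ∀ i, x (Sum.inr i) = ∑ j, x (Sum.inl j) * τ j i := by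
  rw [graphPlane, Submodule.mem_span_range_iff_exists_fun]
  simp only [sum_smul_graphFrame]
  constructor
  · rintro ⟨c, rfl⟩ i
    rfl
  · intro h
    refine ⟨fun j => x (Sum.inl j), funext fun i => ?_⟩
    rcases i with i | i
    · rfl
    · exact (h i).symm

theorem linearIndependent_graphFrame (τ : Fin p → Fin q → ℝ) :
    LinearIndependent ℝ fun j => (Sum.elim (Pi.single j 1) (τ j) : Rpq p q) := by
  rw [Fintype.linearIndependent_iff]
  intro c hc j
  rw [sum_smul_graphFrame] at hc
  exact congrFun hc (Sum.inl j)

theorem isPosPlane_graphPlane_iff {τ : Fin p → Fin q → ℝ} :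
    IsPosPlane (graphPlane τ) ↔
      ∀ c : Fin p → ℝ, c ≠ 0 → ∑ i, (∑ j, c j * τ j i) ^ 2 < ∑ j, c j ^ 2 := by
  have hrank : finrank ℝ (graphPlane τ) = p := by
    rw [graphPlane, finrank_span_eq_card (linearIndependent_graphFrame τ), Fintype.card_fin]
  rw [IsPosPlane, and_iff_right hrank]
  constructor
  · intro h c hc
    have h1 := h (Sum.elim c fun i => ∑ j, c j * τ j i) (mem_graphPlane_iff.mpr fun i => rfl)
      (fun h0 => hc (funext fun j => congrFun h0 (Sum.inl j)))
    simp only [form, Sum.elim_inl, Sum.elim_inr, ← pow_two] at h1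
    linarith
  · intro h x hx hx0
    rw [mem_graphPlane_iff] at hx
    have h1 := h (fun j => x (Sum.inl j)) (fun h0 => hx0 (funext fun i => by
      rcases i with i | i
      · exact congrFun h0 i
      · rw [hx]
        exact Finset.sum_eq_zero fun j _ => by
          rw [show x (Sum.inl j) = 0 from congrFun h0 j, zero_mul]))
    simp only [← hx] at h1
    simp only [form, ← pow_two]
    linarith

/-- On a positive definite subspace the projection to the positive coordinates is injective. -/
theorem IsPosPlane.eq_zero_of_inl {E : Submodule ℝ (Rpq p q)} (hE : IsPosPlane E) {x : Rpq p q}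
    (hx : x ∈ E) (h : ∀ j, x (Sum.inl j) = 0) : x = 0 := by
  by_contra h0
  have h1 := hE.2 x hx h0
  simp only [form, h, mul_zero, Finset.sum_const_zero, zero_sub, Left.neg_pos_iff] at h1
  exact h1.not_ge (Finset.sum_nonneg fun i _ => mul_self_nonneg _)

theorem IsPosPlane.exists_eq_graphPlane {E : Submodule ℝ (Rpq p q)} (hE : IsPosPlane E) :
    ∃ τ, graphPlane τ = E := by
  let π : Rpq p q →ₗ[ℝ] (Fin p → ℝ) := LinearMap.funLeft ℝ ℝ Sum.inl
  have hinj : Function.Injective (π.domRestrict E) := by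
    rw [← LinearMap.ker_eq_bot, eq_bot_iff]
    rintro ⟨x, hx⟩ h
    exact Subtype.ext (hE.eq_zero_of_inl hx fun j => congrFun (LinearMap.mem_ker.mp h) j)
  have hsurj : Function.Surjective (π.domRestrict E) :=
    (LinearMap.injective_iff_surjective_of_finrank_eq_finrank (by simp [hE.1])).mp hinj
  choose s hs using fun j : Fin p => hsurj (Pi.single j 1)
  have hs' : ∀ j k, (s j : Rpq p q) (Sum.inl k) = (Pi.single j 1 : Fin p → ℝ) k := fun j k =>
    congrFun (hs j) k
  refine ⟨fun j i => (s j : Rpq p q) (Sum.inr i), ?_⟩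
  have hle : graphPlane (fun j i => (s j : Rpq p q) (Sum.inr i)) ≤ E := by
    rw [graphPlane, Submodule.span_le]
    rintro _ ⟨j, rfl⟩
    have h1 : (Sum.elim (Pi.single j 1) fun i => (s j : Rpq p q) (Sum.inr i) : Rpq p q) = s j := by
      funext i
      rcases i with i | i
      · exact (hs' j i).symm
      · rfl
    exact Set.mem_of_eq_of_mem h1 (s j).2
  refine Submodule.eq_of_le_of_finrank_eq hle ?_
  rw [graphPlane, finrank_span_eq_card (linearIndependent_graphFrame _), Fintype.card_fin, hE.1]

/-! ### The orientation character -/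

theorem IsPosFrame.frameDet_ne_zero {e : Fin p → Rpq p q} (he : IsPosFrame e) :
    frameDet e ≠ 0 := by
  intro h0
  obtain ⟨v, hv, hv0⟩ := Matrix.exists_mulVec_eq_zero_iff.mpr h0
  have hli : LinearIndependent ℝ e := by
    rw [linearIndependent_iff_card_eq_finrank_span, Fintype.card_fin]
    exact he.1.symm
  rw [Fintype.linearIndependent_iff] at hli
  refine hv (funext fun j => hli v (he.eq_zero_of_inl ?_ fun i => ?_) j)
  · exact Submodule.sum_mem _ fun j _ =>
      Submodule.smul_mem _ _ (Submodule.subset_span ⟨j, rfl⟩)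
  · have h1 := congrFun hv0 i
    simp only [Matrix.mulVec, dotProduct, Matrix.of_apply, Pi.zero_apply] at h1
    simpa [Finset.sum_apply, mul_comm] using h1

/-- The standard positive definite frame. -/
noncomputable def stdFrame (p q : ℕ) : Fin p → Rpq p q := fun j => Sum.elim (Pi.single j 1) 0

/-- Shrinking the coordinates `τ` to `0` connects every positive definite subspace to the standard
one, so the sign by which an isometry changes the orientation is the same for all of them. -/
theorem frameDet_graphFrame_pos {g : Rpq p q ≃ₗ[ℝ] Rpq p q}
    (hg : ∀ x y, form (g x) (g y) = form x y) {τ : Fin p → Fin q → ℝ}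
    (hτ : IsPosPlane (graphPlane τ)) :
    0 < frameDet (fun j => g (Sum.elim (Pi.single j 1) (τ j))) *
      frameDet (fun j => g (stdFrame p q j)) := by
  let F : ℝ → ℝ := fun s => frameDet fun j => g (Sum.elim (Pi.single j 1) ((s • τ) j))
  have hcont : Continuous F := by
    have hg' : Continuous g := LinearMap.continuous_of_finiteDimensional g.toLinearMap
    refine Continuous.matrix_det (continuous_matrix fun i j => ?_)
    refine (continuous_apply (Sum.inl i)).comp (hg'.comp (continuous_pi fun k => ?_))
    rcases k with k | k
    · exact continuous_const
    · exact continuous_id.mul continuous_const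
  have hne : ∀ s ∈ Set.Icc (0 : ℝ) 1, F s ≠ 0 := fun s hs => by
    refine IsPosFrame.frameDet_ne_zero (isPosFrame_comp hg ?_)
    change IsPosPlane (graphPlane (s • τ))
    rw [isPosPlane_graphPlane_iff] at hτ ⊢
    intro c hc
    refine lt_of_le_of_lt (Finset.sum_le_sum fun i _ => ?_) (hτ c hc)
    have h1 : ∑ j, c j * (s • τ) j i = s * ∑ j, c j * τ j i := by
      rw [Finset.mul_sum]
      exact Finset.sum_congr rfl fun j _ => by simp only [Pi.smul_apply, smul_eq_mul]; ring
    rw [h1, mul_pow]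
    exact mul_le_of_le_one_left (sq_nonneg _) (pow_le_one₀ hs.1 hs.2)
  have h0 : F 0 = frameDet fun j => g (stdFrame p q j) := by simp [F, stdFrame]
  have h1 : F 1 = frameDet fun j => g (Sum.elim (Pi.single j 1) (τ j)) := by simp [F]
  rw [← h0, ← h1]
  by_contra! hle
  obtain ⟨s, hs, hs0⟩ : (0 : ℝ) ∈ F '' Set.Icc 0 1 := by
    rcases mul_nonpos_iff.mp hle with ⟨ha, hb⟩ | ⟨ha, hb⟩
    · exact intermediate_value_Icc zero_le_one hcont.continuousOn ⟨hb, ha⟩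
    · exact intermediate_value_Icc' zero_le_one hcont.continuousOn ⟨ha, hb⟩
  exact hne s hs hs0

/-- An isometry acts on the orientations of all positive definite subspaces as on that of the
standard one. -/
theorem frameDet_comp_pos {g : Rpq p q ≃ₗ[ℝ] Rpq p q}
    (hg : ∀ x y, form (g x) (g y) = form x y) {e : Fin p → Rpq p q} (he : IsPosFrame e) :
    0 < frameDet (fun j => g (e j)) * frameDet e * frameDet fun j => g (stdFrame p q j) := by
  obtain ⟨τ, hτ⟩ := IsPosPlane.exists_eq_graphPlane he
  have h1 : ∀ j, e j = ∑ k, e j (Sum.inl k) • (Sum.elim (Pi.single k 1) (τ k) : Rpq p q) :=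
    fun j => by
      have h2 : e j ∈ graphPlane τ := hτ ▸ Submodule.subset_span ⟨j, rfl⟩
      rw [sum_smul_graphFrame]
      funext i
      rcases i with i | i
      · rfl
      · exact mem_graphPlane_iff.mp h2 i
  have h2 : frameDet (fun j => g (e j)) =
      frameDet (fun j => g (Sum.elim (Pi.single j 1) (τ j))) * frameDet e := by
    rw [frameDet, frameDet, frameDet, ← Matrix.det_mul]
    congr 1
    ext i j
    rw [Matrix.of_apply, h1 j, map_sum]
    simp [Matrix.mul_apply, Finset.sum_apply, mul_comm]
  have h3 := frameDet_graphFrame_pos hg (τ := τ) (hτ ▸ he)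
  have h4 : 0 < frameDet e * frameDet e := mul_self_pos.mpr he.frameDet_ne_zero
  rw [h2]
  have h5 := mul_pos h3 h4
  calc _ < _ := h5
    _ = _ := by ring

theorem mem_latticeOPlus_of_frameDet_pos {Λ : Submodule ℤ (Rpq p q)} {g : Rpq p q ≃ₗ[ℝ] Rpq p q}
    (hg : g ∈ latticeO Λ) (h : 0 < frameDet fun j => g (stdFrame p q j)) : g ∈ latticeOPlus Λ := by
  refine ⟨hg, fun e he => ?_⟩
  have h1 := frameDet_comp_pos hg.1 he
  have h2 := (mul_pos_iff_of_pos_right h).mp h1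
  rcases mul_pos_iff.mp h2 with ⟨h3, h4⟩ | ⟨h3, h4⟩
  · exact iff_of_true h3 h4
  · exact iff_of_false h3.not_gt h4.not_gt

theorem isPosFrame_stdFrame : IsPosFrame (stdFrame p q) := by
  change IsPosPlane (graphPlane fun _ _ => (0 : ℝ))
  rw [isPosPlane_graphPlane_iff]
  intro c hc
  simp only [mul_zero, Finset.sum_const_zero, ne_eq, OfNat.ofNat_ne_zero, not_false_eq_true,
    zero_pow]
  obtain ⟨j, hj⟩ := Function.ne_iff.mp hc
  exact Finset.sum_pos' (fun j _ => sq_nonneg _) ⟨j, Finset.mem_univ j, by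
    have : c j ≠ 0 := hj
    positivity⟩

/-- The reflection in a lattice vector of norm `2` reverses the orientation. -/
theorem exists_reflection {Λ : Submodule ℤ (Rpq p q)} (hΛ : IsEvenUnimodular Λ) {u : Rpq p q}
    (hu : u ∈ Λ) (huu : form u u = 2) :
    ∃ r ∈ latticeO Λ, (∀ x, r x = x - form x u • u) ∧
      frameDet (fun j => r (stdFrame p q j)) < 0 := by
  have h : (formBilin p q).flip u u = 2 := huu
  have hr : ∀ x, reflection h x = x - form x u • u := fun x => reflection_apply x h
  have hmem : ∀ x ∈ Λ, reflection h x ∈ Λ := fun x hx => by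
    obtain ⟨n, hn⟩ := (hΛ.unimodular x).mp hx u hu
    rw [hr, hn, Int.cast_smul_eq_zsmul]
    exact Λ.sub_mem hx (Λ.smul_mem n hu)
  refine ⟨reflection h, ⟨fun x y => ?_, fun x => ⟨fun hx => ?_, hmem x⟩⟩, hr, ?_⟩
  · rw [hr, hr]
    simp only [← formBilin_apply] at huu ⊢
    simp only [map_sub, map_smul, LinearMap.sub_apply, LinearMap.smul_apply, smul_eq_mul, huu]
    rw [formBilin_apply u y, form_comm u y, ← formBilin_apply]
    ring
  · have h1 := hmem _ hx
    rwa [involutive_reflection h x] at h1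
  · have h1 : frameDet (fun j => reflection h (stdFrame p q j)) =
        (1 - Matrix.replicateCol Unit (fun i => u (Sum.inl i)) *
          Matrix.replicateRow Unit fun j => u (Sum.inl j)).det := by
      rw [frameDet]
      congr 1
      ext i j
      simp [hr, form, stdFrame, Matrix.one_apply, Pi.single_apply, Matrix.mul_apply, mul_comm]
    rw [h1, Matrix.det_one_sub_mul_comm, Matrix.det_unique]
    have h2 : 2 ≤ ∑ i, u (Sum.inl i) * u (Sum.inl i) := by
      have h3 := Finset.sum_nonneg (s := Finset.univ)
        (f := fun i => u (Sum.inr i) * u (Sum.inr i)) (fun i _ => mul_self_nonneg _)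
      rw [form] at huu
      linarith
    simp only [Matrix.sub_apply, Matrix.one_apply_eq, Matrix.mul_apply, Matrix.replicateRow_apply,
      Matrix.replicateCol_apply]
    linarith

/-- If `δ` is orthogonal to a vector of norm `2`, then the automorphisms carrying `δ'` to `δ` can be
corrected to preserve the orientation. -/
theorem exists_latticeOPlus {Λ : Submodule ℤ (Rpq p q)} (hΛ : IsEvenUnimodular Λ)
    {δ δ' : Rpq p q} {g : Rpq p q ≃ₗ[ℝ] Rpq p q} (hg : g ∈ latticeO Λ) (hgδ : g δ' = δ)
    {u : Rpq p q} (hu : u ∈ Λ) (huu : form u u = 2) (huδ : form u δ = 0) :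
    ∃ g ∈ latticeOPlus Λ, g δ' = δ := by
  have hpos : IsPosFrame fun j => g (stdFrame p q j) := isPosFrame_comp hg.1 isPosFrame_stdFrame
  rcases hpos.frameDet_ne_zero.lt_or_gt with h | h
  · obtain ⟨r, hr, hrx, hrd⟩ := exists_reflection hΛ hu huu
    refine ⟨r * g, mem_latticeOPlus_of_frameDet_pos ((latticeO Λ).mul_mem hr hg) ?_, ?_⟩
    · have h1 := frameDet_comp_pos hr.1 hpos
      exact pos_of_mul_neg_left (neg_of_mul_pos_left h1 hrd.le) h.le
    · change r (g δ') = δ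
      rw [hgδ, hrx, form_comm, huδ, zero_smul, sub_zero]
  · exact ⟨g, mem_latticeOPlus_of_frameDet_pos hg h, hgδ⟩

/-! ### Equivalence of the components of the discriminant locus -/

theorem toQuotient_smul (Λ : Submodule ℤ (Rpq p q)) (g : latticeOPlus Λ) (E : SymSpace p q) :
    toQuotient Λ (g • E) = toQuotient Λ E :=
  Quotient.sound ⟨g, rfl⟩

theorem smul_mem_orthLocus {Λ : Submodule ℤ (Rpq p q)} (g : latticeOPlus Λ) {E : SymSpace p q}
    {δ : Rpq p q} (hE : E ∈ orthLocus δ) :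
    g • E ∈ orthLocus ((g : Rpq p q ≃ₗ[ℝ] Rpq p q) δ) := by
  rintro _ ⟨x, hx, rfl⟩
  exact (g.2.1.1 x δ).trans (hE x hx)

theorem orthLocus_neg (δ : Rpq p q) : orthLocus (-δ) = (orthLocus δ : Set (SymSpace p q)) := by
  ext E
  refine forall₂_congr fun x _ => ?_
  rw [← formBilin_apply, map_neg, neg_eq_zero, formBilin_apply]

/-- All the sets `orthLocus δ` have the same image in the quotient. -/
theorem exists_mem_orthLocus_toQuotient_eq (hpq : p ≡ q [MOD 8]) (hdef : p ≤ q ∨ 2 ≤ q)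
    (Λ : Submodule ℤ (Rpq p q)) [DiscreteTopology Λ] [IsZLattice ℝ Λ] (hΛ : IsEvenUnimodular Λ)
    {δ δ' : Rpq p q} (hδ : δ ∈ normNegTwo Λ) (hδ' : δ' ∈ normNegTwo Λ) {E : SymSpace p q}
    (hE : E ∈ orthLocus δ') : ∃ E' ∈ orthLocus δ, toQuotient Λ E' = toQuotient Λ E := by
  by_cases hc : 2 ≤ p ∧ 2 ≤ q ∨ 1 ≤ p ∧ p + 2 ≤ q
  · obtain ⟨g, hg, hgδ, u, hu, huu, huδ⟩ := hΛ.exists_latticeO Λ hc hδ hδ'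
    obtain ⟨g, hg, rfl⟩ := exists_latticeOPlus hΛ hg hgδ hu huu huδ
    exact ⟨(⟨g, hg⟩ : latticeOPlus Λ) • E, smul_mem_orthLocus ⟨g, hg⟩ hE, toQuotient_smul _ _ _⟩
  have hc' : p = 0 ∨ p = 1 ∧ q = 1 := by
    rw [Nat.ModEq] at hpq
    omega
  refine ⟨E, ?_, rfl⟩
  rcases hc' with rfl | ⟨rfl, rfl⟩
  · intro x hx
    have h0 : x = 0 := E.2.eq_zero_of_inl hx fun j => j.elim0
    rw [h0, ← formBilin_apply, map_zero, LinearMap.zero_apply]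
  · rcases hΛ.eq_or_eq_neg Λ hδ hδ' with rfl | rfl
    · exact hE
    · rwa [orthLocus_neg] at hE

end EvenLattice

namespace EvenLattice

open Module Topology

/-! ### The components in graph coordinates -/

variable {p q : ℕ}

theorem graphPlane_mem_orthLocus_iff {σ : Fin p → Fin q → ℝ} (hσ : IsPosPlane (graphPlane σ))
    (δ : Rpq p q) :
    (⟨graphPlane σ, hσ⟩ : SymSpace p q) ∈ orthLocus δ ↔
      ∀ j, δ (Sum.inl j) - ∑ i, σ j i * δ (Sum.inr i) = 0 := by
  have h1 : (⟨graphPlane σ, hσ⟩ : SymSpace p q) ∈ orthLocus δ ↔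
      graphPlane σ ≤ LinearMap.ker ((formBilin p q).flip δ) := Iff.rfl
  rw [h1, graphPlane, Submodule.span_le, Set.range_subset_iff]
  refine forall_congr' fun j => ?_
  have h2 : form (Sum.elim (Pi.single j 1) (σ j) : Rpq p q) δ =
      δ (Sum.inl j) - ∑ i, σ j i * δ (Sum.inr i) := by
    simp [form, Pi.single_apply]
  rw [← h2]
  rfl

theorem form_self (x : Rpq p q) :
    form x x = ∑ j, x (Sum.inl j) ^ 2 - ∑ i, x (Sum.inr i) ^ 2 := by
  simp only [form, pow_two]

theorem orthLocus_nonempty {δ : Rpq p q} (hδ : form δ δ = -2) :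
    (orthLocus δ : Set (SymSpace p q)).Nonempty := by
  rw [form_self] at hδ
  set a := ∑ j, δ (Sum.inl j) ^ 2 with ha
  set b := ∑ i, δ (Sum.inr i) ^ 2 with hb
  have ha0 : 0 ≤ a := Finset.sum_nonneg fun j _ => sq_nonneg _
  have hb0 : 0 < b := by linarith
  -- `graphPlane τ` is the orthogonal complement of `δ` in `ℝ^p ⊕ ℝ δ⁻`
  let τ : Fin p → Fin q → ℝ := fun j i => δ (Sum.inl j) * δ (Sum.inr i) / b
  have hτ : IsPosPlane (graphPlane τ) := by
    rw [isPosPlane_graphPlane_iff]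
    intro c hc
    have hc0 : 0 < ∑ j, c j ^ 2 := by
      obtain ⟨j, hj⟩ := Function.ne_iff.mp hc
      exact Finset.sum_pos' (fun j _ => sq_nonneg _) ⟨j, Finset.mem_univ j, sq_pos_of_ne_zero hj⟩
    have h1 : ∀ i, ∑ j, c j * τ j i = (∑ j, c j * δ (Sum.inl j)) / b * δ (Sum.inr i) := fun i => by
      rw [Finset.sum_div, Finset.sum_mul]
      exact Finset.sum_congr rfl fun j _ => by simp only [τ]; ring
    have h2 := Finset.sum_mul_sq_le_sq_mul_sq Finset.univ c fun j => δ (Sum.inl j)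
    rw [← ha] at h2
    simp only [h1, mul_pow, ← Finset.mul_sum, ← hb]
    have h3 : ((∑ j, c j * δ (Sum.inl j)) / b) ^ 2 * b = (∑ j, c j * δ (Sum.inl j)) ^ 2 / b := by
      field_simp
    rw [h3, div_lt_iff₀ hb0]
    refine h2.trans_lt ?_
    exact mul_lt_mul_of_pos_left (by linarith) hc0
  refine ⟨⟨graphPlane τ, hτ⟩, (graphPlane_mem_orthLocus_iff hτ δ).mpr fun j => ?_⟩
  have h1 : ∑ i, τ j i * δ (Sum.inr i) = δ (Sum.inl j) / b * b := by
    rw [hb, Finset.mul_sum]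
    exact Finset.sum_congr rfl fun i _ => by simp only [τ]; ring
  rw [h1, div_mul_cancel₀ _ hb0.ne', sub_self]

/-- The coordinate domain of the symmetric space is convex. -/
theorem isPosPlane_lineMap {σ τ : Fin p → Fin q → ℝ} (hσ : IsPosPlane (graphPlane σ))
    (hτ : IsPosPlane (graphPlane τ)) {t : ℝ} (ht : t ∈ Set.Icc (0 : ℝ) 1) :
    IsPosPlane (graphPlane ((1 - t) • σ + t • τ)) := by
  rw [isPosPlane_graphPlane_iff] at hσ hτ ⊢
  intro c hc
  have h1 : ∀ i, (∑ j, c j * ((1 - t) • σ + t • τ) j i) ^ 2 ≤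
      (1 - t) * (∑ j, c j * σ j i) ^ 2 + t * (∑ j, c j * τ j i) ^ 2 := fun i => by
    have h2 : ∑ j, c j * ((1 - t) • σ + t • τ) j i =
        (1 - t) * ∑ j, c j * σ j i + t * ∑ j, c j * τ j i := by
      rw [Finset.mul_sum, Finset.mul_sum, ← Finset.sum_add_distrib]
      exact Finset.sum_congr rfl fun j _ => by
        simp only [Pi.add_apply, Pi.smul_apply, smul_eq_mul]
        ring
    rw [h2]
    have h3 : 0 ≤ (1 - t) * t * (∑ j, c j * σ j i - ∑ j, c j * τ j i) ^ 2 :=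
      mul_nonneg (mul_nonneg (sub_nonneg.mpr ht.2) ht.1) (sq_nonneg _)
    linarith
  refine (Finset.sum_le_sum fun i _ => h1 i).trans_lt ?_
  rw [Finset.sum_add_distrib, ← Finset.mul_sum, ← Finset.mul_sum]
  have h4 := hσ c hc
  have h5 := hτ c hc
  rcases ht.1.eq_or_lt with rfl | h0
  · linarith
  · have h6 := mul_lt_mul_of_pos_left h5 h0
    have h7 := mul_le_mul_of_nonneg_left h4.le (sub_nonneg.mpr ht.2)
    linarith

/-! ### Local finiteness and analyticity -/

/-- The matrices in a neighbourhood of a point of the coordinate domain have operator norm bounded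
by a constant less than `1`. -/
theorem exists_uniform_bound {τ : Fin p → Fin q → ℝ} (hτ : IsPosPlane (graphPlane τ)) :
    ∃ c : ℝ, 0 ≤ c ∧ c < 1 ∧ ∀ᶠ σ in 𝓝 τ, ∀ v : Fin p → ℝ,
      ∑ i, (∑ j, v j * σ j i) ^ 2 ≤ c * ∑ j, v j ^ 2 := by
  rw [isPosPlane_graphPlane_iff] at hτ
  let F : (Fin p → Fin q → ℝ) × (Fin p → ℝ) → ℝ := fun z => ∑ i, (∑ j, z.2 j * z.1 j i) ^ 2
  have hF : Continuous F := by fun_prop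
  let K : Set (Fin p → ℝ) := {v | ∑ j, v j ^ 2 = 1}
  have hK : IsCompact K := by
    refine Metric.isCompact_of_isClosed_isBounded (isClosed_eq (by fun_prop) continuous_const) ?_
    refine (Metric.isBounded_closedBall (x := (0 : Fin p → ℝ)) (r := 1)).subset fun v hv => ?_
    rw [mem_closedBall_zero_iff, pi_norm_le_iff_of_nonneg zero_le_one]
    intro j
    rw [Real.norm_eq_abs, abs_le_one_iff_mul_self_le_one, ← pow_two, ← (show _ = (1 : ℝ) from hv)]
    exact Finset.single_le_sum (f := fun j => v j ^ 2) (fun j _ => sq_nonneg _) (Finset.mem_univ j)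
  have hlt : ∀ v ∈ K, F (τ, v) < 1 := fun v hv => by
    have h1 := hτ v (by
      rintro rfl
      have h2 : ∑ j : Fin p, (0 : Fin p → ℝ) j ^ 2 = 1 := hv
      simp at h2)
    rwa [show ∑ j, v j ^ 2 = 1 from hv] at h1
  obtain ⟨c, hc0, hc1, hc⟩ : ∃ c, 0 ≤ c ∧ c < 1 ∧ ∀ v ∈ K, F (τ, v) < c := by
    rcases K.eq_empty_or_nonempty with h0 | h0
    · exact ⟨0, le_rfl, zero_lt_one, by simp [h0]⟩
    · obtain ⟨w, hw, hmax⟩ := hK.exists_isMaxOn h0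
        (f := fun v => F (τ, v)) (hF.comp (Continuous.prodMk_right τ)).continuousOn
      obtain ⟨c, hc, hc1⟩ := exists_between (hlt w hw)
      exact ⟨c, (Finset.sum_nonneg fun i _ => sq_nonneg _).trans hc.le, hc1,
        fun v hv => (hmax hv).trans_lt hc⟩
  refine ⟨c, hc0, hc1, ?_⟩
  have hev : ∀ᶠ σ in 𝓝 τ, ∀ v ∈ K, F (σ, v) < c :=
    hK.eventually_forall_of_forall_eventually fun v hv =>
      hF.continuousAt.eventually_lt continuousAt_const (hc v hv)
  filter_upwards [hev] with σ hσ v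
  rcases (Finset.sum_nonneg fun j _ => sq_nonneg (v j) :
    (0 : ℝ) ≤ ∑ j, v j ^ 2).eq_or_lt with h0 | h0
  · have h1 : ∀ j, v j = 0 := fun j => by
      have h2 := (Finset.sum_eq_zero_iff_of_nonneg fun j _ => sq_nonneg (v j)).mp h0.symm j
        (Finset.mem_univ j)
      exact pow_eq_zero_iff two_ne_zero |>.mp h2
    simp [h1]
  · set s := Real.sqrt (∑ j, v j ^ 2) with hs
    have hs0 : 0 < s := Real.sqrt_pos.mpr h0
    have hs2 : s ^ 2 = ∑ j, v j ^ 2 := Real.sq_sqrt h0.le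
    have h1 := hσ (s⁻¹ • v) (by
      change ∑ j, (s⁻¹ • v) j ^ 2 = 1
      simp only [Pi.smul_apply, smul_eq_mul, mul_pow, ← Finset.mul_sum, ← hs2]
      field_simp)
    have h2 : F (σ, s⁻¹ • v) = (s ^ 2)⁻¹ * ∑ i, (∑ j, v j * σ j i) ^ 2 := by
      simp only [F, Pi.smul_apply, smul_eq_mul, mul_assoc, ← Finset.mul_sum, mul_pow, inv_pow]
    rw [h2, inv_mul_lt_iff₀ (by positivity), hs2] at h1
    linarith

/-- Vectors of norm `-2` orthogonal to a subspace near a given one are bounded. -/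
theorem norm_sq_le_of_mem_orthLocus {σ : Fin p → Fin q → ℝ} {c : ℝ} (hc0 : 0 ≤ c)
    (hc : c < 1)
    (hσ : ∀ v : Fin p → ℝ, ∑ i, (∑ j, v j * σ j i) ^ 2 ≤ c * ∑ j, v j ^ 2)
    {δ : Rpq p q} (hδ : form δ δ = -2)
    (h : ∀ j, δ (Sum.inl j) - ∑ i, σ j i * δ (Sum.inr i) = 0) (k : Fin p ⊕ Fin q) :
    δ k ^ 2 ≤ 2 / (1 - c) := by
  rw [form_self] at hδ
  set a := ∑ j, δ (Sum.inl j) ^ 2 with ha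
  set b := ∑ i, δ (Sum.inr i) ^ 2 with hb
  have ha0 : 0 ≤ a := Finset.sum_nonneg fun j _ => sq_nonneg _
  have h1 : a = ∑ i, δ (Sum.inr i) * ∑ j, δ (Sum.inl j) * σ j i := by
    simp only [Finset.mul_sum]
    rw [Finset.sum_comm, ha]
    refine Finset.sum_congr rfl fun j _ => ?_
    rw [pow_two]
    nth_rewrite 2 [sub_eq_zero.mp (h j)]
    rw [Finset.mul_sum]
    exact Finset.sum_congr rfl fun i _ => by ring
  have h2 : a ^ 2 ≤ b * (c * a) := by
    have h3 := Finset.sum_mul_sq_le_sq_mul_sq Finset.univ (fun i => δ (Sum.inr i))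
      fun i => ∑ j, δ (Sum.inl j) * σ j i
    rw [← h1, ← hb] at h3
    exact h3.trans (mul_le_mul_of_nonneg_left (hσ _) (by linarith))
  have h4 : b * (1 - c) ≤ 2 := by
    rcases ha0.eq_or_lt with h0 | h0
    · have h5 : 0 ≤ b := by linarith
      have h6 := mul_nonneg h5 hc0
      linarith
    · have h5 : a ≤ b * c := by
        have h6 : a * a ≤ b * c * a := by linarith [h2]
        exact le_of_mul_le_mul_right h6 h0
      linarith
  have h5 : b ≤ 2 / (1 - c) := by rwa [le_div_iff₀ (by linarith)]
  rcases k with j | i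
  · have h6 := Finset.single_le_sum (f := fun j => δ (Sum.inl j) ^ 2) (fun j _ => sq_nonneg _)
      (Finset.mem_univ j)
    linarith
  · have h6 := Finset.single_le_sum (f := fun i => δ (Sum.inr i) ^ 2) (fun i _ => sq_nonneg _)
      (Finset.mem_univ i)
    linarith

theorem mem_toQuotient_preimage_iff {Λ : Submodule ℤ (Rpq p q)} {E : SymSpace p q} :
    E ∈ toQuotient Λ ⁻¹' discriminantLocus Λ ↔ ∃ δ ∈ normNegTwo Λ, E ∈ orthLocus δ := by
  constructor
  · rintro ⟨E', hE', h⟩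
    obtain ⟨g, rfl⟩ : E ∈ MulAction.orbit (latticeOPlus Λ) E' :=
      MulAction.orbitRel_apply.mp (Quotient.exact h.symm)
    simp only [Set.mem_iUnion] at hE'
    obtain ⟨δ, hδ, hδE⟩ := hE'
    refine ⟨(g : Rpq p q ≃ₗ[ℝ] Rpq p q) δ, ⟨(g.2.1.2 δ).mpr hδ.1, ?_⟩, smul_mem_orthLocus g hδE⟩
    rw [g.2.1.1, hδ.2]
  · rintro ⟨δ, hδ, hδE⟩
    refine ⟨E, ?_, rfl⟩
    simp only [Set.mem_iUnion]
    exact ⟨δ, hδ, hδE⟩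

/-- The family of the sets `orthLocus δ` is locally finite, and a finite union of them is the zero
set of a product. -/
theorem isQuotientAnalytic_discriminantLocus (Λ : Submodule ℤ (Rpq p q)) [DiscreteTopology Λ] :
    IsQuotientAnalytic (discriminantLocus Λ) := by
  intro τ hτ
  obtain ⟨c, hc0, hc1, hO⟩ := exists_uniform_bound hτ
  have hfin : {δ | δ ∈ normNegTwo Λ ∧ ∀ k, δ k ^ 2 ≤ 2 / (1 - c)}.Finite := by
    have hcl : IsClosed (Λ : Set (Rpq p q)) := by
      rw [← Submodule.coe_toAddSubgroup]
      have : DiscreteTopology Λ.toAddSubgroup := inferInstanceAs (DiscreteTopology Λ)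
      exact AddSubgroup.isClosed_of_discrete
    refine (Metric.finite_isBounded_inter_isClosed (K := Metric.closedBall 0 √(2 / (1 - c)))
      (s := (Λ : Set (Rpq p q))) DiscreteTopology.isDiscrete
      Metric.isBounded_closedBall hcl).subset fun δ hδ => ⟨?_, hδ.1.1⟩
    rw [mem_closedBall_zero_iff, pi_norm_le_iff_of_nonneg (Real.sqrt_nonneg _)]
    exact fun k => Real.abs_le_sqrt (hδ.2 k)
  refine ⟨_, hO, 1, fun _ σ => ∏ δ ∈ hfin.toFinset,
    ∑ j, (δ (Sum.inl j) - ∑ i, σ j i * δ (Sum.inr i)) ^ 2, fun _ => ?_, fun σ hσO hσ => ?_⟩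
  · have hcoord : ∀ j i σ, AnalyticAt ℝ (fun σ : Fin p → Fin q → ℝ => σ j i) σ := fun j i σ =>
      ((ContinuousLinearMap.proj (R := ℝ) (φ := fun _ : Fin q => ℝ) i).comp
        (ContinuousLinearMap.proj (R := ℝ) (φ := fun _ : Fin p => Fin q → ℝ) j)).analyticAt σ
    exact fun σ _ => Finset.analyticAt_fun_prod _ fun δ _ =>
      Finset.analyticAt_fun_sum _ fun j _ => (analyticAt_const.sub
        (Finset.analyticAt_fun_sum _ fun i _ => (hcoord j i σ).mul analyticAt_const)).pow 2
  · have hzero : ∀ δ : Rpq p q, ∑ j, (δ (Sum.inl j) - ∑ i, σ j i * δ (Sum.inr i)) ^ 2 = 0 ↔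
        ∀ j, δ (Sum.inl j) - ∑ i, σ j i * δ (Sum.inr i) = 0 := fun δ => by
      rw [Finset.sum_eq_zero_iff_of_nonneg fun j _ => sq_nonneg _]
      simp only [Finset.mem_univ, true_imp_iff, pow_eq_zero_iff two_ne_zero]
    refine (mem_toQuotient_preimage_iff (Λ := Λ) (E := ⟨graphPlane σ, hσ⟩)).trans ?_
    rw [forall_const, Finset.prod_eq_zero_iff]
    simp only [hzero, Set.Finite.mem_toFinset, Set.mem_ofPred_eq]
    constructor
    · rintro ⟨δ, hδ, h⟩
      replace h := (graphPlane_mem_orthLocus_iff hσ δ).mp h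
      exact ⟨δ, ⟨hδ, norm_sq_le_of_mem_orthLocus hc0 hc1 hσO hδ.2 h⟩, h⟩
    · rintro ⟨δ, ⟨hδ, -⟩, h⟩
      exact ⟨δ, hδ, (graphPlane_mem_orthLocus_iff hσ δ).mpr h⟩

/-! ### Irreducibility -/

/-- Along a line, an analytic set contains a full neighbourhood of a point or avoids a punctured
one. -/
theorem IsAnalyticSubset.eventually_or {A : Set (SymSpace p q)} (hA : IsAnalyticSubset A)
    {γ : ℝ → Fin p → Fin q → ℝ} {t : ℝ} (hγ : AnalyticAt ℝ γ t)
    (ht : IsPosPlane (graphPlane (γ t))) :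
    (∀ᶠ s in 𝓝 t, ∀ h : IsPosPlane (graphPlane (γ s)), (⟨_, h⟩ : SymSpace p q) ∈ A) ∨
    ∀ᶠ s in 𝓝[≠] t, ∀ h : IsPosPlane (graphPlane (γ s)), (⟨_, h⟩ : SymSpace p q) ∉ A := by
  obtain ⟨O, hO, n, f, hf, hfA⟩ := hA (γ t) ht
  have hO' : ∀ᶠ s in 𝓝 t, γ s ∈ O := hγ.continuousAt.eventually_mem hO
  have hfγ : ∀ k, AnalyticAt ℝ (fun s => f k (γ s)) t := fun k =>
    (hf k _ (mem_of_mem_nhds hO)).comp hγ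
  by_cases hall : ∀ k, ∀ᶠ s in 𝓝 t, f k (γ s) = 0
  · left
    filter_upwards [hO', Filter.eventually_all.mpr hall] with s hs hk h
    exact (hfA _ hs h).mpr hk
  · right
    obtain ⟨k, hk⟩ := not_forall.mp hall
    have h1 := (hfγ k).eventually_eq_zero_or_eventually_ne_zero.resolve_left hk
    filter_upwards [h1, hO'.filter_mono nhdsWithin_le_nhds] with s hs hsO h hmem
    exact hs ((hfA _ hsO h).mp hmem k)

/-- A segment covered by two analytic sets lies in one of them. -/
theorem segment_subset_or {A B : Set (SymSpace p q)} (hA : IsAnalyticSubset A)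
    (hB : IsAnalyticSubset B) {γ : ℝ → Fin p → Fin q → ℝ} (hγ : ∀ t, AnalyticAt ℝ γ t)
    (hpos : ∀ t ∈ Set.Icc (0 : ℝ) 1, IsPosPlane (graphPlane (γ t)))
    (hAB : ∀ t ∈ Set.Icc (0 : ℝ) 1, ∀ h : IsPosPlane (graphPlane (γ t)),
      (⟨_, h⟩ : SymSpace p q) ∈ A ∪ B) :
    (∀ t ∈ Set.Icc (0 : ℝ) 1, ∀ h : IsPosPlane (graphPlane (γ t)),
      (⟨_, h⟩ : SymSpace p q) ∈ A) ∨
    ∀ t ∈ Set.Icc (0 : ℝ) 1, ∀ h : IsPosPlane (graphPlane (γ t)), (⟨_, h⟩ : SymSpace p q) ∈ B := by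
  let U : Set ℝ := {t | ∀ᶠ s in 𝓝 t, ∀ h : IsPosPlane (graphPlane (γ s)),
    (⟨_, h⟩ : SymSpace p q) ∈ A}
  let V : Set ℝ := {t | ∀ᶠ s in 𝓝[≠] t, ∀ h : IsPosPlane (graphPlane (γ s)),
    (⟨_, h⟩ : SymSpace p q) ∉ A}
  have hU : IsOpen U := isOpen_iff_mem_nhds.mpr fun t ht => eventually_eventually_nhds.mpr ht
  have hV : IsOpen V := isOpen_iff_mem_nhds.mpr fun t ht => by
    have h1 : ∀ᶠ s in 𝓝[≠] t, s ∈ V := by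
      filter_upwards [eventually_eventually_nhdsWithin.mpr ht, self_mem_nhdsWithin] with s hs hst
      rw [(isOpen_compl_singleton).nhdsWithin_eq hst] at hs
      exact hs.filter_mono nhdsWithin_le_nhds
    have h2 : insert t V ∈ 𝓝 t := insert_mem_nhds_iff.mpr h1
    rwa [Set.insert_eq_of_mem ht] at h2
  have hcover : Set.Icc (0 : ℝ) 1 ⊆ U ∪ V := fun t ht => hA.eventually_or (hγ t) (hpos t ht)
  -- every punctured neighbourhood of a point of the interval meets the interval
  have hfreq : ∀ t ∈ Set.Icc (0 : ℝ) 1, ∃ᶠ s in 𝓝[≠] t, s ∈ Set.Icc (0 : ℝ) 1 := fun t ht => by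
    have h1 : AccPt t (Filter.principal (Set.Icc (0 : ℝ) 1)) :=
      (isPreconnected_Icc.preperfect_of_nontrivial ⟨0, by simp, 1, by simp, zero_ne_one⟩) t ht
    exact accPt_iff_frequently_nhdsNE.mp h1
  by_cases hne : (Set.Icc (0 : ℝ) 1 ∩ V).Nonempty
  · right
    have hsub : Set.Icc (0 : ℝ) 1 ⊆ V := by
      by_contra hnot
      obtain ⟨t, ht, htV⟩ := Set.not_subset.mp hnot
      obtain ⟨s, hs, hsU, hsV⟩ := isPreconnected_Icc U V hU hV hcover
        ⟨t, ht, (hcover ht).resolve_right htV⟩ hne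
      obtain ⟨r, hr, h1, h2⟩ := ((hfreq s hs).and_eventually
        ((Filter.Eventually.filter_mono nhdsWithin_le_nhds hsU).and hsV)).exists
      exact h2 (hpos r hr) (h1 (hpos r hr))
    intro t ht h
    rcases hB.eventually_or (hγ t) h with h1 | h1
    · exact h1.self_of_nhds h
    · obtain ⟨r, hr, h2, h3⟩ := ((hfreq t ht).and_eventually
        (h1.and (hsub ht))).exists
      exact ((hAB r hr (hpos r hr)).elim (h3 _) (h2 _)).elim
  · left
    intro t ht h
    have h1 : t ∈ U := (hcover ht).resolve_right fun h2 => hne ⟨t, ht, h2⟩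
    exact Filter.Eventually.self_of_nhds h1 h

/-- In graph coordinates `orthLocus δ` is convex, so any two of its points lie on a segment in
it. -/
theorem orthLocus_subset_or {A B : Set (SymSpace p q)} (hA : IsAnalyticSubset A)
    (hB : IsAnalyticSubset B) {δ : Rpq p q} (h : orthLocus δ ⊆ A ∪ B) :
    orthLocus δ ⊆ A ∨ orthLocus δ ⊆ B := by
  by_contra! hnot
  obtain ⟨⟨⟨E, hE⟩, hEδ, hEA⟩, ⟨⟨E', hE'⟩, hEδ', hEB⟩⟩ := hnot.imp Set.not_subset.mp
    Set.not_subset.mp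
  obtain ⟨σ, rfl⟩ := hE.exists_eq_graphPlane
  obtain ⟨τ, rfl⟩ := hE'.exists_eq_graphPlane
  let γ : ℝ → Fin p → Fin q → ℝ := fun t => (1 - t) • σ + t • τ
  have hγ : ∀ t, AnalyticAt ℝ γ t := fun t =>
    ((analyticAt_const.sub analyticAt_id).smul analyticAt_const).add
      (analyticAt_id.smul analyticAt_const)
  have hpos : ∀ t ∈ Set.Icc (0 : ℝ) 1, IsPosPlane (graphPlane (γ t)) := fun t ht =>
    isPosPlane_lineMap hE hE' ht
  replace hEδ := (graphPlane_mem_orthLocus_iff hE δ).mp hEδ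
  replace hEδ' := (graphPlane_mem_orthLocus_iff hE' δ).mp hEδ'
  have hmem : ∀ t ∈ Set.Icc (0 : ℝ) 1, ∀ h : IsPosPlane (graphPlane (γ t)),
      (⟨_, h⟩ : SymSpace p q) ∈ A ∪ B := fun t _ ht => by
    refine h ((graphPlane_mem_orthLocus_iff ht δ).mpr fun j => ?_)
    have h1 : ∑ i, γ t j i * δ (Sum.inr i) =
        (1 - t) * ∑ i, σ j i * δ (Sum.inr i) + t * ∑ i, τ j i * δ (Sum.inr i) := by
      rw [Finset.mul_sum, Finset.mul_sum, ← Finset.sum_add_distrib]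
      exact Finset.sum_congr rfl fun i _ => by
        simp only [γ, Pi.add_apply, Pi.smul_apply, smul_eq_mul]
        ring
    rw [h1, ← sub_eq_zero.mp (hEδ j), ← sub_eq_zero.mp (hEδ' j)]
    ring
  have h0 : γ 0 = σ := by simp [γ]
  have h1 : γ 1 = τ := by simp [γ]
  rcases segment_subset_or hA hB hγ hpos hmem with h2 | h2
  · have h3 := h2 0 (by simp)
    simp only [h0] at h3
    exact hEA (h3 hE)
  · have h3 := h2 1 (by simp)
    simp only [h1] at h3
    exact hEB (h3 hE')

end EvenLattice

open EvenLattice in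
theorem mainTheorem5 (p q : ℕ) (hpq : p ≡ q [MOD 8]) (hq : 0 < q) (hdef : p ≤ q ∨ 2 ≤ q)
    (Λ : Submodule ℤ (EvenLattice.Rpq p q)) [DiscreteTopology Λ] [IsZLattice ℝ Λ]
    (hΛ : EvenLattice.IsEvenUnimodular Λ)
    (hp : p = 0 → (EvenLattice.normNegTwo Λ).Nonempty) :
    EvenLattice.IsIrreducibleAnalytic (EvenLattice.discriminantLocus Λ) := by
  have hne : (normNegTwo Λ).Nonempty := by
    rcases Nat.eq_zero_or_pos p with h | h
    · exact hp h
    · exact hΛ.normNegTwo_nonempty Λ h hq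
  obtain ⟨δ, hδ⟩ := hne
  -- the discriminant locus is the image of `orthLocus δ`
  have hle : ∀ A : Set (ModularQuotient Λ), orthLocus δ ⊆ toQuotient Λ ⁻¹' A →
      discriminantLocus Λ ⊆ A := by
    rintro A hA _ ⟨E, hE, rfl⟩
    simp only [Set.mem_iUnion] at hE
    obtain ⟨δ', hδ', hEδ'⟩ := hE
    obtain ⟨E', hE', h⟩ := exists_mem_orthLocus_toQuotient_eq hpq hdef Λ hΛ hδ hδ' hEδ'
    exact h ▸ hA hE'
  refine ⟨isQuotientAnalytic_discriminantLocus Λ, ?_, fun A B hA hB hAB => ?_⟩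
  · obtain ⟨E, hE⟩ := orthLocus_nonempty hδ.2
    exact ⟨toQuotient Λ E, mem_toQuotient_preimage_iff.mpr ⟨δ, hδ, hE⟩⟩
  · have hsub : orthLocus δ ⊆ toQuotient Λ ⁻¹' A ∪ toQuotient Λ ⁻¹' B := fun E hE => by
      have h1 : toQuotient Λ E ∈ discriminantLocus Λ :=
        mem_toQuotient_preimage_iff.mpr ⟨δ, hδ, hE⟩
      rwa [hAB] at h1
    rcases orthLocus_subset_or hA hB hsub with h | h
    · exact Or.inl ((hle A h).antisymm (hAB ▸ Set.subset_union_left))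
    · exact Or.inr ((hle B h).antisymm (hAB ▸ Set.subset_union_right))
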